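/- Let $X_1,X_2,\dots$ be i.i.d. random vectors in $\mathbb R^d$ with mean $\mu$, covariance matrix $V$ and $E\|X_1\|^r<\infty$ for some $r>3$; write $S_n=X_1+\cdots+X_n$ and $\bar X_n=S_n/n$. Let $0<\epsilon_0<\epsilon_1$, and let $n_0(a),n_1(a)$ be integer-valued functions with $n_0(a)\sim a/\epsilon_0$ and $n_1(a)\sim a/\epsilon_1$ as $a\to\infty$. Let $g:\mathbb R^d\to\mathbb R$ be measurable, continuously differentiable in a neighbourhood of $\mu$, with $g(\mu)\ne\epsilon_0$ and $g(\mu)\neq\epsilon_1$. Put $$t_a=\inf\{n\ge 1: n\,g(S_n/n)\ge a\}\quad(\inf\emptyset=\infty),\qquad T=T_a=\min\{n_0(a),\max(t_a,n_1(a))\}.$$ Let $h:\mathbb R^d\to\mathbb R$ be measurable and twice continuously differentiable in a neighbourhood of $\mu$, and suppose that for some constant $C$, for all sufficiently large $n$, $|h(\bar X_n)|\le C(1+\|\bar X_n\|^r)$ almost surely (this holds in particular if $|h(x)|\le C(1+\|x\|^r)$ for all $x$). Let $\kappa(x)=\max\{\epsilon_0,\min(g(x),\epsilon_1)\}$. Then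 $\kappa^{1/2}$ is differentiable at $\mu$, the random variable $\sqrt T\{h(\bar X_T)-h(\mu)\}$ is integrable for all sufficiently large $a$, and, as $a\to\infty$, $$E\big[\sqrt T\{h(\bar X_T)-h(\mu)\}\big]=b(\mu,V)\Big(\frac{\kappa(\mu)}{a}\Big)^{1/2}+o(a^{-1/2}),$$ where $$b(\mu,V)=\frac{(\nabla\kappa^{1/2}(\mu))'\,V\,\nabla h(\mu)}{\kappa^{1/2}(\mu)}+\frac12\operatorname{tr}\big(\nabla^2h(\mu)V\big).$$ -/

import Mathlib

open MeasureTheory ProbabilityTheory Filter Asymptotics Topology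
open scoped Matrix

namespace SeqBias

noncomputable section

/-- The sample mean `S_n / n`, where `S_n` is the sum of the first `n` vectors of the sequence
(the sequence is indexed from `0`). -/
def sampleMean {d : ℕ} {Ω : Type*} (X : ℕ → Ω → EuclideanSpace ℝ (Fin d)) (n : ℕ) (ω : Ω) :
    EuclideanSpace ℝ (Fin d) :=
  (n : ℝ)⁻¹ • ∑ i ∈ Finset.range n, X i ω

/-- The first passage time `t_a = inf {n ≥ 1 : n g(S_n / n) ≥ a}`, with `inf ∅ = ∞`. -/
def passageTime {d : ℕ} {Ω : Type*} (X : ℕ → Ω → EuclideanSpace ℝ (Fin d))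
    (g : EuclideanSpace ℝ (Fin d) → ℝ) (a : ℝ) (ω : Ω) : ℕ∞ :=
  sInf ((fun n : ℕ => (n : ℕ∞)) '' {n : ℕ | 1 ≤ n ∧ a ≤ (n : ℝ) * g (sampleMean X n ω)})

/-- The stopping rule `T = min {n₀(a), max (t_a, n₁(a))}`. It is at most `n₀(a)`, so the
conversion to a natural number loses nothing. -/
def stopRule {d : ℕ} {Ω : Type*} (X : ℕ → Ω → EuclideanSpace ℝ (Fin d))
    (g : EuclideanSpace ℝ (Fin d) → ℝ) (n₀ n₁ : ℝ → ℕ) (a : ℝ) (ω : Ω) : ℕ :=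
  (min (n₀ a : ℕ∞) (max (passageTime X g a ω) (n₁ a : ℕ∞))).toNat

/-- The function `κ = max {ε₀, min (g, ε₁)}`. -/
def kappa {d : ℕ} (g : EuclideanSpace ℝ (Fin d) → ℝ) (ε₀ ε₁ : ℝ)
    (x : EuclideanSpace ℝ (Fin d)) : ℝ :=
  max ε₀ (min (g x) ε₁)

/-- The covariance matrix of a random vector. -/
def covMatrix {d : ℕ} {Ω : Type*} [MeasurableSpace Ω] (Y : Ω → EuclideanSpace ℝ (Fin d))
    (P : Measure Ω) : Matrix (Fin d) (Fin d) ℝ :=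
  Matrix.of fun i j => cov[fun ω => Y ω i, fun ω => Y ω j; P]

/-- The Hessian matrix of second partial derivatives. -/
def hessian {d : ℕ} (h : EuclideanSpace ℝ (Fin d) → ℝ) (x : EuclideanSpace ℝ (Fin d)) :
    Matrix (Fin d) (Fin d) ℝ :=
  Matrix.of fun i j =>
    fderiv ℝ (fderiv ℝ h) x (EuclideanSpace.single i 1) (EuclideanSpace.single j 1)

/-- The bias coefficient `b(x, V) = (∇κ^{1/2})' V ∇h / κ^{1/2} + tr (∇²h V) / 2`, with all
derivatives taken at `x`. -/
def biasCoeff {d : ℕ} (κ h : EuclideanSpace ℝ (Fin d) → ℝ) (x : EuclideanSpace ℝ (Fin d))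
    (V : Matrix (Fin d) (Fin d) ℝ) : ℝ :=
  ((gradient (fun y => √(κ y)) x).ofLp ⬝ᵥ (V *ᵥ (gradient h x).ofLp)) / √(κ x)
    + (hessian h x * V).trace / 2

end

end SeqBias

/-! ### Elementary inequalities for powers of norms -/

namespace SeqBias

/-! Put ξ_i = X_i − μ, W = ξ_1 + ⋯ + ξ_T, s = √(a/T), L = ∇h(μ), Q = ∇²h(μ)/2, k = √κ(μ) and D =
∇κ^{1/2}(μ). Taylor's formula for h at X̄_T = μ + W/T turns √a · √T (h(X̄_T) − h(μ)) into s L(W) +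
s³ Q(W, W)/a plus a remainder (`tendsto_sqrt_mul_integral`). For bounded stopping times Wald's
second identity gives E Q(W, W) = E[T] · E Q(ξ, ξ), and E[T]/a → k⁻², so the quadratic term tends to
k E Q(ξ, ξ). In the linear term W has order √a, so s → k is not enough. Wald's first identity E L(W)
= 0 allows a deterministic c_a → k to be subtracted from s. What remains is governed by s − c_a ≈
D(W)/T, which contributes E[L(ξ) D(ξ)] in the limit, again by Wald's second identity. The sum of the
two limits is b(μ, V) √κ(μ) (`biasCoeff_mul_sqrt`).

The expansion s − c_a ≈ D(W)/T is `HasRootExpansion`. If g(μ) > ε₁ or g(μ) < ε₀, the rule equals n₁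
or n₀ on the main event and D = 0. In between, a/T ≤ g(X̄_T) while g(X̄_{T−1}) < a/(T−1), and
linearizing √g at both times squeezes s up to the last summand ξ_T (`abs_root_sub_le`).

Two exceptional events have to be discarded. Sample means far from μ between n₁ and n₀ have
probability O(a^{−r/2}) by the maximal inequality `exists_prob_max_psum_le`, which beats the order
√a of W. Crossings before n₁ form an event B whose probability tends to 0 without a usable rate,
since g is arbitrary away from μ. On B the rule equals n₁, so s − c_a is a constant there, and only
E[L(S_{n₁}); B] → 0 is needed, S being the centered sum. By optional stopping S_{n₁} may be replaced
by the sum at the crossing time, which is controlled over dyadic blocks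
(`tendsto_integral_early_crossing`, `tendsto_early_crossing`).

All error terms rest on one bound, E‖S_τ‖^r ≤ K N^{r/2} for every stopping time τ ≤ N, with K
independent of τ (`exists_integral_norm_gatedSum_rpow_le`). -/

theorem rpow_one_add_le_quadratic {s z : ℝ} (hs : 1 ≤ s) (hz : |z| ≤ 1 / 2 + 1 / 16) :
    (1 + z) ^ s ≤ 1 + s * z + s ^ 2 * 2 ^ s * z ^ 2 := by
  obtain ⟨hz1, hz2⟩ := abs_le.1 hz
  have hpos : 0 < 1 + z := by linarith
  have hpow : (1 + z) ^ s = (1 + z) ^ (s - 1) * (1 + z) := by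
    rw [← Real.rpow_add_one hpos.ne']; ring_nf
  -- The tangent of the convex power at 1 + z, evaluated at 1. It is Bernoulli's inequality at −z/(1
  -- + z), multiplied by (1 + z)^s.
  have hA : (1 + z) ^ s ≤ 1 + s * z * (1 + z) ^ (s - 1) := by
    have h := one_add_mul_self_le_rpow_one_add (s := -z / (1 + z))
      (by rw [le_div_iff₀ hpos]; linarith) hs
    have e : 1 + -z / (1 + z) = (1 + z)⁻¹ := by field_simp; ring
    rw [e, Real.inv_rpow hpos.le] at h
    have hp : 0 < (1 + z) ^ s := Real.rpow_pos_of_pos hpos _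
    have h2 := mul_le_mul_of_nonneg_left h hp.le
    rw [mul_inv_cancel₀ hp.ne'] at h2
    have e2 : (1 + z) ^ s * (1 + s * (-z / (1 + z))) = (1 + z) ^ s - s * z * (1 + z) ^ (s - 1) := by
      rw [hpow]; field_simp; ring
    rw [e2] at h2
    linarith
  have hsz : 0 ≤ s := by linarith
  have h2s : (1 : ℝ) ≤ 2 ^ s := Real.one_le_rpow (by norm_num) hsz
  -- Replacing the slope at 1 + z by the slope at 1 costs a quadratic term. For z ≥ 0 it comes from
  -- `hA` again, for z ≤ 0 from Bernoulli's lower bound.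
  have hB : z * ((1 + z) ^ (s - 1) - 1) ≤ s * 2 ^ s * z ^ 2 := by
    rcases le_total 0 z with h0 | h0
    · have h1 : (1 + z) ^ (s - 1) ≤ (1 + z) ^ s :=
        Real.rpow_le_rpow_of_exponent_le (by linarith) (by linarith)
      have h3 : (1 + z) ^ (s - 1) ≤ 2 ^ s := h1.trans (Real.rpow_le_rpow hpos.le (by linarith) hsz)
      have h4 : (1 + z) ^ (s - 1) - 1 ≤ s * z * 2 ^ s := by
        have := mul_le_mul_of_nonneg_left h3 (mul_nonneg hsz h0)
        linarith
      nlinarith [mul_le_mul_of_nonneg_left h4 h0]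
    · have h1 : (1 + z) ^ s ≤ (1 + z) ^ (s - 1) :=
        Real.rpow_le_rpow_of_exponent_ge hpos (by linarith) (by linarith)
      have h2 := one_add_mul_self_le_rpow_one_add (s := z) (by linarith) hs
      have h3 : 0 ≤ (1 + z) ^ (s - 1) - 1 - s * z := by linarith
      have h4 : z * ((1 + z) ^ (s - 1) - 1 - s * z) ≤ 0 := mul_nonpos_of_nonpos_of_nonneg h0 h3
      nlinarith [mul_nonneg hsz (sq_nonneg z)]
  nlinarith [mul_le_mul_of_nonneg_left hB hsz]

/-- The first order term is kept exactly because it integrates to zero when y is centered and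
independent of x. If ‖x‖ ≤ 4‖y‖, every term is absorbed by ‖y‖^r. Otherwise ‖x + y‖² = ‖x‖²(1 + z)
with small z, and the quadratic estimate applies with exponent r/2. -/
theorem exists_norm_add_rpow_le {E : Type*} [NormedAddCommGroup E] [InnerProductSpace ℝ E]
    {r : ℝ} (hr : 2 < r) :
    ∃ C : ℝ, 0 ≤ C ∧ ∀ x y : E, ‖x + y‖ ^ r ≤ ‖x‖ ^ r + r * ‖x‖ ^ (r - 2) * inner ℝ x y
      + C * (‖x‖ ^ (r - 2) * ‖y‖ ^ 2 + ‖y‖ ^ r) := by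
  have hr0 : 0 ≤ r := by linarith
  set s := r / 2 with hs
  have hs1 : 1 ≤ s := by rw [hs]; linarith
  set C1 : ℝ := 5 ^ r + r * 4 ^ (r - 1)
  set C2 : ℝ := s + s ^ 2 * 2 ^ s * 9
  have hC1 : 0 ≤ C1 := by positivity
  have hC2 : 0 ≤ C2 := by positivity
  refine ⟨C1 + C2, by positivity, fun x y => ?_⟩
  have hxy := abs_le.1 (abs_real_inner_le_norm x y)
  set u := ‖x‖ with hu
  set v := ‖y‖ with hv
  have hu0 : 0 ≤ u := norm_nonneg _
  have hv0 : 0 ≤ v := norm_nonneg _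
  have hA0 : 0 ≤ u ^ (r - 2) := Real.rpow_nonneg hu0 _
  have hB0 : 0 ≤ v ^ r := Real.rpow_nonneg hv0 _
  have hur : 0 ≤ u ^ r := Real.rpow_nonneg hu0 _
  rcases le_total u (4 * v) with h | h
  · have h1 : ‖x + y‖ ^ r ≤ 5 ^ r * v ^ r := by
      rw [← Real.mul_rpow (by norm_num) hv0]
      refine Real.rpow_le_rpow (norm_nonneg _) ((norm_add_le _ _).trans ?_) hr0
      linarith
    have h2 : u ^ (r - 2) * (u * v) ≤ 4 ^ (r - 1) * v ^ r := by
      have e1 : u ^ (r - 2) * u = u ^ (r - 1) := by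
        rcases eq_or_lt_of_le hu0 with h0 | h0
        · rw [← h0, mul_zero, Real.zero_rpow (by linarith)]
        · rw [← Real.rpow_add_one h0.ne']; ring_nf
      have e2 : v ^ (r - 1) * v = v ^ r := by
        rcases eq_or_lt_of_le hv0 with h0 | h0
        · rw [← h0, mul_zero, Real.zero_rpow (by linarith)]
        · rw [← Real.rpow_add_one h0.ne']; ring_nf
      rw [← mul_assoc, e1, ← e2, ← mul_assoc, ← Real.mul_rpow (by norm_num) hv0]
      exact mul_le_mul_of_nonneg_right (Real.rpow_le_rpow hu0 h (by linarith)) hv0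
    have h3 : -(r * 4 ^ (r - 1) * v ^ r) ≤ r * u ^ (r - 2) * inner ℝ x y := by
      have := mul_le_mul_of_nonneg_left hxy.1 (mul_nonneg hr0 hA0)
      nlinarith [mul_le_mul_of_nonneg_left h2 hr0]
    have h4 : 0 ≤ (C1 + C2) * (u ^ (r - 2) * v ^ 2) := by positivity
    have h5 : 0 ≤ C2 * v ^ r := by positivity
    have h6 : C1 * v ^ r = 5 ^ r * v ^ r + r * 4 ^ (r - 1) * v ^ r := by simp only [C1]; ring
    nlinarith
  · rcases eq_or_lt_of_le hu0 with h0 | h0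
    · have hv' : v = 0 := by linarith
      have hx : x = 0 := norm_eq_zero.1 (by rw [← hu, h0])
      have hy : y = 0 := norm_eq_zero.1 (by rw [← hv, hv'])
      simp [hx, hy]
      rw [Real.zero_rpow (by linarith), ← h0, hv', Real.zero_rpow (by linarith)]; simp
    set w := 2 * inner ℝ x y + v ^ 2 with hw
    have hsq : ‖x + y‖ ^ 2 = u ^ 2 * (1 + w / u ^ 2) := by
      rw [norm_add_sq_real]; field_simp; rw [hw]; ring
    have hwabs : |w| ≤ 2 * (u * v) + v ^ 2 := by
      rw [abs_le]; constructor <;> nlinarith [hxy.1, hxy.2]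
    -- From v ≤ u/4: the inner product contributes 2 · 1/4 and the square contributes 1/16.
    have hz : |w / u ^ 2| ≤ 1 / 2 + 1 / 16 := by
      rw [abs_div, abs_of_pos (by positivity : 0 < u ^ 2), div_le_iff₀ (by positivity)]
      nlinarith
    have hq := rpow_one_add_le_quadratic hs1 hz
    have hpow : ‖x + y‖ ^ r = u ^ r * (1 + w / u ^ 2) ^ s := by
      have : r = (2 : ℕ) * s := by rw [hs]; push_cast; ring
      rw [this, Real.rpow_mul (norm_nonneg _), Real.rpow_natCast, hsq,
        Real.mul_rpow (by positivity) (by linarith [(abs_le.1 hz).1]), Real.rpow_mul hu0,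
        Real.rpow_natCast]
    have hu2 : u ^ r = u ^ (r - 2) * u ^ 2 := by
      rw [← Real.rpow_natCast u 2, ← Real.rpow_add h0]; norm_num
    have hw2 : w ^ 2 ≤ 9 * (u ^ 2 * v ^ 2) := by
      have h7 : 2 * (u * v) + v ^ 2 ≤ 3 * (u * v) := by nlinarith
      calc w ^ 2 = |w| ^ 2 := (sq_abs w).symm
        _ ≤ (3 * (u * v)) ^ 2 := by
          exact pow_le_pow_left₀ (abs_nonneg _) (hwabs.trans h7) 2
        _ = _ := by ring
    have hrs : r = 2 * s := by rw [hs]; ring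
    calc ‖x + y‖ ^ r = u ^ r * (1 + w / u ^ 2) ^ s := hpow
      _ ≤ u ^ r * (1 + s * (w / u ^ 2) + s ^ 2 * 2 ^ s * (w / u ^ 2) ^ 2) :=
        mul_le_mul_of_nonneg_left hq hur
      _ = u ^ r + s * u ^ (r - 2) * w + s ^ 2 * 2 ^ s * u ^ (r - 2) * (w ^ 2 / u ^ 2) := by
        rw [hu2]; field_simp
      _ ≤ u ^ r + s * u ^ (r - 2) * w + s ^ 2 * 2 ^ s * u ^ (r - 2) * (9 * v ^ 2) := by
        have : w ^ 2 / u ^ 2 ≤ 9 * v ^ 2 := by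
          rw [div_le_iff₀ (by positivity)]; linarith
        gcongr
      _ = u ^ r + r * u ^ (r - 2) * inner ℝ x y + C2 * (u ^ (r - 2) * v ^ 2) := by
        rw [hw, hrs]; simp only [C2]; ring
      _ ≤ _ := by
        have h4 : 0 ≤ C1 * (u ^ (r - 2) * v ^ 2) := by positivity
        have h5 : 0 ≤ (C1 + C2) * v ^ r := by positivity
        linarith

/-- Interpolation of a lower power between a constant and a higher power. -/
theorem rpow_le_add_rpow {x s p q : ℝ} (hx : 0 ≤ x) (hs : 0 < s) (hp : 0 ≤ p) (hpq : p ≤ q) :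
    x ^ p ≤ s ^ p + s ^ (p - q) * x ^ q := by
  rcases le_total x s with h | h
  · have := Real.rpow_le_rpow hx h hp
    have : 0 ≤ s ^ (p - q) * x ^ q := by positivity
    linarith
  · have hx' : 0 < x := hs.trans_le h
    have h1 : x ^ p = x ^ (p - q) * x ^ q := by rw [← Real.rpow_add hx']; ring_nf
    have h2 : x ^ (p - q) ≤ s ^ (p - q) := Real.rpow_le_rpow_of_nonpos hs h (by linarith)
    have h3 : 0 ≤ s ^ p := by positivity
    have h4 := mul_le_mul_of_nonneg_right h2 (Real.rpow_nonneg hx q)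
    linarith

end SeqBias

/-! ### Sums with predictable gates: Wald's identities and the moment bound -/

namespace SeqBias

set_option linter.unusedSectionVars false

section GatedSums

variable {Ω E : Type*} [MeasurableSpace Ω] [NormedAddCommGroup E] [InnerProductSpace ℝ E]
  [CompleteSpace E] [MeasurableSpace E] [BorelSpace E] [SecondCountableTopology E]

/-- A centered i.i.d. sequence with a finite absolute moment of order `r`. -/
structure IsCenteredIID (ξ : ℕ → Ω → E) (P : Measure Ω) (r : ℝ) : Prop where
  measurable : ∀ i, Measurable (ξ i)
  indep : iIndepFun ξ P
  ident : ∀ i, IdentDistrib (ξ i) (ξ 0) P P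
  moment : Integrable (fun ω => ‖ξ 0 ω‖ ^ r) P
  mean : ∫ ω, ξ 0 ω ∂P = 0

/-- The σ-algebra generated by the variables of index less than `n`. -/
def past (ξ : ℕ → Ω → E) (n : ℕ) : MeasurableSpace Ω :=
  ⨆ i ∈ Set.Iio n, MeasurableSpace.comap (ξ i) inferInstance

/-- The sum of the first `n` variables, the `i`-th one being kept only on the event `B i`. -/
noncomputable def gatedSum (ξ : ℕ → Ω → E) (B : ℕ → Set Ω) (n : ℕ) (ω : Ω) : E :=
  ∑ i ∈ Finset.range n, (B i).indicator (ξ i) ω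

theorem past_mono (ξ : ℕ → Ω → E) {k n : ℕ} (hkn : k ≤ n) : past ξ k ≤ past ξ n :=
  biSup_mono fun _ hi => lt_of_lt_of_le hi hkn

theorem measurable_past (ξ : ℕ → Ω → E) {i n : ℕ} (hin : i < n) : Measurable[past ξ n] (ξ i) := by
  have h : MeasurableSpace.comap (ξ i) inferInstance ≤ past ξ n :=
    le_biSup (fun i => MeasurableSpace.comap (ξ i) inferInstance) (show i ∈ Set.Iio n from hin)
  exact Measurable.mono (comap_measurable (ξ i)) h le_rfl

namespace IsCenteredIID

variable {ξ : ℕ → Ω → E} {P : Measure Ω} [IsProbabilityMeasure P] {r : ℝ}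

theorem past_le' (hξ : ∀ i, Measurable (ξ i)) (n : ℕ) : past ξ n ≤ ‹MeasurableSpace Ω› :=
  iSup₂_le fun i _ => (hξ i).comap_le

theorem past_le (hξ : IsCenteredIID ξ P r) (n : ℕ) : past ξ n ≤ ‹MeasurableSpace Ω› :=
  past_le' hξ.measurable n

theorem indepFun_past (hξ : IsCenteredIID ξ P r) {F : Type*} [MeasurableSpace F] {n : ℕ}
    {f : Ω → F} (hf : Measurable[past ξ n] f) : IndepFun f (ξ n) P := by
  have h := indep_iSup_of_disjoint (m := fun i => MeasurableSpace.comap (ξ i) inferInstance)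
    (fun i => (hξ.measurable i).comap_le) hξ.indep
    (S := Set.Iio n) (T := {n}) (by simp)
  rw [IndepFun_iff_Indep]
  refine indep_of_indep_of_le_left (indep_of_indep_of_le_right h ?_) ?_
  · simp
  · exact hf.comap_le

theorem memLp (hξ : IsCenteredIID ξ P r) (hr : 0 < r) (i : ℕ) :
    MemLp (ξ i) (ENNReal.ofReal r) P := by
  rw [(hξ.ident i).memLp_iff,
    ← integrable_norm_rpow_iff (hξ.measurable 0).aestronglyMeasurable (by simpa using hr) (by simp),
    ENNReal.toReal_ofReal hr.le]
  exact hξ.moment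

theorem integrable (hξ : IsCenteredIID ξ P r) (hr : 1 ≤ r) (i : ℕ) : Integrable (ξ i) P :=
  (hξ.memLp (by linarith) i).integrable (by simpa using hr)

theorem integral_comp (hξ : IsCenteredIID ξ P r) {f : E → ℝ} (hf : Measurable f) (i : ℕ) :
    ∫ ω, f (ξ i ω) ∂P = ∫ ω, f (ξ 0 ω) ∂P :=
  ((hξ.ident i).comp hf).integral_eq

theorem integral_eq_zero (hξ : IsCenteredIID ξ P r) (i : ℕ) : ∫ ω, ξ i ω ∂P = 0 := by
  rw [(hξ.ident i).integral_eq, hξ.mean]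

/-- A bilinear expression in a past vector and the next variable has mean zero. -/
theorem integral_bilin_past (hξ : IsCenteredIID ξ P r) (hr : 1 ≤ r) {F : Type*}
    [NormedAddCommGroup F] [NormedSpace ℝ F] [CompleteSpace F] [MeasurableSpace F] [BorelSpace F]
    {n : ℕ} {f : Ω → F} (hf : Measurable[past ξ n] f) (hfi : Integrable f P)
    (b : F →L[ℝ] E →L[ℝ] ℝ) :
    Integrable (fun ω => b (f ω) (ξ n ω)) P ∧ ∫ ω, b (f ω) (ξ n ω) ∂P = 0 := by
  have hi := hξ.indepFun_past hf
  refine ⟨hi.integrable_bilin hfi (hξ.integrable hr n) b, ?_⟩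
  rw [hi.integral_bilin hfi (hξ.integrable hr n) b, hξ.integral_eq_zero, map_zero]

/-- A past factor is uncorrelated with every function of the next variable. -/
theorem integral_mul_past (hξ : IsCenteredIID ξ P r) {n : ℕ} {f : Ω → ℝ}
    (hf : Measurable[past ξ n] f) (hfi : Integrable f P) {φ : E → ℝ} (hφ : Measurable φ)
    (hφi : Integrable (fun ω => φ (ξ 0 ω)) P) :
    Integrable (fun ω => f ω * φ (ξ n ω)) P ∧
      ∫ ω, f ω * φ (ξ n ω) ∂P = (∫ ω, f ω ∂P) * ∫ ω, φ (ξ 0 ω) ∂P := by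
  have hi : IndepFun f (fun ω => φ (ξ n ω)) P := (hξ.indepFun_past hf).comp measurable_id hφ
  have hφn : Integrable (fun ω => φ (ξ n ω)) P :=
    (((hξ.ident n).comp hφ).integrable_iff).2 hφi
  refine ⟨hi.integrable_mul hfi hφn, ?_⟩
  rw [← hξ.integral_comp hφ n]
  exact hi.integral_mul_eq_mul_integral hfi.aestronglyMeasurable hφn.aestronglyMeasurable

theorem measurable_gatedSum {B : ℕ → Set Ω}
    (hB : ∀ i, MeasurableSet[past ξ i] (B i)) (n : ℕ) :
    Measurable[past ξ n] (gatedSum ξ B n) := by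
  unfold gatedSum
  refine Finset.measurable_fun_sum _ fun i hi => ?_
  have hi' := Finset.mem_range.1 hi
  exact (measurable_past ξ hi').indicator (past_mono ξ hi'.le _ (hB i))

theorem memLp_gatedSum (hξ : IsCenteredIID ξ P r) (hr : 0 < r) {B : ℕ → Set Ω}
    (hB : ∀ i, MeasurableSet[past ξ i] (B i)) (n : ℕ) :
    MemLp (gatedSum ξ B n) (ENNReal.ofReal r) P := by
  unfold gatedSum
  refine memLp_finsetSum _ fun i _ => ?_
  exact (hξ.memLp hr i).indicator (hξ.past_le i _ (hB i))

end IsCenteredIID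

theorem integrable_norm_rpow_of_memLp {P : Measure Ω} [IsProbabilityMeasure P] {Y : Ω → E} {r p : ℝ}
    (hY : MemLp Y (ENNReal.ofReal r) P) (hp : 0 ≤ p) (hpr : p ≤ r) :
    Integrable (fun ω => ‖Y ω‖ ^ p) P := by
  have h := (hY.mono_exponent (ENNReal.ofReal_le_ofReal hpr)).integrable_norm_rpow'
  rwa [ENNReal.toReal_ofReal hp] at h

theorem integrable_bilin_of_memLp {P : Measure Ω} [IsProbabilityMeasure P] {Y Z : Ω → E} {r : ℝ}
    (hr : 2 ≤ r) (hY : MemLp Y (ENNReal.ofReal r) P) (hZ : MemLp Z (ENNReal.ofReal r) P)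
    (b : E →L[ℝ] E →L[ℝ] ℝ) :
    Integrable (fun ω => b (Y ω) (Z ω)) P := by
  have h2 : (2 : ENNReal) ≤ ENNReal.ofReal r := by
    rw [← ENNReal.ofReal_ofNat]; exact ENNReal.ofReal_le_ofReal hr
  have hy := hY.mono_exponent h2
  have hz := hZ.mono_exponent h2
  refine Integrable.mono' ((hy.norm.integrable_mul hz.norm).const_mul ‖b‖)
    (b.aestronglyMeasurable_comp₂ hY.1 hZ.1) (ae_of_all _ fun ω => ?_)
  simpa [mul_assoc] using b.le_opNorm₂ (Y ω) (Z ω)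

namespace IsCenteredIID

variable {ξ : ℕ → Ω → E} {P : Measure Ω} [IsProbabilityMeasure P] {r : ℝ}

/-- Wald's first identity. -/
theorem integral_gatedSum (hξ : IsCenteredIID ξ P r) (hr : 1 ≤ r) {B : ℕ → Set Ω}
    (hB : ∀ i, MeasurableSet[past ξ i] (B i)) (n : ℕ) (L : E →L[ℝ] ℝ) :
    ∫ ω, L (gatedSum ξ B n ω) ∂P = 0 := by
  have key : ∀ i, Integrable (fun ω => L ((B i).indicator (ξ i) ω)) P ∧
      ∫ ω, L ((B i).indicator (ξ i) ω) ∂P = 0 := by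
    intro i
    -- The gated term is the bilinear expression t · L x, taken at the indicator of the gate, which
    -- belongs to the past, and the next variable.
    have h := hξ.integral_bilin_past hr (n := i) (f := (B i).indicator fun _ => (1 : ℝ))
      (measurable_const.indicator (hB i))
      ((integrable_const 1).indicator (hξ.past_le i _ (hB i)))
      (ContinuousLinearMap.toSpanSingleton ℝ L)
    have e : ∀ ω, ContinuousLinearMap.toSpanSingleton ℝ L ((B i).indicator (fun _ => (1 : ℝ)) ω)
        (ξ i ω) = L ((B i).indicator (ξ i) ω) := by
      intro ω
      by_cases hω : ω ∈ B i <;> simp [hω]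
    simpa only [e] using h
  simp only [gatedSum, map_sum]
  rw [integral_finsetSum _ fun i _ => (key i).1]
  exact Finset.sum_eq_zero fun i _ => (key i).2

/-- Wald's second identity. -/
theorem integral_bilin_gatedSum (hξ : IsCenteredIID ξ P r) (hr : 2 ≤ r) {B : ℕ → Set Ω}
    (hB : ∀ i, MeasurableSet[past ξ i] (B i)) (n : ℕ) (b : E →L[ℝ] E →L[ℝ] ℝ) :
    ∫ ω, b (gatedSum ξ B n ω) (gatedSum ξ B n ω) ∂P =
      (∑ i ∈ Finset.range n, P.real (B i)) * ∫ ω, b (ξ 0 ω) (ξ 0 ω) ∂P := by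
  induction n with
  | zero => simp [gatedSum]
  | succ n ih =>
    have hr0 : 0 < r := by linarith
    have hr1 : 1 ≤ r := by linarith
    have hBn := hξ.past_le n _ (hB n)
    set Y := gatedSum ξ B n with hY
    have hYm : Measurable[past ξ n] Y := measurable_gatedSum hB n
    have hYL := hξ.memLp_gatedSum hr0 hB n
    have hYi : Integrable Y P := hYL.integrable (by simpa using hr1)
    have hYBm : Measurable[past ξ n] ((B n).indicator Y) := hYm.indicator (hB n)
    have h1 := hξ.integral_bilin_past hr1 hYBm (hYi.indicator hBn) b
    -- Since b need not be symmetric, the two cross terms are separate; the flip puts the past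
    -- vector first.
    have h2 := hξ.integral_bilin_past hr1 hYBm (hYi.indicator hBn) b.flip
    have hbm : Measurable fun x : E => b x x :=
      (b.continuous₂.comp (continuous_id.prodMk continuous_id)).measurable
    have h3 := hξ.integral_mul_past (n := n) (f := (B n).indicator fun _ => (1 : ℝ))
      (measurable_const.indicator (hB n)) ((integrable_const 1).indicator hBn) hbm
      (integrable_bilin_of_memLp hr (hξ.memLp hr0 0) (hξ.memLp hr0 0) b)
    have e : ∀ ω, b (gatedSum ξ B (n + 1) ω) (gatedSum ξ B (n + 1) ω) =
        b (Y ω) (Y ω) + b ((B n).indicator Y ω) (ξ n ω) + b.flip ((B n).indicator Y ω) (ξ n ω)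
          + (B n).indicator (fun _ => (1 : ℝ)) ω * b (ξ n ω) (ξ n ω) := by
      intro ω
      have : gatedSum ξ B (n + 1) ω = Y ω + (B n).indicator (ξ n) ω := by
        simp [hY, gatedSum, Finset.sum_range_succ]
      rw [this]
      by_cases hω : ω ∈ B n <;> simp [hω]
      ring
    have hYY := integrable_bilin_of_memLp hr hYL hYL b
    simp only [e]
    rw [integral_add ((hYY.fun_add h1.1).fun_add h2.1) h3.1, integral_add (hYY.fun_add h1.1) h2.1,
      integral_add hYY h1.1, h1.2, h2.2, h3.2, ih, integral_indicator_const _ hBn,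
      Finset.sum_range_succ, smul_eq_mul, mul_one]
    ring

/-- Moment bound for sums of gated centered variables, uniform in the gates. -/
theorem exists_integral_norm_gatedSum_rpow_le (hξ : IsCenteredIID ξ P r) (hr : 2 < r) :
    ∃ K : ℝ, 0 ≤ K ∧ ∀ B : ℕ → Set Ω, (∀ i, MeasurableSet[past ξ i] (B i)) → ∀ n : ℕ,
      ∫ ω, ‖gatedSum ξ B n ω‖ ^ r ∂P ≤ K * (n : ℝ) ^ (r / 2) := by
  have hr0 : 0 < r := by linarith
  have hr1 : 1 ≤ r := by linarith
  obtain ⟨C, hC0, hC⟩ := exists_norm_add_rpow_le (E := E) hr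
  set σ := ∫ ω, ‖ξ 0 ω‖ ^ 2 ∂P with hσ
  set M := ∫ ω, ‖ξ 0 ω‖ ^ r ∂P with hM
  have hσ0 : 0 ≤ σ := integral_nonneg fun _ => by positivity
  have hM0 : 0 ≤ M := integral_nonneg fun _ => by positivity
  -- the one-step inequality
  have step : ∀ B : ℕ → Set Ω, (∀ i, MeasurableSet[past ξ i] (B i)) → ∀ n : ℕ,
      ∫ ω, ‖gatedSum ξ B (n + 1) ω‖ ^ r ∂P ≤ ∫ ω, ‖gatedSum ξ B n ω‖ ^ r ∂P
        + C * ((∫ ω, ‖gatedSum ξ B n ω‖ ^ (r - 2) ∂P) * σ + M) := by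
    intro B hB n
    have hBn := hξ.past_le n _ (hB n)
    set Y := gatedSum ξ B n with hY
    have hYm : Measurable[past ξ n] Y := measurable_gatedSum hB n
    have hYL := hξ.memLp_gatedSum hr0 hB n
    have hYr := integrable_norm_rpow_of_memLp hYL hr0.le le_rfl
    have hYr2 := integrable_norm_rpow_of_memLp hYL (p := r - 2) (by linarith) (by linarith)
    have hYr1 := integrable_norm_rpow_of_memLp hYL (p := r - 1) (by linarith) (by linarith)
    -- The gate is moved from the new summand to the coefficient of the linear term, which thereby
    -- stays measurable with respect to the past. The nonnegative error term needs no gate.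
    set F : Ω → E := (B n).indicator fun ω => (r * ‖Y ω‖ ^ (r - 2)) • Y ω with hF
    have hψ : Measurable fun x : E => (r * ‖x‖ ^ (r - 2)) • x :=
      (measurable_const.mul (measurable_norm.pow_const _)).smul measurable_id
    have hFm : Measurable[past ξ n] F := (hψ.comp hYm).indicator (hB n)
    have hFi : Integrable F P := by
      refine Integrable.indicator ?_ hBn
      refine Integrable.mono' (hYr1.const_mul r) ?_ (ae_of_all _ fun ω => ?_)
      · exact ((hψ.comp hYm).mono (hξ.past_le n) le_rfl).aestronglyMeasurable
      · rw [norm_smul, Real.norm_of_nonneg (by positivity), mul_assoc]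
        refine mul_le_mul_of_nonneg_left ?_ hr0.le
        rcases eq_or_lt_of_le (norm_nonneg (Y ω)) with h0 | h0
        · rw [← h0, mul_zero]; positivity
        · rw [← Real.rpow_add_one h0.ne']; ring_nf; rfl
    have h1 := hξ.integral_bilin_past hr1 hFm hFi (innerSL ℝ)
    have hsq : Integrable (fun ω => ‖ξ 0 ω‖ ^ 2) P := by
      have := integrable_norm_rpow_of_memLp (hξ.memLp hr0 0) (p := 2) (by norm_num) hr.le
      simpa using this
    have h2 := hξ.integral_mul_past (n := n) (f := fun ω => ‖Y ω‖ ^ (r - 2)) ((measurable_norm.pow_const (r - 2)).comp hYm) hYr2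
      (φ := fun x => ‖x‖ ^ 2) (measurable_norm.pow_const 2) hsq
    have h3 : Integrable (fun ω => ‖ξ n ω‖ ^ r) P :=
      integrable_norm_rpow_of_memLp (hξ.memLp hr0 n) hr0.le le_rfl
    have h3' : ∫ ω, ‖ξ n ω‖ ^ r ∂P = M :=
      hξ.integral_comp (f := fun x => ‖x‖ ^ r) (measurable_norm.pow_const r) n
    have hpt : ∀ ω, ‖gatedSum ξ B (n + 1) ω‖ ^ r ≤ ‖Y ω‖ ^ r + innerSL ℝ (F ω) (ξ n ω)
        + C * (‖Y ω‖ ^ (r - 2) * ‖ξ n ω‖ ^ 2 + ‖ξ n ω‖ ^ r) := by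
      intro ω
      have e : gatedSum ξ B (n + 1) ω = Y ω + (B n).indicator (ξ n) ω := by
        simp [hY, gatedSum, Finset.sum_range_succ]
      rw [e]
      by_cases hω : ω ∈ B n
      · have := hC (Y ω) (ξ n ω)
        simpa [hF, hω, inner_smul_left] using this
      · have : 0 ≤ C * (‖Y ω‖ ^ (r - 2) * ‖ξ n ω‖ ^ 2 + ‖ξ n ω‖ ^ r) := by positivity
        simp [hF, hω]
        simpa using this
    have hint : Integrable (fun ω => C * (‖Y ω‖ ^ (r - 2) * ‖ξ n ω‖ ^ 2 + ‖ξ n ω‖ ^ r)) P :=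
      (h2.1.add h3).const_mul C
    calc ∫ ω, ‖gatedSum ξ B (n + 1) ω‖ ^ r ∂P
        ≤ ∫ ω, (‖Y ω‖ ^ r + innerSL ℝ (F ω) (ξ n ω)
          + C * (‖Y ω‖ ^ (r - 2) * ‖ξ n ω‖ ^ 2 + ‖ξ n ω‖ ^ r)) ∂P :=
          integral_mono (integrable_norm_rpow_of_memLp (hξ.memLp_gatedSum hr0 hB (n + 1)) hr0.le
            le_rfl) ((hYr.add h1.1).add hint) hpt
      _ = _ := by
          rw [integral_add (hYr.fun_add h1.1) hint, integral_add hYr h1.1, h1.2, integral_const_mul,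
            integral_add h2.1 h3, h2.2, h3']
          ring
  -- choice of the constants
  set c : ℝ := √(4 * C * σ / r + 1) with hc
  have hc2 : c ^ 2 = 4 * C * σ / r + 1 := Real.sq_sqrt (by positivity)
  have hcpos : 0 < c := Real.sqrt_pos.2 (by positivity)
  -- The first summand serves the step from n = 0. The second pays for the terms not proportional to
  -- K, using half of the increment K · r/2; by the choice of c the terms proportional to K use at
  -- most the other half.
  set K : ℝ := C * M + 4 / r * (C * (σ * c ^ (r - 2) + M)) with hK
  have hK0 : 0 ≤ K := by positivity
  refine ⟨K, hK0, fun B hB n => ?_⟩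
  have hCσ : C * σ / c ^ 2 ≤ r / 4 := by
    rw [div_le_iff₀ (by positivity), hc2]
    have : r / 4 * (4 * C * σ / r + 1) = C * σ + r / 4 := by field_simp
    linarith
  have hKc : C * (σ * (c ^ (r - 2) + K / c ^ 2) + M) ≤ K * (r / 2) := by
    have e1 : C * (σ * (c ^ (r - 2) + K / c ^ 2) + M)
        = C * (σ * c ^ (r - 2) + M) + K * (C * σ / c ^ 2) := by ring
    have e2 : C * (σ * c ^ (r - 2) + M) ≤ K * (r / 4) := by
      have : 4 / r * (C * (σ * c ^ (r - 2) + M)) ≤ K := by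
        rw [hK]; nlinarith [mul_nonneg hC0 hM0]
      calc C * (σ * c ^ (r - 2) + M) = 4 / r * (C * (σ * c ^ (r - 2) + M)) * (r / 4) := by
            field_simp
        _ ≤ K * (r / 4) := by gcongr
    have e3 := mul_le_mul_of_nonneg_left hCσ hK0
    rw [e1]; linarith
  induction n with
  | zero =>
    simp [gatedSum, Real.zero_rpow hr0.ne', Real.zero_rpow (by linarith : r / 2 ≠ 0)]
  | succ n ih =>
    have hst := step B hB n
    -- At n = 0 the truncation level c√n vanishes, so this step is done directly.
    rcases Nat.eq_zero_or_pos n with h0 | h0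
    · subst h0
      have z1 : ∫ ω, ‖gatedSum ξ B 0 ω‖ ^ r ∂P = 0 := by simp [gatedSum, Real.zero_rpow hr0.ne']
      have z2 : ∫ ω, ‖gatedSum ξ B 0 ω‖ ^ (r - 2) ∂P = 0 := by
        simp [gatedSum, Real.zero_rpow (by linarith : r - 2 ≠ 0)]
      rw [z1, z2] at hst
      have : 0 ≤ 4 / r * (C * (σ * c ^ (r - 2) + M)) := by positivity
      simp only [zero_add, Nat.cast_one, Real.one_rpow, mul_one]
      simp only [zero_add, zero_mul] at hst
      linarith
    · have hn : (0 : ℝ) < n := by exact_mod_cast h0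
      set s : ℝ := c * √n with hs
      have hspos : 0 < s := mul_pos hcpos (Real.sqrt_pos.2 hn)
      have hYL := hξ.memLp_gatedSum hr0 hB n
      have hYr := integrable_norm_rpow_of_memLp hYL hr0.le le_rfl
      have hYr2 := integrable_norm_rpow_of_memLp hYL (p := r - 2) (by linarith) (by linarith)
      -- Interpolation at the natural scale c√n closes the recursion: the moment of order r − 2 is
      -- bounded through that of order r, with a factor (c√n)⁻².
      have h4 : ∫ ω, ‖gatedSum ξ B n ω‖ ^ (r - 2) ∂P ≤
          s ^ (r - 2) + s ^ (r - 2 - r) * ∫ ω, ‖gatedSum ξ B n ω‖ ^ r ∂P := by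
        calc _ ≤ ∫ ω, (s ^ (r - 2) + s ^ (r - 2 - r) * ‖gatedSum ξ B n ω‖ ^ r) ∂P :=
              integral_mono hYr2 ((integrable_const _).add (hYr.const_mul _)) fun ω =>
                rpow_le_add_rpow (norm_nonneg _) hspos (by linarith) (by linarith)
          _ = _ := by
              rw [integral_add (integrable_const _) (hYr.const_mul _), integral_const_mul]; simp
      have e1 : s ^ (r - 2) = c ^ (r - 2) * (n : ℝ) ^ (r / 2 - 1) := by
        rw [hs, Real.mul_rpow hcpos.le (Real.sqrt_nonneg _), Real.sqrt_eq_rpow,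
          ← Real.rpow_mul hn.le]
        ring_nf
      have e2 : s ^ (r - 2 - r) * (K * (n : ℝ) ^ (r / 2)) = K / c ^ 2 * (n : ℝ) ^ (r / 2 - 1) := by
        have : r - 2 - r = -((2 : ℕ) : ℝ) := by push_cast; ring
        rw [this, Real.rpow_neg hspos.le, Real.rpow_natCast, hs, mul_pow, Real.sq_sqrt hn.le,
          Real.rpow_sub_one hn.ne']
        field_simp
      have h5 : ∫ ω, ‖gatedSum ξ B n ω‖ ^ (r - 2) ∂P ≤
          (c ^ (r - 2) + K / c ^ 2) * (n : ℝ) ^ (r / 2 - 1) := by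
        have := mul_le_mul_of_nonneg_left ih (Real.rpow_nonneg hspos.le (r - 2 - r))
        rw [e2] at this
        rw [add_mul, ← e1]; linarith
      have hn1 : 1 ≤ (n : ℝ) ^ (r / 2 - 1) :=
        Real.one_le_rpow (by exact_mod_cast h0) (by linarith)
      have h6 : C * ((∫ ω, ‖gatedSum ξ B n ω‖ ^ (r - 2) ∂P) * σ + M) ≤
          K * (r / 2) * (n : ℝ) ^ (r / 2 - 1) := by
        have h7 : (∫ ω, ‖gatedSum ξ B n ω‖ ^ (r - 2) ∂P) * σ + M ≤
            (σ * (c ^ (r - 2) + K / c ^ 2) + M) * (n : ℝ) ^ (r / 2 - 1) := by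
          nlinarith [mul_le_mul_of_nonneg_right h5 hσ0, mul_le_mul_of_nonneg_left hn1 hM0]
        have h8 := mul_le_mul_of_nonneg_left h7 hC0
        have h9 := mul_le_mul_of_nonneg_right hKc (by linarith : 0 ≤ (n : ℝ) ^ (r / 2 - 1))
        linarith
      -- Bernoulli's inequality at 1/n: the increment of n^{r/2} dominates r/2 · n^{r/2−1}.
      have h10 : (n : ℝ) ^ (r / 2) + r / 2 * (n : ℝ) ^ (r / 2 - 1) ≤ ((n : ℝ) + 1) ^ (r / 2) := by
        have hb := one_add_mul_self_le_rpow_one_add (s := 1 / (n : ℝ))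
          (by have : 0 ≤ 1 / (n : ℝ) := by positivity
              linarith) (p := r / 2) (by linarith)
        have := mul_le_mul_of_nonneg_left hb (Real.rpow_nonneg hn.le (r / 2))
        rw [← Real.mul_rpow hn.le (by positivity)] at this
        have e3 : (n : ℝ) * (1 + 1 / n) = n + 1 := by field_simp
        rw [e3] at this
        rw [Real.rpow_sub_one hn.ne']
        refine le_trans (le_of_eq ?_) this
        ring
      have h11 := mul_le_mul_of_nonneg_left h10 hK0
      push_cast
      linarith

end IsCenteredIID

end GatedSums

end SeqBias

/-! ### Centered sums at bounded stopping times -/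

namespace SeqBias

section Stopping

variable {Ω E : Type*} [MeasurableSpace Ω] [NormedAddCommGroup E] [InnerProductSpace ℝ E]
  [CompleteSpace E] [MeasurableSpace E] [BorelSpace E] [SecondCountableTopology E]

/-- The partial sums of a sequence of random vectors. -/
def psum (ξ : ℕ → Ω → E) (n : ℕ) (ω : Ω) : E := ∑ i ∈ Finset.range n, ξ i ω

/-- A stopping time with respect to the past of `ξ`, bounded by `N`. -/
structure IsBoundedStop (ξ : ℕ → Ω → E) (τ : Ω → ℕ) (N : ℕ) : Prop where
  measurableSet_lt : ∀ n, MeasurableSet[past ξ n] {ω | n < τ ω}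
  le : ∀ ω, τ ω ≤ N

theorem IsBoundedStop.const (ξ : ℕ → Ω → E) (N : ℕ) : IsBoundedStop ξ (fun _ => N) N :=
  ⟨fun _ => MeasurableSet.const _, fun _ => le_rfl⟩

/-- The summand of index i is kept exactly when i < τ, an event decided by the variables of index
less than i. The events {i < τ} are therefore admissible gates, and the results on gated sums carry
over. -/
theorem IsBoundedStop.psum_eq {ξ : ℕ → Ω → E} {τ : Ω → ℕ} {N : ℕ} (hτ : IsBoundedStop ξ τ N)
    (ω : Ω) : psum ξ (τ ω) ω = gatedSum ξ (fun n => {ω | n < τ ω}) N ω := by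
  unfold psum gatedSum
  rw [← Finset.sum_subset (Finset.range_mono (hτ.le ω))]
  · refine Finset.sum_congr rfl fun i hi => ?_
    rw [Set.indicator_of_mem]
    exact Finset.mem_range.1 hi
  · intro i _ hi
    rw [Set.indicator_of_notMem]
    simpa using hi

namespace IsBoundedStop

variable {ξ : ℕ → Ω → E} {P : Measure Ω} [IsProbabilityMeasure P] {r : ℝ} {τ : Ω → ℕ} {N : ℕ}

theorem measurable (hτ : IsBoundedStop ξ τ N) (hξ : IsCenteredIID ξ P r) : Measurable τ :=
  measurable_of_Ioi fun n => hξ.past_le n _ (hτ.measurableSet_lt n)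

theorem memLp_psum (hτ : IsBoundedStop ξ τ N) (hξ : IsCenteredIID ξ P r) (hr : 0 < r) :
    MemLp (fun ω => psum ξ (τ ω) ω) (ENNReal.ofReal r) P := by
  simp only [hτ.psum_eq]
  exact hξ.memLp_gatedSum hr hτ.measurableSet_lt N

theorem integral_psum (hτ : IsBoundedStop ξ τ N) (hξ : IsCenteredIID ξ P r) (hr : 1 ≤ r)
    (L : E →L[ℝ] ℝ) : ∫ ω, L (psum ξ (τ ω) ω) ∂P = 0 := by
  simp only [hτ.psum_eq]
  exact hξ.integral_gatedSum hr hτ.measurableSet_lt N L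

theorem integral_bilin_psum (hτ : IsBoundedStop ξ τ N) (hξ : IsCenteredIID ξ P r) (hr : 2 ≤ r)
    (b : E →L[ℝ] E →L[ℝ] ℝ) :
    ∫ ω, b (psum ξ (τ ω) ω) (psum ξ (τ ω) ω) ∂P =
      (∫ ω, (τ ω : ℝ) ∂P) * ∫ ω, b (ξ 0 ω) (ξ 0 ω) ∂P := by
  simp only [hτ.psum_eq]
  rw [hξ.integral_bilin_gatedSum hr hτ.measurableSet_lt N b]
  congr 1
  have hm : ∀ n, MeasurableSet {ω | n < τ ω} := fun n => hξ.past_le n _ (hτ.measurableSet_lt n)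
  -- Counting the indices below τ identifies the sum of the gate probabilities with the mean of τ.
  have e : ∀ ω, (τ ω : ℝ) =
      ∑ i ∈ Finset.range N, {ω | i < τ ω}.indicator (fun _ => (1 : ℝ)) ω := by
    intro ω
    rw [← Finset.sum_subset (Finset.range_mono (hτ.le ω))]
    · rw [Finset.sum_congr rfl (g := fun _ => (1 : ℝ))]
      · simp
      · intro i hi
        rw [Set.indicator_of_mem]
        exact Finset.mem_range.1 hi
    · intro i _ hi
      rw [Set.indicator_of_notMem]
      simpa using hi
  simp only [e]
  rw [integral_finsetSum _ fun i _ => (integrable_const (1 : ℝ)).indicator (hm i)]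
  refine Finset.sum_congr rfl fun i _ => ?_
  rw [integral_indicator_const _ (hm i), smul_eq_mul, mul_one]

end IsBoundedStop

theorem IsCenteredIID.exists_integral_norm_psum_rpow_le {ξ : ℕ → Ω → E} {P : Measure Ω}
    [IsProbabilityMeasure P] {r : ℝ} (hξ : IsCenteredIID ξ P r) (hr : 2 < r) :
    ∃ K : ℝ, 0 ≤ K ∧ ∀ (τ : Ω → ℕ) (N : ℕ), IsBoundedStop ξ τ N →
      ∫ ω, ‖psum ξ (τ ω) ω‖ ^ r ∂P ≤ K * (N : ℝ) ^ (r / 2) := by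
  obtain ⟨K, hK0, hK⟩ := hξ.exists_integral_norm_gatedSum_rpow_le hr
  refine ⟨K, hK0, fun τ N hτ => ?_⟩
  simp only [hτ.psum_eq]
  exact hK _ hτ.measurableSet_lt N

namespace IsBoundedStop

variable {ξ : ℕ → Ω → E} {P : Measure Ω} [IsProbabilityMeasure P] {r : ℝ} {τ : Ω → ℕ} {N : ℕ}

theorem integrable_norm_psum_rpow (hτ : IsBoundedStop ξ τ N) (hξ : IsCenteredIID ξ P r)
    (hr : 0 < r) {p : ℝ} (hp : 0 ≤ p) (hpr : p ≤ r) :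
    Integrable (fun ω => ‖psum ξ (τ ω) ω‖ ^ p) P :=
  integrable_norm_rpow_of_memLp (hτ.memLp_psum hξ hr) hp hpr

theorem measurable_comp (hτ : IsBoundedStop ξ τ N) (hξ : IsCenteredIID ξ P r) {F : Type*}
    [MeasurableSpace F] {f : ℕ → Ω → F} (hf : ∀ n, Measurable (f n)) :
    Measurable fun ω => f (τ ω) ω := by
  have h : Measurable fun p : ℕ × Ω => f p.1 p.2 := measurable_from_prod_countable_right hf
  exact h.comp ((hτ.measurable hξ).prodMk measurable_id)

/-- The last summand before a bounded stopping time. -/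
theorem integral_norm_last_rpow_le (hτ : IsBoundedStop ξ τ N) (hξ : IsCenteredIID ξ P r)
    (hr : 0 < r) :
    Integrable (fun ω => {ω | 0 < τ ω}.indicator (fun ω => ‖ξ (τ ω - 1) ω‖ ^ r) ω) P ∧
    ∫ ω, {ω | 0 < τ ω}.indicator (fun ω => ‖ξ (τ ω - 1) ω‖ ^ r) ω ∂P ≤
      N * ∫ ω, ‖ξ 0 ω‖ ^ r ∂P := by
  have hm : MeasurableSet {ω | 0 < τ ω} := hξ.past_le 0 _ (hτ.measurableSet_lt 0)
  have hi : ∀ i, Integrable (fun ω => ‖ξ i ω‖ ^ r) P := fun i =>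
    integrable_norm_rpow_of_memLp (hξ.memLp hr i) hr.le le_rfl
  -- The index of the last summand is random and depends on the summands, so it is dominated by the
  -- sum over all indices. The price is a factor N, which makes the last summand of order N^{1/r} in
  -- L^r.
  have hb : ∀ ω, {ω | 0 < τ ω}.indicator (fun ω => ‖ξ (τ ω - 1) ω‖ ^ r) ω ≤
      ∑ i ∈ Finset.range N, ‖ξ i ω‖ ^ r := by
    intro ω
    by_cases h : 0 < τ ω
    · rw [Set.indicator_of_mem (by exact h)]
      refine Finset.single_le_sum (f := fun i => ‖ξ i ω‖ ^ r) (fun i _ => by positivity)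
        (Finset.mem_range.2 ?_)
      have := hτ.le ω
      omega
    · rw [Set.indicator_of_notMem (by exact h)]
      exact Finset.sum_nonneg fun i _ => by positivity
  have hsum : Integrable (fun ω => ∑ i ∈ Finset.range N, ‖ξ i ω‖ ^ r) P :=
    integrable_finsetSum _ fun i _ => hi i
  have hmeas : Measurable fun ω => ‖ξ (τ ω - 1) ω‖ ^ r :=
    hτ.measurable_comp hξ (f := fun n ω => ‖ξ (n - 1) ω‖ ^ r)
      fun n => ((hξ.measurable (n - 1)).norm.pow_const r)
  have hint : Integrable (fun ω => {ω | 0 < τ ω}.indicator (fun ω => ‖ξ (τ ω - 1) ω‖ ^ r) ω) P := by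
    refine Integrable.mono' hsum (hmeas.indicator hm).aestronglyMeasurable
      (ae_of_all _ fun ω => ?_)
    rw [Real.norm_of_nonneg (Set.indicator_nonneg (fun ω _ => by positivity) ω)]
    exact hb ω
  refine ⟨hint, (integral_mono hint hsum hb).trans ?_⟩
  rw [integral_finsetSum _ fun i _ => hi i]
  have : ∀ i ∈ Finset.range N, ∫ ω, ‖ξ i ω‖ ^ r ∂P = ∫ ω, ‖ξ 0 ω‖ ^ r ∂P := fun i _ =>
    hξ.integral_comp (f := fun x => ‖x‖ ^ r) (measurable_norm.pow_const r) i
  rw [Finset.sum_congr rfl this]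
  simp

end IsBoundedStop

end Stopping

/-! ### The stopping rule and the first passage as stopping times -/

section StopRule

variable {d : ℕ} {Ω : Type*} {X : ℕ → Ω → EuclideanSpace ℝ (Fin d)}
  {g : EuclideanSpace ℝ (Fin d) → ℝ} {a : ℝ} {ω : Ω}

/-- The boundary `a` has not been reached up to time `n`. -/
def NotCrossed (X : ℕ → Ω → EuclideanSpace ℝ (Fin d)) (g : EuclideanSpace ℝ (Fin d) → ℝ) (a : ℝ)
    (n : ℕ) (ω : Ω) : Prop :=
  ∀ k : ℕ, 1 ≤ k → k ≤ n → (k : ℝ) * g (sampleMean X k ω) < a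

theorem lt_passageTime_iff {n : ℕ} : (n : ℕ∞) < passageTime X g a ω ↔ NotCrossed X g a n ω := by
  unfold passageTime NotCrossed
  constructor
  · intro h k hk hkn
    by_contra hc
    have : sInf ((fun n : ℕ => (n : ℕ∞)) '' {n : ℕ | 1 ≤ n ∧ a ≤ (n : ℝ) * g (sampleMean X n ω)})
        ≤ (k : ℕ∞) := sInf_le ⟨k, ⟨hk, not_lt.1 hc⟩, rfl⟩
    have hkn' : (k : ℕ∞) ≤ n := by exact_mod_cast hkn
    exact absurd (h.trans_le (this.trans hkn')) (lt_irrefl _)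
  · intro h
    have h1 : (n : ℕ∞) + 1 ≤ sInf ((fun n : ℕ => (n : ℕ∞)) ''
        {n : ℕ | 1 ≤ n ∧ a ≤ (n : ℝ) * g (sampleMean X n ω)}) := by
      refine le_sInf ?_
      rintro _ ⟨k, ⟨hk, hak⟩, rfl⟩
      have : n < k := by
        by_contra hc
        exact absurd (h k hk (not_lt.1 hc)) (not_lt.2 hak)
      have h2 : ((n + 1 : ℕ) : ℕ∞) ≤ (k : ℕ∞) := ENat.natCast_le_natCast.2 this
      rw [Nat.cast_add, Nat.cast_one] at h2
      exact h2
    have h3 : (n : ℕ∞) < (n : ℕ∞) + 1 := by exact_mod_cast Nat.lt_succ_self n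
    exact h3.trans_le h1

/-- Reduces the rule to a statement about finitely many sample means. Its properties, including
measurability, are read off from this form rather than from the infimum in `ℕ∞`. -/
theorem lt_stopRule_iff {n₀ n₁ : ℝ → ℕ} {n : ℕ} :
    n < stopRule X g n₀ n₁ a ω ↔ n < n₀ a ∧ (n < n₁ a ∨ NotCrossed X g a n ω) := by
  have hfin : min (n₀ a : ℕ∞) (max (passageTime X g a ω) (n₁ a : ℕ∞)) ≠ ⊤ :=
    ne_top_of_le_ne_top (ENat.natCast_ne_top (n₀ a)) (min_le_left _ _)
  have h : ((stopRule X g n₀ n₁ a ω : ℕ) : ℕ∞) =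
      min (n₀ a : ℕ∞) (max (passageTime X g a ω) (n₁ a : ℕ∞)) := ENat.natCast_toNat hfin
  rw [← ENat.natCast_lt_natCast, h, lt_min_iff, lt_max_iff, lt_passageTime_iff, ENat.natCast_lt_natCast,
    ENat.natCast_lt_natCast, or_comm (a := NotCrossed X g a n ω)]

theorem NotCrossed.mono {k n : ℕ} (h : NotCrossed X g a n ω) (hkn : k ≤ n) :
    NotCrossed X g a k ω := fun j hj hjk => h j hj (hjk.trans hkn)

theorem stopRule_le {n₀ n₁ : ℝ → ℕ} : stopRule X g n₀ n₁ a ω ≤ n₀ a := by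
  by_contra h
  exact absurd (lt_stopRule_iff.1 (not_le.1 h)).1 (lt_irrefl _)

theorem le_stopRule {n₀ n₁ : ℝ → ℕ} (h : n₁ a ≤ n₀ a) : n₁ a ≤ stopRule X g n₀ n₁ a ω := by
  by_contra hc
  have hlt := not_le.1 hc
  exact absurd (lt_stopRule_iff.2 ⟨hlt.trans_le h, Or.inl hlt⟩) (lt_irrefl _)

theorem stopRule_eq_of_not_notCrossed {n₀ n₁ : ℝ → ℕ} (h : n₁ a ≤ n₀ a)
    (hc : ¬ NotCrossed X g a (n₁ a) ω) : stopRule X g n₀ n₁ a ω = n₁ a := by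
  refine le_antisymm (not_lt.1 fun hlt => ?_) (le_stopRule h)
  rcases (lt_stopRule_iff.1 hlt).2 with h1 | h1
  · exact lt_irrefl _ h1
  · exact hc h1

theorem notCrossed_of_lt_stopRule {n₀ n₁ : ℝ → ℕ} {n : ℕ} (hn : n₁ a ≤ n)
    (h : n < stopRule X g n₀ n₁ a ω) : NotCrossed X g a n ω :=
  (lt_stopRule_iff.1 h).2.resolve_left (not_lt.2 hn)

/-- If the rule stops strictly between `n₁` and `n₀`, the boundary is reached at that time. -/
theorem le_mul_of_stopRule_lt {n₀ n₁ : ℝ → ℕ} (h1 : n₁ a < stopRule X g n₀ n₁ a ω)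
    (h0 : stopRule X g n₀ n₁ a ω < n₀ a) :
    a ≤ (stopRule X g n₀ n₁ a ω : ℝ) * g (sampleMean X (stopRule X g n₀ n₁ a ω) ω) := by
  set T := stopRule X g n₀ n₁ a ω with hT
  have hpre : NotCrossed X g a (T - 1) ω :=
    notCrossed_of_lt_stopRule (n₀ := n₀) (n₁ := n₁) (by omega) (by omega)
  have hnot : ¬ NotCrossed X g a T ω := fun h =>
    absurd (lt_stopRule_iff.2 ⟨h0, Or.inr h⟩) (lt_irrefl _)
  by_contra hc
  refine hnot fun k hk hkT => ?_
  rcases Nat.lt_or_ge k T with h | h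
  · exact hpre k hk (by omega)
  · have : k = T := le_antisymm hkT h
    rw [this]; exact not_le.1 hc

/-- The passage time truncated at `n`. -/
noncomputable def truncPassage (X : ℕ → Ω → EuclideanSpace ℝ (Fin d)) (g : EuclideanSpace ℝ (Fin d) → ℝ) (a : ℝ)
    (n : ℕ) (ω : Ω) : ℕ :=
  stopRule X g (fun _ => n) (fun _ => 0) a ω

theorem lt_truncPassage_iff {k n : ℕ} :
    k < truncPassage X g a n ω ↔ k < n ∧ NotCrossed X g a k ω := by
  unfold truncPassage
  rw [lt_stopRule_iff]
  simp

theorem truncPassage_le {n : ℕ} : truncPassage X g a n ω ≤ n :=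
  stopRule_le (n₀ := fun _ => n)

theorem truncPassage_eq_of_notCrossed {n : ℕ} (h : NotCrossed X g a n ω) :
    truncPassage X g a n ω = n := by
  refine le_antisymm truncPassage_le (not_lt.1 fun hlt => ?_)
  exact absurd (lt_truncPassage_iff.2 ⟨hlt, h.mono hlt.le⟩) (lt_irrefl _)

theorem truncPassage_spec {n : ℕ} (h : ¬ NotCrossed X g a n ω) :
    1 ≤ truncPassage X g a n ω ∧
      a ≤ (truncPassage X g a n ω : ℝ) * g (sampleMean X (truncPassage X g a n ω) ω) := by
  set T := truncPassage X g a n ω with hT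
  have hTn : T ≤ n := truncPassage_le
  have hnot : ¬ NotCrossed X g a T ω := by
    intro hc
    rcases hTn.lt_or_eq with h1 | h1
    · exact absurd (lt_truncPassage_iff.2 ⟨h1, hc⟩) (lt_irrefl _)
    · exact h (h1 ▸ hc)
  -- At time 0 the condition of not having crossed is vacuous, since crossing times start at 1.
  have hpos : 1 ≤ T := by
    by_contra hc
    exact hnot fun k hk hkT => by omega
  refine ⟨hpos, ?_⟩
  by_contra hc
  have hpre : NotCrossed X g a (T - 1) ω := (lt_truncPassage_iff.1 (show T - 1 < T by omega)).2
  refine hnot fun k hk hkT => ?_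
  rcases Nat.lt_or_ge k T with h | h
  · exact hpre k hk (by omega)
  · have : k = T := le_antisymm hkT h
    rw [this]; exact not_le.1 hc

variable [MeasurableSpace Ω]

theorem psum_sub_eq {m : EuclideanSpace ℝ (Fin d)} {n : ℕ} (hn : 1 ≤ n) :
    sampleMean X n ω - m = (n : ℝ)⁻¹ • psum (fun i ω => X i ω - m) n ω := by
  have : (n : ℝ) ≠ 0 := by positivity
  unfold sampleMean psum
  rw [Finset.sum_sub_distrib, smul_sub]
  simp only [Finset.sum_const, Finset.card_range]
  rw [← Nat.cast_smul_eq_nsmul ℝ, smul_smul, inv_mul_cancel₀ this, one_smul]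

/-- The sample means up to time n are functions of the first n centered variables, because adding m
back recovers the original ones. -/
theorem measurableSet_past_notCrossed {m : EuclideanSpace ℝ (Fin d)} (hg : Measurable g) (n : ℕ) :
    MeasurableSet[past (fun i ω => X i ω - m) n] {ω | NotCrossed X g a n ω} := by
  have hS : ∀ k ≤ n, Measurable[past (fun i ω => X i ω - m) n] (sampleMean X k) := by
    intro k hk
    unfold sampleMean
    have h1 : Measurable[past (fun i ω => X i ω - m) n]
        (fun ω => ∑ i ∈ Finset.range k, X i ω) := by
      refine Finset.measurable_fun_sum _ fun i hi => ?_
      have := (measurable_past (fun i ω => X i ω - m)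
        ((Finset.mem_range.1 hi).trans_le hk)).add_const m
      simpa using this
    exact h1.const_smul ((k : ℝ)⁻¹)
  have : {ω | NotCrossed X g a n ω} = ⋂ k : ℕ, ⋂ _ : 1 ≤ k, ⋂ _ : k ≤ n,
      {ω | (k : ℝ) * g (sampleMean X k ω) < a} := by
    ext ω; simp [NotCrossed]
  rw [this]
  refine MeasurableSet.iInter fun k => MeasurableSet.iInter fun _ => MeasurableSet.iInter fun hk => ?_
  have hm : Measurable[past (fun i ω => X i ω - m) n]
      fun ω => (k : ℝ) * g (sampleMean X k ω) := by
    have hg' : Measurable fun x => (k : ℝ) * g x := hg.const_mul _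
    exact hg'.comp (hS k hk)
  exact hm measurableSet_Iio

theorem isBoundedStop_stopRule {m : EuclideanSpace ℝ (Fin d)} (hg : Measurable g)
    (n₀ n₁ : ℝ → ℕ) (a : ℝ) :
    IsBoundedStop (fun i ω => X i ω - m) (stopRule X g n₀ n₁ a) (n₀ a) := by
  refine ⟨fun n => ?_, fun ω => stopRule_le⟩
  simp only [lt_stopRule_iff]
  exact (MeasurableSet.const _).inter
    ((MeasurableSet.const _).union (measurableSet_past_notCrossed hg n))

theorem isBoundedStop_truncPassage {m : EuclideanSpace ℝ (Fin d)} (hg : Measurable g)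
    (a : ℝ) (n : ℕ) :
    IsBoundedStop (fun i ω => X i ω - m) (truncPassage X g a n) n :=
  isBoundedStop_stopRule hg (fun _ => n) (fun _ => 0) a

end StopRule

end SeqBias

/-! ### Maximal inequality and negligibility of early crossings -/

namespace SeqBias

theorem tendsto_zero_of_forall_le_add {ι : Type*} {l : Filter ι} {f : ι → ℝ} (hf : ∀ᶠ a in l, 0 ≤ f a)
    (h : ∀ ε > 0, ∃ u : ι → ℝ, Tendsto u l (𝓝 0) ∧ ∀ᶠ a in l, f a ≤ ε + u a) :
    Tendsto f l (𝓝 0) := by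
  rw [Metric.tendsto_nhds]
  intro ε hε
  obtain ⟨u, hu, hle⟩ := h (ε / 2) (by linarith)
  filter_upwards [hf, hle, (hu.eventually (gt_mem_nhds (by linarith : (0 : ℝ) < ε / 2)))]
    with a h1 h2 h3
  rw [Real.dist_eq, sub_zero, abs_of_nonneg h1]
  linarith

section Estimates

variable {d : ℕ} {Ω : Type*} [MeasurableSpace Ω] {X : ℕ → Ω → EuclideanSpace ℝ (Fin d)}
  {m : EuclideanSpace ℝ (Fin d)} {P : Measure Ω} [IsProbabilityMeasure P] {r : ℝ}
  {g : EuclideanSpace ℝ (Fin d) → ℝ}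

theorem mul_norm_sampleMean_sub {k : ℕ} (hk : 1 ≤ k) (ω : Ω) :
    (k : ℝ) * ‖sampleMean X k ω - m‖ = ‖psum (fun i ω => X i ω - m) k ω‖ := by
  have : (0 : ℝ) < k := by exact_mod_cast hk
  rw [psum_sub_eq hk, norm_smul, norm_inv, Real.norm_of_nonneg this.le, ← mul_assoc,
    mul_inv_cancel₀ this.ne', one_mul]

/-- A maximal inequality for the centered partial sums. -/
theorem exists_prob_max_psum_le (hξ : IsCenteredIID (fun i ω => X i ω - m) P r) (hr : 2 < r) :
    ∃ K : ℝ, 0 ≤ K ∧ ∀ (N : ℕ) (c : ℝ), 0 < c →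
      P.real {ω | ∃ k, 1 ≤ k ∧ k ≤ N ∧ c ≤ ‖psum (fun i ω => X i ω - m) k ω‖} ≤
        K * (N : ℝ) ^ (r / 2) / c ^ r := by
  obtain ⟨K, hK0, hK⟩ := hξ.exists_integral_norm_psum_rpow_le hr
  refine ⟨K, hK0, fun N c hc => ?_⟩
  have hr0 : 0 < r := by linarith
  set ξ : ℕ → Ω → EuclideanSpace ℝ (Fin d) := fun i ω => X i ω - m with hξd
  -- With this boundary function k · G(X̄_k) is the norm of the centered sum, so the first passage
  -- over c is the first time that the norm reaches c. Markov's inequality at that stopping time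
  -- replaces Doob's inequality.
  set G : EuclideanSpace ℝ (Fin d) → ℝ := fun x => ‖x - m‖ with hG
  have hGm : Measurable G := (measurable_id.sub_const m).norm
  have hτ : IsBoundedStop ξ (truncPassage X G c N) N := isBoundedStop_truncPassage hGm c N
  have hsub : {ω | ∃ k, 1 ≤ k ∧ k ≤ N ∧ c ≤ ‖psum ξ k ω‖} ⊆
      {ω | c ^ r ≤ ‖psum ξ (truncPassage X G c N ω) ω‖ ^ r} := by
    rintro ω ⟨k, hk, hkN, hck⟩
    have hnot : ¬ NotCrossed X G c N ω := by
      intro h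
      have := h k hk hkN
      rw [hG, mul_norm_sampleMean_sub hk] at this
      linarith
    obtain ⟨h1, h2⟩ := truncPassage_spec hnot
    rw [hG, mul_norm_sampleMean_sub h1] at h2
    exact Real.rpow_le_rpow hc.le h2 hr0.le
  rw [le_div_iff₀ (by positivity), mul_comm]
  have hmk := mul_meas_ge_le_integral_of_nonneg (μ := P)
    (f := fun ω => ‖psum ξ (truncPassage X G c N ω) ω‖ ^ r)
    (ae_of_all _ fun ω => by positivity) (hτ.integrable_norm_psum_rpow hξ hr0 hr0.le le_rfl) (c ^ r)
  exact (mul_le_mul_of_nonneg_left (measureReal_mono hsub) (by positivity)).trans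
    (hmk.trans (hK _ N hτ))

/-- Once the boundary is reached, the truncation level is irrelevant. A crossing inside a dyadic
block can therefore be estimated with the moment bound at the scale of that block instead of at n₁.
-/
theorem truncPassage_eq_of_not_notCrossed {a : ℝ} {k n : ℕ} {ω : Ω} (h : ¬ NotCrossed X g a n ω)
    (hk : truncPassage X g a n ω ≤ k) : truncPassage X g a k ω = truncPassage X g a n ω := by
  refine eq_of_forall_lt_iff fun j => ?_
  rw [lt_truncPassage_iff]
  constructor
  · rintro ⟨_, h2⟩
    exact lt_truncPassage_iff.2 ⟨lt_of_not_ge fun hnj => h (h2.mono hnj), h2⟩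
  · intro h1
    exact ⟨h1.trans_le hk, (lt_truncPassage_iff.1 h1).2⟩

/-- For fixed k each path eventually stays below the growing boundary, so dominated convergence
applies; no growth condition on g enters. -/
theorem tendsto_integral_crossing_at (hξ : IsCenteredIID (fun i ω => X i ω - m) P r) (hr : 2 < r)
    (hX : ∀ i, Measurable (X i)) (hg : Measurable g) (k : ℕ) :
    Tendsto (fun a : ℝ => ∫ ω, {ω | a ≤ (k : ℝ) * g (sampleMean X k ω)}.indicator
      (fun ω => 1 + ‖psum (fun i ω => X i ω - m) k ω‖) ω ∂P) atTop (𝓝 0) := by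
  have hS : Measurable (sampleMean X k) :=
    (Finset.measurable_fun_sum _ fun i _ => hX i).const_smul ((k : ℝ)⁻¹)
  have hs := IsBoundedStop.const (fun i ω => X i ω - m) k
  have hi : Integrable (fun ω => 1 + ‖psum (fun i ω => X i ω - m) k ω‖) P := by
    refine (integrable_const 1).add ?_
    have := hs.integrable_norm_psum_rpow hξ (by linarith) (p := 1) zero_le_one (by linarith)
    simpa using this
  have hm : ∀ a : ℝ, MeasurableSet {ω | a ≤ (k : ℝ) * g (sampleMean X k ω)} := fun a =>
    measurableSet_le measurable_const ((hg.comp hS).const_mul _)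
  have h0 : (0 : ℝ) = ∫ _ : Ω, (0 : ℝ) ∂P := by simp
  rw [h0]
  refine tendsto_integral_filter_of_dominated_convergence
    (fun ω => 1 + ‖psum (fun i ω => X i ω - m) k ω‖)
    (Eventually.of_forall fun a => (hi.1.indicator (hm a))) ?_ hi ?_
  · refine Eventually.of_forall fun a => ae_of_all _ fun ω => ?_
    rw [Real.norm_of_nonneg (Set.indicator_nonneg (fun ω _ => by positivity) ω)]
    exact Set.indicator_le_self' (fun ω _ => by positivity) ω
  · refine ae_of_all _ fun ω => ?_
    refine tendsto_const_nhds.congr' ?_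
    filter_upwards [eventually_gt_atTop ((k : ℝ) * g (sampleMean X k ω))] with a ha
    rw [Set.indicator_of_notMem]
    exact not_le.2 ha

/-- Crossings before the minimal time `n₁` contribute negligibly. -/
theorem tendsto_integral_early_crossing (hξ : IsCenteredIID (fun i ω => X i ω - m) P r)
    (hr : 2 < r) (hX : ∀ i, Measurable (X i)) (hg : Measurable g) {n₁ : ℝ → ℕ} {δ β : ℝ}
    (hδ : 0 < δ) (hβ : 0 < β) (hgβ : ∀ x, ‖x - m‖ ≤ δ → g x ≤ β)
    (hn : ∀ᶠ a in atTop, (n₁ a : ℝ) * β < a) :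
    Tendsto (fun a : ℝ => ∫ ω, {ω | ¬ NotCrossed X g a (n₁ a) ω}.indicator (fun ω =>
      1 + ‖psum (fun i ω => X i ω - m) (truncPassage X g a (n₁ a) ω) ω‖) ω ∂P) atTop (𝓝 0) := by
  obtain ⟨K, hK0, hK⟩ := hξ.exists_integral_norm_psum_rpow_le hr
  have hr0 : 0 < r := by linarith
  set ξ : ℕ → Ω → EuclideanSpace ℝ (Fin d) := fun i ω => X i ω - m with hξd
  set c : ℝ := (1 + 1 / δ) * δ ^ (1 - r) with hc
  have hc0 : 0 ≤ c := by positivity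
  set q : ℝ := 2 ^ (1 - r / 2) with hq
  have hq0 : 0 < q := by positivity
  have hq1 : q < 1 := Real.rpow_lt_one_of_one_lt_of_neg (by norm_num) (by linarith)
  have hNCm : ∀ (a : ℝ) n, MeasurableSet {ω | NotCrossed X g a n ω} := fun a n =>
    hξ.past_le n _ (measurableSet_past_notCrossed hg n)
  have hτ : ∀ (a : ℝ) n, IsBoundedStop ξ (truncPassage X g a n) n := fun a n =>
    isBoundedStop_truncPassage hg a n
  refine tendsto_zero_of_forall_le_add
    (Eventually.of_forall fun a => integral_nonneg fun ω =>
      Set.indicator_nonneg (fun ω _ => by positivity) ω) fun ε hε => ?_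
  -- The finitely many crossing times up to 2^J are negligible one at a time. The dyadic blocks
  -- beyond form a geometric tail of ratio q = 2^{1−r/2} < 1, made smaller than ε by the choice of
  -- J.
  obtain ⟨J, hJ⟩ : ∃ J : ℕ, c * K * 2 ^ (r / 2) * (q ^ J / (1 - q)) ≤ ε := by
    have : Tendsto (fun J : ℕ => c * K * 2 ^ (r / 2) * (q ^ J / (1 - q))) atTop (𝓝 0) := by
      have := ((tendsto_pow_atTop_nhds_zero_of_lt_one hq0.le hq1).div_const (1 - q)).const_mul
        (c * K * 2 ^ (r / 2))
      simpa using this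
    obtain ⟨J, hJ⟩ := (this.eventually (gt_mem_nhds hε)).exists
    exact ⟨J, hJ.le⟩
  set A : ℝ → ℕ → Ω → ℝ := fun a k => {ω | a ≤ (k : ℝ) * g (sampleMean X k ω)}.indicator
      (fun ω => 1 + ‖psum ξ k ω‖) with hA
  refine ⟨fun a => ∑ k ∈ Finset.range (2 ^ J + 1), ∫ ω, A a k ω ∂P, ?_, ?_⟩
  · have := tendsto_finsetSum (Finset.range (2 ^ J + 1))
      fun k _ => tendsto_integral_crossing_at hξ hr hX hg k
    simpa using this
  filter_upwards [hn] with a ha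
  have hA0 : ∀ k ω, 0 ≤ A a k ω := fun k ω => Set.indicator_nonneg (fun ω _ => by positivity) ω
  -- Crossing at T in the block (2^j, 2^{j+1}] forces y = ‖S_T‖ ≥ δ 2^j, hence 1 + y ≤ c (2^j)^{1−r}
  -- y^r. The moment bound truncated at 2^{j+1} makes the integral of order 2^{j(1−r)} · 2^{jr/2} =
  -- q^j.
  set D : ℕ → Ω → ℝ := fun j ω => c * ((2 : ℝ) ^ j) ^ (1 - r) *
    ‖psum ξ (truncPassage X g a (2 ^ (j + 1)) ω) ω‖ ^ r with hD
  have hD0 : ∀ j ω, 0 ≤ D j ω := fun j ω => by positivity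
  have hpt : ∀ ω, {ω | ¬ NotCrossed X g a (n₁ a) ω}.indicator (fun ω =>
      1 + ‖psum ξ (truncPassage X g a (n₁ a) ω) ω‖) ω ≤
      ∑ k ∈ Finset.range (2 ^ J + 1), A a k ω + ∑ j ∈ Finset.Ico J (n₁ a + 1), D j ω := by
    intro ω
    have hs1 : 0 ≤ ∑ k ∈ Finset.range (2 ^ J + 1), A a k ω := Finset.sum_nonneg fun k _ => hA0 k ω
    have hs2 : 0 ≤ ∑ j ∈ Finset.Ico J (n₁ a + 1), D j ω := Finset.sum_nonneg fun j _ => hD0 j ω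
    by_cases hω : NotCrossed X g a (n₁ a) ω
    · rw [Set.indicator_of_notMem (by simpa using hω)]
      positivity
    rw [Set.indicator_of_mem (by exact hω)]
    obtain ⟨h1, h2⟩ := truncPassage_spec hω
    set T := truncPassage X g a (n₁ a) ω with hT
    have hTn : T ≤ n₁ a := truncPassage_le
    rcases Nat.lt_or_ge T (2 ^ J + 1) with h3 | h3
    · have : A a T ω ≤ ∑ k ∈ Finset.range (2 ^ J + 1), A a k ω :=
        Finset.single_le_sum (f := fun k => A a k ω) (fun k _ => hA0 k ω) (Finset.mem_range.2 h3)
      have e : A a T ω = 1 + ‖psum ξ T ω‖ := Set.indicator_of_mem (by exact h2) _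
      linarith
    · have hTpos : (0 : ℝ) < T := by exact_mod_cast h1
      -- A sample mean within δ of m would give T g ≤ T β ≤ n₁ β < a, contradicting the crossing at
      -- T.
      have hbig : δ * T < ‖psum ξ T ω‖ := by
        by_contra hcon
        rw [← mul_norm_sampleMean_sub h1] at hcon
        have hx : ‖sampleMean X T ω - m‖ ≤ δ := by
          have := not_lt.1 hcon
          rw [mul_comm] at this
          exact le_of_mul_le_mul_right this hTpos
        have h4 := mul_le_mul_of_nonneg_left (hgβ _ hx) hTpos.le
        have h5 : (T : ℝ) * β ≤ n₁ a * β := by gcongr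
        linarith
      obtain ⟨j, hj1, hj2⟩ : ∃ j, 2 ^ j < T ∧ T ≤ 2 ^ (j + 1) := by
        have hT2 : 2 ≤ T := by have := Nat.one_le_two_pow (n := J); omega
        refine ⟨Nat.log 2 (T - 1), ?_, ?_⟩
        · have := Nat.pow_log_le_self 2 (x := T - 1) (by omega)
          omega
        · have := Nat.lt_pow_succ_log_self (b := 2) (by norm_num) (T - 1)
          omega
      have hjJ : J ≤ j := by
        have : 2 ^ J < 2 ^ (j + 1) := by omega
        have := (Nat.pow_lt_pow_iff_right (by norm_num : 1 < 2)).1 this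
        omega
      have hjn : j < n₁ a + 1 := by
        have := Nat.lt_two_pow_self (n := j)
        omega
      have hle : D j ω ≤ ∑ j ∈ Finset.Ico J (n₁ a + 1), D j ω :=
        Finset.single_le_sum (f := fun j => D j ω) (fun j _ => hD0 j ω)
          (Finset.mem_Ico.2 ⟨hjJ, hjn⟩)
      have hTj : truncPassage X g a (2 ^ (j + 1)) ω = T :=
        truncPassage_eq_of_not_notCrossed hω hj2
      set y := ‖psum ξ T ω‖ with hy
      have h2j : (0 : ℝ) < 2 ^ j := by positivity
      have hyj : δ * 2 ^ j ≤ y := by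
        have : ((2 : ℝ) ^ j) ≤ T := by exact_mod_cast hj1.le
        nlinarith
      have hypos : 0 < y := lt_of_lt_of_le (by positivity) hyj
      have hy1 : 1 + y ≤ (1 + 1 / δ) * y := by
        have h1T : (1 : ℝ) ≤ T := by exact_mod_cast h1
        have : δ ≤ y := by nlinarith
        have : 1 ≤ 1 / δ * y := by rw [one_div, inv_mul_eq_div, le_div_iff₀ hδ]; linarith
        linarith
      have hy2 : y ≤ (δ * 2 ^ j) ^ (1 - r) * y ^ r := by
        have h6 : y ^ (1 - r) ≤ (δ * 2 ^ j) ^ (1 - r) :=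
          Real.rpow_le_rpow_of_nonpos (by positivity) hyj (by linarith)
        have h7 : y = y ^ (1 - r) * y ^ r := by
          rw [← Real.rpow_add hypos]; simp
        calc y = y ^ (1 - r) * y ^ r := h7
          _ ≤ _ := mul_le_mul_of_nonneg_right h6 (by positivity)
      have hfin : 1 + y ≤ D j ω := by
        have e : D j ω = (1 + 1 / δ) * ((δ * 2 ^ j) ^ (1 - r) * y ^ r) := by
          simp only [hD]
          rw [hTj, ← hy, Real.mul_rpow hδ.le h2j.le, hc]
          ring
        rw [e]
        exact hy1.trans (mul_le_mul_of_nonneg_left hy2 (by positivity))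
      linarith
  have hAi : ∀ k, Integrable (A a k) P := by
    intro k
    have hS : Measurable (sampleMean X k) :=
      (Finset.measurable_fun_sum _ fun i _ => hX i).const_smul ((k : ℝ)⁻¹)
    refine Integrable.indicator ?_ (measurableSet_le measurable_const ((hg.comp hS).const_mul _))
    refine (integrable_const 1).add ?_
    have := (IsBoundedStop.const ξ k).integrable_norm_psum_rpow hξ hr0 (p := 1) zero_le_one
      (by linarith)
    simpa using this
  have hDi : ∀ j, Integrable (D j) P := fun j =>
    ((hτ a _).integrable_norm_psum_rpow hξ hr0 hr0.le le_rfl).const_mul _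
  have hLi : Integrable (fun ω => {ω | ¬ NotCrossed X g a (n₁ a) ω}.indicator (fun ω =>
      1 + ‖psum ξ (truncPassage X g a (n₁ a) ω) ω‖) ω) P := by
    refine Integrable.indicator ?_ (hNCm a _).compl
    refine (integrable_const 1).add ?_
    have := (hτ a (n₁ a)).integrable_norm_psum_rpow hξ hr0 (p := 1) zero_le_one
      (by linarith)
    simpa using this
  have hDint : ∀ j, ∫ ω, D j ω ∂P ≤ c * K * 2 ^ (r / 2) * q ^ j := by
    intro j
    simp only [hD]
    rw [integral_const_mul]
    have h1 := hK _ _ (hτ a (2 ^ (j + 1)))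
    have h2 : (0 : ℝ) ≤ c * ((2 : ℝ) ^ j) ^ (1 - r) := by positivity
    refine (mul_le_mul_of_nonneg_left h1 h2).trans (le_of_eq ?_)
    have h2j : (0 : ℝ) < 2 ^ j := by positivity
    push_cast
    rw [pow_succ, Real.mul_rpow h2j.le (by norm_num), hq, ← Real.rpow_natCast (2 ^ (1 - r / 2) : ℝ),
      ← Real.rpow_mul (by norm_num), mul_comm (1 - r / 2), Real.rpow_mul (by norm_num),
      Real.rpow_natCast]
    have : ((2 : ℝ) ^ j) ^ (1 - r / 2) = ((2 : ℝ) ^ j) ^ (1 - r) * ((2 : ℝ) ^ j) ^ (r / 2) := by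
      rw [← Real.rpow_add h2j]; ring_nf
    rw [this]; ring
  calc _ ≤ ∫ ω, (∑ k ∈ Finset.range (2 ^ J + 1), A a k ω
        + ∑ j ∈ Finset.Ico J (n₁ a + 1), D j ω) ∂P :=
        integral_mono hLi ((integrable_finsetSum _ fun k _ => hAi k).add
          (integrable_finsetSum _ fun j _ => hDi j)) hpt
    _ = ∑ k ∈ Finset.range (2 ^ J + 1), ∫ ω, A a k ω ∂P
        + ∑ j ∈ Finset.Ico J (n₁ a + 1), ∫ ω, D j ω ∂P := by
        rw [integral_add (integrable_finsetSum _ fun k _ => hAi k)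
          (integrable_finsetSum _ fun j _ => hDi j), integral_finsetSum _ fun k _ => hAi k,
          integral_finsetSum _ fun j _ => hDi j]
    _ ≤ ∑ k ∈ Finset.range (2 ^ J + 1), ∫ ω, A a k ω ∂P + ε := by
        gcongr
        refine (Finset.sum_le_sum fun j _ => hDint j).trans ?_
        rw [← Finset.mul_sum]
        refine le_trans ?_ hJ
        gcongr
        exact geom_sum_Ico_le_of_lt_one hq0.le hq1
    _ = _ := add_comm _ _

end Estimates

end SeqBias

/-! ### Families of random vectors of order a^s in L^r -/

namespace SeqBias

section ScaledFamilies

variable {Ω E : Type*} [MeasurableSpace Ω] [NormedAddCommGroup E] [InnerProductSpace ℝ E]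
  [CompleteSpace E] [MeasurableSpace E] [BorelSpace E] [SecondCountableTopology E]
  {P : Measure Ω} [IsProbabilityMeasure P] {r C : ℝ} {W : ℝ → Ω → E}

/-- A family of random vectors which is of order `a ^ s` in `L^r`, in the sense that the absolute
moment of order `r` of `W a` is at most `C * a ^ (r * s)` for large `a`. -/
structure HasMomentScale (W : ℝ → Ω → E) (P : Measure Ω) (r s C : ℝ) : Prop where
  memLp : ∀ a, MemLp (W a) (ENNReal.ofReal r) P
  nonneg : 0 ≤ C
  moment : ∀ᶠ a in atTop, ∫ ω, ‖W a ω‖ ^ r ∂P ≤ C * a ^ (r * s)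

namespace HasMomentScale

theorem integrable_rpow {s : ℝ} (hW : HasMomentScale W P r s C) {p : ℝ} (hp : 0 ≤ p) (hpr : p ≤ r)
    (a : ℝ) : Integrable (fun ω => ‖W a ω‖ ^ p) P :=
  integrable_norm_rpow_of_memLp (hW.memLp a) hp hpr

theorem integrable_mul_rpow {s : ℝ} (hW : HasMomentScale W P r s C) {p : ℝ} (hp : 0 ≤ p)
    (hpr : p ≤ r) {a M : ℝ} {θ : Ω → ℝ} (hθ : Measurable θ) (hθM : ∀ ω, |θ ω| ≤ M) :
    Integrable (fun ω => θ ω * ‖W a ω‖ ^ p) P := by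
  have := (hW.integrable_rpow hp hpr a).bdd_mul (c := M) hθ.aestronglyMeasurable
    (ae_of_all _ fun ω => by simpa using hθM ω)
  simpa using this

/-- Truncation bound: the contribution of `‖W‖ ^ p` weighted by a bounded factor. -/
theorem integral_mul_rpow_le {s : ℝ} (hW : HasMomentScale W P r s C) {p : ℝ} (hp : 0 ≤ p)
    (hpr : p ≤ r) {M : ℝ} : ∀ᶠ a in atTop, ∀ (θ : Ω → ℝ), Measurable θ → (∀ ω, 0 ≤ θ ω) →
      (∀ ω, θ ω ≤ M) → ∀ t : ℝ, 0 < t →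
      ∫ ω, θ ω * ‖W a ω‖ ^ p ∂P ≤ t ^ p * ∫ ω, θ ω ∂P + t ^ (p - r) * M * (C * a ^ (r * s)) := by
  filter_upwards [hW.moment] with a ha θ hθ h0 hM t ht
  have hr0 : 0 ≤ r := hp.trans hpr
  have hM0 : 0 ≤ M := by
    rcases isEmpty_or_nonempty Ω with h | ⟨⟨ω⟩⟩
    · exact absurd (measure_univ (μ := P)) (by simp [Set.univ_eq_empty_iff.2 h])
    · exact (h0 ω).trans (hM ω)
  have hθM : ∀ ω, |θ ω| ≤ M := fun ω => by rw [abs_of_nonneg (h0 ω)]; exact hM ω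
  have hθi : Integrable θ P := by
    refine Integrable.mono' (integrable_const M) hθ.aestronglyMeasurable (ae_of_all _ fun ω => ?_)
    simpa using hθM ω
  have hr := hW.integrable_rpow hr0 le_rfl a
  calc ∫ ω, θ ω * ‖W a ω‖ ^ p ∂P
      ≤ ∫ ω, (t ^ p * θ ω + t ^ (p - r) * M * ‖W a ω‖ ^ r) ∂P := by
        refine integral_mono (hW.integrable_mul_rpow hp hpr hθ hθM)
          ((hθi.const_mul _).add (hr.const_mul _)) fun ω => ?_
        have h1 := mul_le_mul_of_nonneg_left
          (rpow_le_add_rpow (norm_nonneg (W a ω)) ht hp hpr) (h0 ω)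
        have h2 : θ ω * (t ^ (p - r) * ‖W a ω‖ ^ r) ≤ M * (t ^ (p - r) * ‖W a ω‖ ^ r) :=
          mul_le_mul_of_nonneg_right (hM ω) (by positivity)
        simp only
        linarith
    _ = t ^ p * ∫ ω, θ ω ∂P + t ^ (p - r) * M * ∫ ω, ‖W a ω‖ ^ r ∂P := by
        rw [integral_add (hθi.const_mul _) (hr.const_mul _), integral_const_mul,
          integral_const_mul]
    _ ≤ _ := by gcongr

/-- The truncation bound with unit weight, at the level a^s that balances its two terms. -/
theorem integral_rpow_le {s : ℝ} (hW : HasMomentScale W P r s C) {p : ℝ} (hp : 0 ≤ p)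
    (hpr : p ≤ r) : ∀ᶠ a in atTop, ∫ ω, ‖W a ω‖ ^ p ∂P ≤ (1 + C) * a ^ (p * s) := by
  filter_upwards [hW.integral_mul_rpow_le hp hpr (M := 1), eventually_gt_atTop 0] with a ha ha0
  have h := ha (fun _ => 1) measurable_const (fun _ => zero_le_one) (fun _ => le_rfl) (a ^ s)
    (by positivity)
  simp only [one_mul, integral_const, probReal_univ, smul_eq_mul, mul_one] at h
  refine h.trans (le_of_eq ?_)
  rw [← Real.rpow_mul ha0.le, ← Real.rpow_mul ha0.le]
  have : a ^ (s * (p - r)) * (C * a ^ (r * s)) = C * a ^ (s * p) := by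
    have e : s * p = s * (p - r) + r * s := by ring
    rw [e, Real.rpow_add ha0]; ring
  rw [this, mul_comm p s]; ring

/-- Uniform integrability of ‖W‖²/a. Truncation at s√a leaves s² E θ plus a multiple of s^{2−r}; s
is fixed large first, then a → ∞. -/
theorem tendsto_integral_mul_sq (hr : 2 < r) (hW : HasMomentScale W P r (1 / 2) C) {M : ℝ}
    {θ : ℝ → Ω → ℝ} (hθ : ∀ a, Measurable (θ a)) (h0 : ∀ a ω, 0 ≤ θ a ω)
    (hM : ∀ᶠ a in atTop, ∀ ω, θ a ω ≤ M) (hlim : Tendsto (fun a => ∫ ω, θ a ω ∂P) atTop (𝓝 0)) :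
    Tendsto (fun a => (∫ ω, θ a ω * ‖W a ω‖ ^ (2 : ℝ) ∂P) / a) atTop (𝓝 0) := by
  refine tendsto_zero_of_forall_le_add ?_ fun ε hε => ?_
  · filter_upwards [eventually_gt_atTop 0] with a ha
    exact div_nonneg (integral_nonneg fun ω => mul_nonneg (h0 a ω) (by positivity)) ha.le
  obtain ⟨s, hs0, hs⟩ : ∃ s : ℝ, 0 < s ∧ s ^ (2 - r) * M * C ≤ ε := by
    have : Tendsto (fun s : ℝ => s ^ (2 - r) * M * C) atTop (𝓝 0) := by
      have := ((tendsto_rpow_neg_atTop (by linarith : 0 < r - 2)).mul_const M).mul_const C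
      simpa using this
    obtain ⟨s, h1, h2⟩ := ((this.eventually (gt_mem_nhds hε)).and (eventually_gt_atTop 0)).exists
    exact ⟨s, h2, h1.le⟩
  refine ⟨fun a => s ^ 2 * ∫ ω, θ a ω ∂P, by simpa using hlim.const_mul (s ^ 2), ?_⟩
  filter_upwards [hW.integral_mul_rpow_le (p := 2) (by norm_num) hr.le (M := M),
    eventually_gt_atTop 0, hM] with a ha ha0 hMa
  have h := ha (θ a) (hθ a) (h0 a) hMa (s * √a) (by positivity)
  rw [div_le_iff₀ ha0]
  refine h.trans ?_
  have e1 : (s * √a) ^ (2 : ℝ) = s ^ 2 * a := by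
    rw [Real.rpow_ofNat, mul_pow, Real.sq_sqrt ha0.le]
  have e2 : (s * √a) ^ (2 - r) * M * (C * a ^ (r * (1 / 2))) = s ^ (2 - r) * M * C * a := by
    rw [Real.mul_rpow hs0.le (Real.sqrt_nonneg _), Real.sqrt_eq_rpow, ← Real.rpow_mul ha0.le]
    have : a ^ (1 / 2 * (2 - r)) * a ^ (r * (1 / 2)) = a := by
      rw [← Real.rpow_add ha0]; ring_nf; simp
    linear_combination s ^ (2 - r) * M * C * this
  rw [e1, e2]
  nlinarith [mul_le_mul_of_nonneg_right hs ha0.le]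

/-- There is no division by a here, so a rate for the weight is required. Truncation at level a
makes both terms of order a^{1−r/2}. -/
theorem tendsto_integral_mul_norm (hr : 2 < r) (hW : HasMomentScale W P r (1 / 2) C) {M K : ℝ}
    {θ : ℝ → Ω → ℝ} (hθ : ∀ a, Measurable (θ a)) (h0 : ∀ a ω, 0 ≤ θ a ω)
    (hM : ∀ᶠ a in atTop, ∀ ω, θ a ω ≤ M)
    (hlim : ∀ᶠ a in atTop, ∫ ω, θ a ω ∂P ≤ K * a ^ (-(r / 2))) :
    Tendsto (fun a => ∫ ω, θ a ω * ‖W a ω‖ ^ (1 : ℝ) ∂P) atTop (𝓝 0) := by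
  have hu : Tendsto (fun a : ℝ => (K + M * C) * a ^ (-(r / 2 - 1))) atTop (𝓝 0) := by
    simpa using (tendsto_rpow_neg_atTop (by linarith : 0 < r / 2 - 1)).const_mul (K + M * C)
  refine squeeze_zero' (Eventually.of_forall fun a => integral_nonneg fun ω =>
    mul_nonneg (h0 a ω) (by positivity)) ?_ hu
  filter_upwards [hW.integral_mul_rpow_le (p := 1) (by norm_num) (by linarith) (M := M),
    eventually_gt_atTop 0, hM, hlim] with a ha ha0 hMa hla
  refine (ha (θ a) (hθ a) (h0 a) hMa a ha0).trans ?_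
  have e1 : a ^ (1 : ℝ) * (K * a ^ (-(r / 2))) = K * a ^ (-(r / 2 - 1)) := by
    have : -(r / 2 - 1) = 1 + -(r / 2) := by ring
    rw [this, Real.rpow_add ha0]; ring
  have e2 : a ^ (1 - r) * M * (C * a ^ (r * (1 / 2))) = M * C * a ^ (-(r / 2 - 1)) := by
    have : -(r / 2 - 1) = (1 - r) + r * (1 / 2) := by ring
    rw [this, Real.rpow_add ha0]; ring
  have h1 := mul_le_mul_of_nonneg_left hla (by positivity : 0 ≤ a ^ (1 : ℝ))
  rw [e2]
  linarith

end HasMomentScale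

end ScaledFamilies

end SeqBias

/-! ### From a pathwise linearization to a linearization in mean -/

namespace SeqBias

section Correction

variable {Ω E : Type*} [MeasurableSpace Ω] [NormedAddCommGroup E] [InnerProductSpace ℝ E]
  [CompleteSpace E] [MeasurableSpace E] [BorelSpace E] [SecondCountableTopology E]
  {P : Measure Ω} [IsProbabilityMeasure P] {r C C' : ℝ} {W Z : ℝ → Ω → E}

theorem integrable_indicator_one_mul {S : Set Ω} (hS : MeasurableSet S) {f : Ω → ℝ}
    (hf : Integrable f P) : Integrable (fun ω => S.indicator (fun _ => (1 : ℝ)) ω * f ω) P := by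
  refine (hf.indicator hS).congr (ae_of_all _ fun ω => ?_)
  by_cases h : ω ∈ S <;> simp [h]

theorem tendsto_rpow_atTop_of_neg {p : ℝ} (hp : p < 0) :
    Tendsto (fun a : ℝ => a ^ p) atTop (𝓝 0) := by
  simpa using tendsto_rpow_neg_atTop (by linarith : 0 < -p)

set_option maxHeartbeats 1000000 in
/-- The correction `φ` is asymptotically `D (W) / T`, outside of an event `B` on which it is
deterministic and of events whose probability is polynomially small. -/
theorem tendsto_correction (hr : 2 < r) (hW : HasMomentScale W P r (1 / 2) C)
    (hZ : HasMomentScale Z P r (1 / r) C') (hWm : ∀ a, Measurable (W a))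
    {T : ℝ → Ω → ℕ} (hTm : ∀ a, Measurable (T a)) {c₀ : ℝ} (hc₀ : 0 < c₀)
    (hT : ∀ᶠ a in atTop, ∀ ω, c₀ * a ≤ T a ω) (L D : E →L[ℝ] ℝ) {φ : ℝ → Ω → ℝ}
    (hφm : ∀ a, Measurable (φ a)) {M : ℝ} (hφM : ∀ᶠ a in atTop, ∀ ω, |φ a ω| ≤ M)
    {B : ℝ → Set Ω} (hBm : ∀ a, MeasurableSet (B a))
    (hB : Tendsto (fun a => P.real (B a)) atTop (𝓝 0)) {c : ℝ → ℝ}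
    (hφB : ∀ᶠ a in atTop, ∀ ω ∈ B a, φ a ω = c a) (hcM : ∀ᶠ a in atTop, |c a| ≤ M)
    (hLB : Tendsto (fun a => ∫ ω, (B a).indicator (fun ω => L (W a ω)) ω ∂P) atTop (𝓝 0)) {K : ℝ}
    (hK : 0 ≤ K)
    (hG : ∀ η > 0, ∃ (G : ℝ → Set Ω) (K' : ℝ), (∀ a, MeasurableSet (G a)) ∧
      (∀ᶠ a in atTop, P.real (G a)ᶜ ≤ K' * a ^ (-(r / 2))) ∧
      ∀ᶠ a in atTop, ∀ ω ∈ G a, ω ∉ B a →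
        |φ a ω - D (W a ω) / T a ω| ≤ K / a * (η * ‖W a ω‖ + 1 + ‖Z a ω‖)) :
    Tendsto (fun a => ∫ ω, |φ a ω| ∂P) atTop (𝓝 0) ∧
    Tendsto (fun a => ∫ ω, L (W a ω) * (φ a ω - D (W a ω) / T a ω) ∂P) atTop (𝓝 0) := by
  have hr0 : 0 < r := by linarith
  have hM0 : 0 ≤ M := by
    obtain ⟨a, ha⟩ := hcM.exists
    exact (abs_nonneg _).trans ha
  have iW1 : ∀ a, Integrable (fun ω => ‖W a ω‖) P := fun a => by
    simpa using hW.integrable_rpow (p := 1) zero_le_one (by linarith) a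
  have iW2 : ∀ a, Integrable (fun ω => ‖W a ω‖ ^ 2) P := fun a => by
    simpa using hW.integrable_rpow (p := 2) (by norm_num) hr.le a
  have iZ1 : ∀ a, Integrable (fun ω => ‖Z a ω‖) P := fun a => by
    simpa using hZ.integrable_rpow (p := 1) zero_le_one (by linarith) a
  have iZ2 : ∀ a, Integrable (fun ω => ‖Z a ω‖ ^ 2) P := fun a => by
    simpa using hZ.integrable_rpow (p := 2) (by norm_num) hr.le a
  have eW1 : ∀ᶠ a in atTop, (∫ ω, ‖W a ω‖ ∂P) / a ≤ (1 + C) * a ^ (-(1 / 2) : ℝ) := by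
    filter_upwards [hW.integral_rpow_le (p := 1) zero_le_one (by linarith), eventually_gt_atTop 0]
      with a h1 ha
    simp only [Real.rpow_one, one_mul] at h1
    rw [div_le_iff₀ ha, mul_assoc, ← Real.rpow_add_one ha.ne']
    refine h1.trans (le_of_eq ?_)
    norm_num
  have eW2 : ∀ᶠ a in atTop, (∫ ω, ‖W a ω‖ ^ 2 ∂P) / a ≤ 1 + C := by
    filter_upwards [hW.integral_rpow_le (p := 2) (by norm_num) hr.le, eventually_gt_atTop 0]
      with a h1 ha
    simp only [Real.rpow_ofNat] at h1
    rw [div_le_iff₀ ha]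
    refine h1.trans (le_of_eq ?_)
    norm_num
  have eZ1 : ∀ᶠ a in atTop, (∫ ω, ‖Z a ω‖ ∂P) / a ≤ (1 + C') * a ^ (1 / r - 1) := by
    filter_upwards [hZ.integral_rpow_le (p := 1) zero_le_one (by linarith), eventually_gt_atTop 0]
      with a h1 ha
    simp only [Real.rpow_one, one_mul] at h1
    rw [div_le_iff₀ ha, mul_assoc, ← Real.rpow_add_one ha.ne']
    refine h1.trans (le_of_eq ?_)
    ring_nf
  have eZ2 : ∀ᶠ a in atTop, (∫ ω, ‖Z a ω‖ ^ 2 ∂P) / a ≤ (1 + C') * a ^ (2 / r - 1) := by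
    filter_upwards [hZ.integral_rpow_le (p := 2) (by norm_num) hr.le, eventually_gt_atTop 0]
      with a h1 ha
    simp only [Real.rpow_ofNat] at h1
    rw [div_le_iff₀ ha, mul_assoc, ← Real.rpow_add_one ha.ne']
    refine h1.trans (le_of_eq ?_)
    ring_nf
  have hp1 : (1 / r - 1 : ℝ) < 0 := by
    have : 1 / r < 1 := by rw [div_lt_one hr0]; linarith
    linarith
  have hp2 : (2 / r - 1 : ℝ) < 0 := by
    have : 2 / r < 1 := by rw [div_lt_one hr0]; linarith
    linarith
  have hDT : ∀ᶠ a in atTop, ∀ ω, |D (W a ω) / T a ω| ≤ ‖D‖ / c₀ * (‖W a ω‖ / a) := by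
    filter_upwards [hT, eventually_gt_atTop 0] with a hTa ha ω
    have hTpos : (0 : ℝ) < T a ω := lt_of_lt_of_le (by positivity) (hTa ω)
    rw [abs_div, abs_of_pos hTpos, div_mul_div_comm]
    exact div_le_div₀ (by positivity) (D.le_opNorm _) (by positivity) (hTa ω)
  have ind_int : ∀ {S : Set Ω}, MeasurableSet S →
      Integrable (S.indicator fun _ => (1 : ℝ)) P := fun hS => (integrable_const 1).indicator hS
  have indB0 : ∀ (S : Set Ω) ω, 0 ≤ S.indicator (fun _ => (1 : ℝ)) ω := fun S ω =>
    Set.indicator_nonneg (fun _ _ => zero_le_one) ω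
  have indB1 : ∀ (S : Set Ω) ω, S.indicator (fun _ => (1 : ℝ)) ω ≤ 1 := fun S ω =>
    Set.indicator_le_self' (f := fun _ => (1 : ℝ)) (fun _ _ => zero_le_one) ω
  have ind_eq : ∀ {S : Set Ω}, MeasurableSet S →
      ∫ ω, S.indicator (fun _ => (1 : ℝ)) ω ∂P = P.real S := fun hS => by
    rw [integral_indicator_const _ hS, smul_eq_mul, mul_one]
  constructor
  · obtain ⟨G, K', hGm, hGP, hGφ⟩ := hG 1 one_pos
    have hlim : Tendsto (fun a : ℝ => M * P.real (B a) + M * (K' * a ^ (-(r / 2)))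
        + (‖D‖ / c₀ + K) * ((1 + C) * a ^ (-(1 / 2) : ℝ)) + K * a⁻¹
        + K * ((1 + C') * a ^ (1 / r - 1))) atTop (𝓝 0) := by
      have h1 := hB.const_mul M
      have h2 := ((tendsto_rpow_atTop_of_neg (by linarith : -(r / 2) < 0)).const_mul K').const_mul M
      have h3 := ((tendsto_rpow_atTop_of_neg (by norm_num : (-(1 / 2) : ℝ) < 0)).const_mul
        (1 + C)).const_mul (‖D‖ / c₀ + K)
      have h4 := (tendsto_inv_atTop_zero (𝕜 := ℝ)).const_mul K
      have h5 := ((tendsto_rpow_atTop_of_neg hp1).const_mul (1 + C')).const_mul K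
      simpa using (((h1.add h2).add h3).add h4).add h5
    refine squeeze_zero' (Eventually.of_forall fun a => integral_nonneg fun ω => abs_nonneg _)
      ?_ hlim
    filter_upwards [hGP, hGφ, hDT, hφM, eW1, eZ1, eventually_gt_atTop 0]
      with a hPa hφa hDa hMa hw hz ha
    have i1 := (ind_int (hBm a)).const_mul M
    have i2 := (ind_int (hGm a).compl).const_mul M
    have i3 := ((iW1 a).div_const a).const_mul (‖D‖ / c₀ + K)
    have i4 : Integrable (fun _ : Ω => K * a⁻¹) P := integrable_const _
    have i5 := ((iZ1 a).div_const a).const_mul K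
    have hφi : Integrable (fun ω => |φ a ω|) P :=
      Integrable.mono' (integrable_const M) (hφm a).abs.aestronglyMeasurable
        (ae_of_all _ fun ω => by simpa using hMa ω)
    have hpt : ∀ ω, |φ a ω| ≤ M * (B a).indicator (fun _ => (1 : ℝ)) ω
        + M * (G a)ᶜ.indicator (fun _ => (1 : ℝ)) ω + (‖D‖ / c₀ + K) * (‖W a ω‖ / a) + K * a⁻¹
        + K * (‖Z a ω‖ / a) := by
      intro ω
      have n1 : 0 ≤ (‖D‖ / c₀ + K) * (‖W a ω‖ / a) := by positivity
      have n2 : 0 ≤ K * a⁻¹ := by positivity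
      have n3 : 0 ≤ K * (‖Z a ω‖ / a) := by positivity
      have n4 := mul_nonneg hM0 (indB0 (B a) ω)
      have n5 := mul_nonneg hM0 (indB0 (G a)ᶜ ω)
      by_cases hωB : ω ∈ B a
      · have := hMa ω
        have e : (B a).indicator (fun _ => (1 : ℝ)) ω = 1 := by simp [hωB]
        rw [e] at n4 ⊢; linarith
      by_cases hωG : ω ∈ G a
      · have h1 := hφa ω hωG hωB
        have h2 := abs_sub_abs_le_abs_sub (φ a ω) (D (W a ω) / T a ω)
        have h3 := hDa ω
        have e : K / a * (1 * ‖W a ω‖ + 1 + ‖Z a ω‖) =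
          K * (‖W a ω‖ / a) + K * a⁻¹ + K * (‖Z a ω‖ / a) := by field_simp
        rw [e] at h1
        linarith
      · have := hMa ω
        have e : (G a)ᶜ.indicator (fun _ => (1 : ℝ)) ω = 1 := by simp [hωG]
        rw [e] at n5 ⊢; linarith
    refine (integral_mono hφi ((((i1.fun_add i2).fun_add i3).fun_add i4).fun_add i5) hpt).trans ?_
    rw [integral_add (((i1.fun_add i2).fun_add i3).fun_add i4) i5,
      integral_add ((i1.fun_add i2).fun_add i3) i4,
      integral_add (i1.fun_add i2) i3, integral_add i1 i2]
    simp only [integral_const_mul, integral_div, ind_eq (hBm a), ind_eq (hGm a).compl,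
      integral_const, probReal_univ, one_smul]
    gcongr
  -- On B the correction is the constant c a, and its product with L(W) is removed because only its
  -- integral, not its absolute value, is known to vanish. What is left on B is −L(W) D(W)/T, of
  -- size ‖W‖²/a, which uniform integrability handles.
  · set F : ℝ → Ω → ℝ := fun a ω => L (W a ω) * (φ a ω - D (W a ω) / T a ω)
      - c a * (B a).indicator (fun ω => L (W a ω)) ω with hF
    have hLm : ∀ a, Measurable fun ω => L (W a ω) := fun a => L.measurable.comp (hWm a)
    have hFm : ∀ a, Measurable (F a) := fun a => by
      have hTr : Measurable fun ω => (T a ω : ℝ) := measurable_from_top.comp (hTm a)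
      exact ((hLm a).mul ((hφm a).sub ((D.measurable.comp (hWm a)).div hTr))).sub
        (((hLm a).indicator (hBm a)).const_mul _)
    have hLBi : ∀ a, Integrable ((B a).indicator fun ω => L (W a ω)) P := fun a =>
      (Integrable.mono' ((iW1 a).const_mul ‖L‖) (hLm a).aestronglyMeasurable
        (ae_of_all _ fun ω => L.le_opNorm _)).indicator (hBm a)
    have hbase : ∀ η > 0, ∃ (u : ℝ → ℝ), Tendsto u atTop (𝓝 0) ∧ ∀ᶠ a in atTop,
        Integrable (F a) P ∧ ∫ ω, |F a ω| ∂P ≤ ‖L‖ * K * (2 * η * (1 + C)) + u a := by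
      intro η hη
      obtain ⟨G, K', hGm, hGP, hGφ⟩ := hG η hη
      have hGlim : Tendsto (fun a => P.real (G a)ᶜ) atTop (𝓝 0) := by
        refine squeeze_zero' (Eventually.of_forall fun a => measureReal_nonneg) hGP ?_
        simpa using (tendsto_rpow_atTop_of_neg (by linarith : -(r / 2) < 0)).const_mul K'
      have t1 := hW.tendsto_integral_mul_sq hr (M := 1)
        (θ := fun a => (B a).indicator fun _ => (1 : ℝ))
        (fun a => measurable_const.indicator (hBm a)) (fun a ω => indB0 _ ω)
        (Eventually.of_forall fun a ω => indB1 _ ω) (by simpa only [ind_eq (hBm _)] using hB)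
      have t2 := hW.tendsto_integral_mul_sq hr (M := 1)
        (θ := fun a => (G a)ᶜ.indicator fun _ => (1 : ℝ))
        (fun a => measurable_const.indicator (hGm a).compl) (fun a ω => indB0 _ ω)
        (Eventually.of_forall fun a ω => indB1 _ ω)
        (by simpa only [ind_eq (hGm _).compl] using hGlim)
      have t3 := hW.tendsto_integral_mul_norm hr (M := 1) (K := K')
        (θ := fun a => (G a)ᶜ.indicator fun _ => (1 : ℝ))
        (fun a => measurable_const.indicator (hGm a).compl) (fun a ω => indB0 _ ω)
        (Eventually.of_forall fun a ω => indB1 _ ω)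
        (by simpa only [ind_eq (hGm _).compl] using hGP)
      simp only [Real.rpow_ofNat, Real.rpow_one] at t1 t2 t3
      set I1 : ℝ → ℝ := fun a => (∫ ω, (B a).indicator (fun _ => (1 : ℝ)) ω * ‖W a ω‖ ^ 2 ∂P) / a
      set I2 : ℝ → ℝ := fun a => (∫ ω, (G a)ᶜ.indicator (fun _ => (1 : ℝ)) ω * ‖W a ω‖ ^ 2 ∂P) / a
      set I3 : ℝ → ℝ := fun a => ∫ ω, (G a)ᶜ.indicator (fun _ => (1 : ℝ)) ω * ‖W a ω‖ ∂P
      refine ⟨fun a => ‖L‖ * (‖D‖ / c₀) * I1 a + ‖L‖ * (‖D‖ / c₀) * I2 a + ‖L‖ * M * I3 a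
        + ‖L‖ * K * ((1 + C) * a ^ (-(1 / 2) : ℝ))
        + ‖L‖ * K * η⁻¹ * ((1 + C') * a ^ (2 / r - 1)), ?_, ?_⟩
      · have h1 := t1.const_mul (‖L‖ * (‖D‖ / c₀))
        have h2 := t2.const_mul (‖L‖ * (‖D‖ / c₀))
        have h3 := t3.const_mul (‖L‖ * M)
        have h4 := ((tendsto_rpow_atTop_of_neg (by norm_num : (-(1 / 2) : ℝ) < 0)).const_mul
          (1 + C)).const_mul (‖L‖ * K)
        have h5 := ((tendsto_rpow_atTop_of_neg hp2).const_mul (1 + C')).const_mul (‖L‖ * K * η⁻¹)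
        simpa using (((h1.add h2).add h3).add h4).add h5
      filter_upwards [hGφ, hDT, hφM, hφB, eW1, eW2, eZ2, eventually_gt_atTop 0]
        with a hφa hDa hMa hBa hw1 hw2 hz ha
      have i1 : Integrable (fun ω => ‖L‖ * (‖D‖ / c₀) *
          ((B a).indicator (fun _ => (1 : ℝ)) ω * ‖W a ω‖ ^ 2 / a)) P := by
        exact ((integrable_indicator_one_mul (hBm a) (iW2 a)).div_const a).const_mul _
      have i2 : Integrable (fun ω => ‖L‖ * (‖D‖ / c₀) *
          ((G a)ᶜ.indicator (fun _ => (1 : ℝ)) ω * ‖W a ω‖ ^ 2 / a)) P := by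
        exact ((integrable_indicator_one_mul (hGm a).compl (iW2 a)).div_const a).const_mul _
      have i3 : Integrable (fun ω => ‖L‖ * M *
          ((G a)ᶜ.indicator (fun _ => (1 : ℝ)) ω * ‖W a ω‖)) P := by
        exact (integrable_indicator_one_mul (hGm a).compl (iW1 a)).const_mul _
      have i4 := ((iW1 a).div_const a).const_mul (‖L‖ * K)
      have i5 := ((iZ2 a).div_const a).const_mul (‖L‖ * K * η⁻¹)
      have i6 := ((iW2 a).div_const a).const_mul (‖L‖ * K * (2 * η))
      have hpt : ∀ ω, |F a ω| ≤ ‖L‖ * (‖D‖ / c₀) *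
          ((B a).indicator (fun _ => (1 : ℝ)) ω * ‖W a ω‖ ^ 2 / a) + ‖L‖ * (‖D‖ / c₀) *
          ((G a)ᶜ.indicator (fun _ => (1 : ℝ)) ω * ‖W a ω‖ ^ 2 / a) + ‖L‖ * M *
          ((G a)ᶜ.indicator (fun _ => (1 : ℝ)) ω * ‖W a ω‖) + ‖L‖ * K * (‖W a ω‖ / a)
          + ‖L‖ * K * η⁻¹ * (‖Z a ω‖ ^ 2 / a) + ‖L‖ * K * (2 * η) * (‖W a ω‖ ^ 2 / a) := by
        intro ω
        have hLw := L.le_opNorm (W a ω)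
        rw [Real.norm_eq_abs] at hLw
        have hDw := hDa ω
        set w := ‖W a ω‖ with hw
        set z := ‖Z a ω‖ with hz
        have hw0 : 0 ≤ w := norm_nonneg _
        have hz0 : 0 ≤ z := norm_nonneg _
        have n1 : 0 ≤ ‖L‖ * (‖D‖ / c₀) *
          ((B a).indicator (fun _ => (1 : ℝ)) ω * w ^ 2 / a) := by
            have := indB0 (B a) ω; positivity
        have n2 : 0 ≤ ‖L‖ * (‖D‖ / c₀) *
          ((G a)ᶜ.indicator (fun _ => (1 : ℝ)) ω * w ^ 2 / a) := by
            have := indB0 (G a)ᶜ ω; positivity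
        have n3 : 0 ≤ ‖L‖ * M * ((G a)ᶜ.indicator (fun _ => (1 : ℝ)) ω * w) := by
            have := indB0 (G a)ᶜ ω; positivity
        have n4 : 0 ≤ ‖L‖ * K * (w / a) := by positivity
        have n5 : 0 ≤ ‖L‖ * K * η⁻¹ * (z ^ 2 / a) := by positivity
        have n6 : 0 ≤ ‖L‖ * K * (2 * η) * (w ^ 2 / a) := by positivity
        have hLD : |L (W a ω)| * |D (W a ω) / T a ω| ≤ ‖L‖ * (‖D‖ / c₀) * (w ^ 2 / a) := by
          refine (mul_le_mul hLw hDw (abs_nonneg _) (by positivity)).trans (le_of_eq ?_)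
          field_simp
        by_cases hωB : ω ∈ B a
        · have e : (B a).indicator (fun _ => (1 : ℝ)) ω = 1 := by simp [hωB]
          have eF : F a ω = - (L (W a ω) * (D (W a ω) / T a ω)) := by
            simp only [hF, Set.indicator_of_mem hωB, hBa ω hωB]; ring
          rw [eF, abs_neg, abs_mul, e, one_mul]
          linarith
        have eF : F a ω = L (W a ω) * (φ a ω - D (W a ω) / T a ω) := by
          simp only [hF, Set.indicator_of_notMem hωB]; ring
        rw [eF, abs_mul]
        by_cases hωG : ω ∈ G a
        · have h1 := hφa ω hωG hωB
          -- Weighted Young inequality. After division by a, the first term is small since E‖W‖²/a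
          -- is bounded, and the second vanishes since E‖Z‖² = O(a^{2/r}) with 2/r < 1.
          have h2 : w * z ≤ η * w ^ 2 + η⁻¹ * z ^ 2 := by
            have e1 : η * (η⁻¹ * z ^ 2) = z ^ 2 := by field_simp
            have h3 : 0 ≤ η * (η * w ^ 2 + η⁻¹ * z ^ 2 - w * z) := by
              nlinarith [sq_nonneg (η * w - z / 2), sq_nonneg z]
            have := nonneg_of_mul_nonneg_right h3 hη
            linarith
          have h3 : |L (W a ω)| * |φ a ω - D (W a ω) / T a ω| ≤
              ‖L‖ * w * (K / a * (η * w + 1 + z)) :=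
            mul_le_mul hLw h1 (abs_nonneg _) (by positivity)
          have e2 : ‖L‖ * w * (K / a * (η * w + 1 + z)) =
              ‖L‖ * K / a * (η * w ^ 2 + w + w * z) := by ring
          have h4 : ‖L‖ * K / a * (η * w ^ 2 + w + w * z) ≤
              ‖L‖ * K / a * (η * w ^ 2 + w + (η * w ^ 2 + η⁻¹ * z ^ 2)) := by gcongr
          have e3 : ‖L‖ * K / a * (η * w ^ 2 + w + (η * w ^ 2 + η⁻¹ * z ^ 2)) =
              ‖L‖ * K * (w / a) + ‖L‖ * K * η⁻¹ * (z ^ 2 / a)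
              + ‖L‖ * K * (2 * η) * (w ^ 2 / a) := by ring
          linarith
        · have e : (G a)ᶜ.indicator (fun _ => (1 : ℝ)) ω = 1 := by simp [hωG]
          have h1 : |φ a ω - D (W a ω) / T a ω| ≤ |φ a ω| + |D (W a ω) / T a ω| := abs_sub _ _
          have h2 : |L (W a ω)| * |φ a ω - D (W a ω) / T a ω| ≤
              |L (W a ω)| * |φ a ω| + |L (W a ω)| * |D (W a ω) / T a ω| := by
            rw [← mul_add]; exact mul_le_mul_of_nonneg_left h1 (abs_nonneg _)
          have h3 : |L (W a ω)| * |φ a ω| ≤ ‖L‖ * w * M :=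
            mul_le_mul hLw (hMa ω) (abs_nonneg _) (by positivity)
          rw [e, one_mul, one_mul] at *
          linarith
      have hbi := ((((i1.fun_add i2).fun_add i3).fun_add i4).fun_add i5).fun_add i6
      have hFi : Integrable (F a) P := Integrable.mono' hbi (hFm a).aestronglyMeasurable
        (ae_of_all _ hpt)
      refine ⟨hFi, (integral_mono hFi.abs hbi hpt).trans ?_⟩
      rw [integral_add ((((i1.fun_add i2).fun_add i3).fun_add i4).fun_add i5) i6,
        integral_add (((i1.fun_add i2).fun_add i3).fun_add i4) i5,
        integral_add ((i1.fun_add i2).fun_add i3) i4,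
        integral_add (i1.fun_add i2) i3, integral_add i1 i2]
      simp only [integral_const_mul, integral_div]
      have q1 := mul_le_mul_of_nonneg_left hw1 (by positivity : 0 ≤ ‖L‖ * K)
      have q2 := mul_le_mul_of_nonneg_left hw2 (by positivity : 0 ≤ ‖L‖ * K * (2 * η))
      have q3 := mul_le_mul_of_nonneg_left hz (by positivity : 0 ≤ ‖L‖ * K * η⁻¹)
      linarith
    have hFi : ∀ᶠ a in atTop, Integrable (F a) P := by
      obtain ⟨u, -, hu⟩ := hbase 1 one_pos
      exact hu.mono fun a ha => ha.1
    have hFlim : Tendsto (fun a => ∫ ω, |F a ω| ∂P) atTop (𝓝 0) := by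
      refine tendsto_zero_of_forall_le_add
        (Eventually.of_forall fun a => integral_nonneg fun ω => abs_nonneg _) fun ε hε => ?_
      have hpos : 0 < ‖L‖ * K * (2 * (1 + C)) + 1 := by
        have := hW.nonneg
        positivity
      obtain ⟨u, hu0, hu⟩ := hbase (ε / (‖L‖ * K * (2 * (1 + C)) + 1)) (by positivity)
      refine ⟨u, hu0, hu.mono fun a ha => ha.2.trans ?_⟩
      gcongr
      set q := ‖L‖ * K * (2 * (1 + C))
      have : ‖L‖ * K * (2 * (ε / (q + 1)) * (1 + C)) = q / (q + 1) * ε := by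
        simp only [q]; ring
      rw [this]
      have : q / (q + 1) ≤ 1 := by rw [div_le_one hpos]; linarith
      nlinarith
    have hFint : Tendsto (fun a => ∫ ω, F a ω ∂P) atTop (𝓝 0) :=
      squeeze_zero_norm (fun a => norm_integral_le_integral_norm _) hFlim
    have hcB : Tendsto (fun a => c a * ∫ ω, (B a).indicator (fun ω => L (W a ω)) ω ∂P) atTop
        (𝓝 0) := by
      refine squeeze_zero_norm' (a := fun a => M * |∫ ω, (B a).indicator (fun ω => L (W a ω)) ω ∂P|)
        ?_ (by simpa using hLB.abs.const_mul M)
      filter_upwards [hcM] with a ha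
      rw [norm_mul, Real.norm_eq_abs, Real.norm_eq_abs]
      gcongr
    have hsum := hFint.add hcB
    rw [add_zero] at hsum
    refine hsum.congr' ?_
    filter_upwards [hFi] with a ha
    have e : ∀ ω, L (W a ω) * (φ a ω - D (W a ω) / T a ω) =
        F a ω + c a * (B a).indicator (fun ω => L (W a ω)) ω := by
      intro ω; simp only [hF]; ring
    simp only [e]
    rw [integral_add ha ((hLBi a).const_mul _), integral_const_mul]

end Correction

end SeqBias

/-! ### Limit of the normalized expectation -/

namespace SeqBias

section Limit

variable {Ω E : Type*} [MeasurableSpace Ω] [NormedAddCommGroup E] [InnerProductSpace ℝ E]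
  [CompleteSpace E] [MeasurableSpace E] [BorelSpace E] [SecondCountableTopology E]
  {P : Measure Ω} [IsProbabilityMeasure P] {r C : ℝ} {W : ℝ → Ω → E}

theorem abs_sub_le_max_of_mem_Icc {x k lo hi : ℝ} (hx : x ∈ Set.Icc lo hi) :
    |x - k| ≤ max |hi - k| |lo - k| := by
  rw [max_comm]
  exact abs_le_max_abs_abs (by linarith [hx.1]) (by linarith [hx.2])

/-- Lets convergence of √(a/T) in L¹ pass to the powers that occur: exponents 2 and 3 as weights,
and −2 for T/a. -/
theorem tendsto_integral_abs_comp_sub {s : ℝ → Ω → ℝ} {f : ℝ → ℝ} {k lo hi Λ : ℝ}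
    (hs : ∀ a, Measurable (s a)) (hsI : ∀ᶠ a in atTop, ∀ ω, s a ω ∈ Set.Icc lo hi)
    (hf : ∀ x ∈ Set.Icc lo hi, |f x - f k| ≤ Λ * |x - k|)
    (hlim : Tendsto (fun a => ∫ ω, |s a ω - k| ∂P) atTop (𝓝 0)) :
    Tendsto (fun a => ∫ ω, |f (s a ω) - f k| ∂P) atTop (𝓝 0) := by
  refine squeeze_zero' (Eventually.of_forall fun a => integral_nonneg fun ω => abs_nonneg _) ?_
    (by simpa using hlim.const_mul Λ)
  filter_upwards [hsI] with a ha
  rw [← integral_const_mul]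
  refine integral_mono_of_nonneg (ae_of_all _ fun ω => abs_nonneg _) ?_
    (ae_of_all _ fun ω => hf _ (ha ω))
  refine Integrable.const_mul ?_ Λ
  refine Integrable.mono' (integrable_const (max |hi - k| |lo - k|))
    ((hs a).sub_const k).abs.aestronglyMeasurable (ae_of_all _ fun ω => ?_)
  simp only [Real.norm_eq_abs, abs_abs]
  exact abs_sub_le_max_of_mem_Icc (ha ω)

theorem tendsto_integral_comp {s : ℝ → Ω → ℝ} {f : ℝ → ℝ} {k lo hi Λ : ℝ}
    (hs : ∀ a, Measurable (s a)) (hfm : Measurable f)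
    (hsI : ∀ᶠ a in atTop, ∀ ω, s a ω ∈ Set.Icc lo hi)
    (hf : ∀ x ∈ Set.Icc lo hi, |f x - f k| ≤ Λ * |x - k|)
    (hlim : Tendsto (fun a => ∫ ω, |s a ω - k| ∂P) atTop (𝓝 0)) :
    Tendsto (fun a => ∫ ω, f (s a ω) ∂P) atTop (𝓝 (f k)) := by
  have h := tendsto_integral_abs_comp_sub hs hsI hf hlim
  rw [tendsto_iff_norm_sub_tendsto_zero]
  refine squeeze_zero' (Eventually.of_forall fun a => norm_nonneg _) ?_ h
  filter_upwards [hsI] with a ha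
  have hi : Integrable (fun ω => f (s a ω) - f k) P := by
    refine Integrable.mono' (integrable_const (Λ * 0 + |Λ| * (max |hi - k| |lo - k|)))
      ((hfm.comp (hs a)).sub_const _).aestronglyMeasurable (ae_of_all _ fun ω => ?_)
    have h2 := ha ω
    have h1 : |s a ω - k| ≤ max |hi - k| |lo - k| :=
      abs_sub_le_max_of_mem_Icc h2
    calc |f (s a ω) - f k| ≤ Λ * |s a ω - k| := hf _ h2
      _ ≤ |Λ| * |s a ω - k| := by gcongr; exact le_abs_self _
      _ ≤ _ := by rw [mul_zero, zero_add]; gcongr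
  have hi' : Integrable (fun ω => f (s a ω)) P := by
    simpa using hi.fun_add (integrable_const (f k))
  have : (∫ ω, f (s a ω) ∂P) - f k = ∫ ω, (f (s a ω) - f k) ∂P := by
    rw [integral_sub hi' (integrable_const _)]; simp
  rw [this]
  exact norm_integral_le_integral_norm _

/-- Limit of a quadratic form in `W` weighted by a function of `√(a / T)`. -/
theorem tendsto_integral_weighted_quadratic (hr : 2 < r) (hW : HasMomentScale W P r (1 / 2) C)
    (hWm : ∀ a, Measurable (W a)) {s : ℝ → Ω → ℝ} {f : ℝ → ℝ} {k lo hi Λ : ℝ}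
    (hs : ∀ a, Measurable (s a)) (hfm : Measurable f)
    (hsI : ∀ᶠ a in atTop, ∀ ω, s a ω ∈ Set.Icc lo hi) (hf0 : 0 ≤ Λ)
    (hf : ∀ x ∈ Set.Icc lo hi, |f x - f k| ≤ Λ * |x - k|)
    (hlim : Tendsto (fun a => ∫ ω, |s a ω - k| ∂P) atTop (𝓝 0)) (b : E →L[ℝ] E →L[ℝ] ℝ) {q β : ℝ}
    (hq : Tendsto (fun a => (∫ ω, b (W a ω) (W a ω) ∂P) / a) atTop (𝓝 (q * β))) :
    (∀ᶠ a in atTop, Integrable (fun ω => f (s a ω) * (b (W a ω) (W a ω) / a)) P) ∧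
    Tendsto (fun a => ∫ ω, f (s a ω) * (b (W a ω) (W a ω) / a) ∂P) atTop (𝓝 (f k * (q * β))) := by
  set M : ℝ := Λ * (max |hi - k| |lo - k|) with hM
  have hfM : ∀ᶠ a in atTop, ∀ ω, |f (s a ω) - f k| ≤ M := by
    filter_upwards [hsI] with a ha ω
    have h2 := ha ω
    have h1 : |s a ω - k| ≤ max |hi - k| |lo - k| :=
      abs_sub_le_max_of_mem_Icc h2
    exact (hf _ h2).trans (by rw [hM]; gcongr)
  have hθm : ∀ a, Measurable fun ω => |f (s a ω) - f k| := fun a =>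
    ((hfm.comp (hs a)).sub_const _).abs
  -- The increment f(s) − f(k) is a bounded weight with vanishing mean, so its contribution
  -- disappears and the weight may be frozen at k.
  have h1 := hW.tendsto_integral_mul_sq hr (θ := fun a ω => |f (s a ω) - f k|) hθm
    (fun a ω => abs_nonneg _) hfM (tendsto_integral_abs_comp_sub hs hsI hf hlim)
  simp only [Real.rpow_ofNat] at h1
  have hbb : ∀ a, Integrable (fun ω => b (W a ω) (W a ω)) P := fun a =>
    integrable_bilin_of_memLp hr.le (hW.memLp a) (hW.memLp a) b
  have hbm : ∀ a, Measurable fun ω => b (W a ω) (W a ω) := fun a =>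
    (b.continuous₂.comp (continuous_id.prodMk continuous_id)).measurable.comp (hWm a)
  have hble : ∀ a ω, |b (W a ω) (W a ω)| ≤ ‖b‖ * ‖W a ω‖ ^ 2 := fun a ω => by
    have := b.le_opNorm₂ (W a ω) (W a ω)
    rw [Real.norm_eq_abs] at this
    nlinarith
  have hdom : ∀ a > 0, ∀ ω, |(f (s a ω) - f k) * (b (W a ω) (W a ω) / a)| ≤
      ‖b‖ * (|f (s a ω) - f k| * ‖W a ω‖ ^ 2 / a) := fun a ha ω => by
    rw [abs_mul, abs_div, abs_of_pos ha]
    have := hble a ω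
    calc _ ≤ |f (s a ω) - f k| * ((‖b‖ * ‖W a ω‖ ^ 2) / a) := by gcongr
      _ = _ := by ring
  have hdomi : ∀ᶠ a in atTop, Integrable (fun ω =>
      ‖b‖ * (|f (s a ω) - f k| * ‖W a ω‖ ^ 2 / a)) P := by
    filter_upwards [hfM] with a ha
    have := hW.integrable_mul_rpow (p := 2) (by norm_num) hr.le (a := a) (hθm a)
      (fun ω => by rw [abs_abs]; exact ha ω)
    simp only [Real.rpow_ofNat] at this
    exact (this.div_const a).const_mul _
  have hFi : ∀ᶠ a in atTop, Integrable (fun ω => (f (s a ω) - f k) * (b (W a ω) (W a ω) / a)) P := by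
    filter_upwards [hdomi, eventually_gt_atTop 0] with a hi ha
    exact Integrable.mono' hi
      (((hfm.comp (hs a)).sub_const _).mul ((hbm a).div_const a)).aestronglyMeasurable
      (ae_of_all _ fun ω => hdom a ha ω)
  have hF : Tendsto (fun a => ∫ ω, (f (s a ω) - f k) * (b (W a ω) (W a ω) / a) ∂P) atTop
      (𝓝 0) := by
    refine squeeze_zero_norm' (a := fun a =>
      ‖b‖ * ((∫ ω, |f (s a ω) - f k| * ‖W a ω‖ ^ 2 ∂P) / a)) ?_ (by simpa using h1.const_mul ‖b‖)
    filter_upwards [hdomi, hFi, eventually_gt_atTop 0] with a hi hi2 ha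
    refine (norm_integral_le_integral_norm _).trans ?_
    rw [← integral_div, ← integral_const_mul]
    exact integral_mono hi2.norm hi fun ω => hdom a ha ω
  have e : ∀ a ω, f (s a ω) * (b (W a ω) (W a ω) / a) =
      (f (s a ω) - f k) * (b (W a ω) (W a ω) / a) + f k * (b (W a ω) (W a ω) / a) := fun a ω => by
    ring
  have hci : ∀ a, Integrable (fun ω => f k * (b (W a ω) (W a ω) / a)) P := fun a =>
    ((hbb a).div_const a).const_mul _
  constructor
  · filter_upwards [hFi] with a ha
    simp only [e]
    exact ha.add (hci a)
  · have hsum := hF.add (hq.const_mul (f k))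
    rw [zero_add] at hsum
    refine hsum.congr' ?_
    filter_upwards [hFi] with a ha
    simp only [e]
    rw [integral_add ha (hci a), integral_const_mul, integral_div]

theorem abs_sq_sub_le {x k lo hi : ℝ} (hlo : 0 ≤ lo) (hk : 0 ≤ k) (hx : x ∈ Set.Icc lo hi) :
    |x ^ 2 - k ^ 2| ≤ (hi + k) * |x - k| := by
  have : x ^ 2 - k ^ 2 = (x + k) * (x - k) := by ring
  rw [this, abs_mul, abs_of_nonneg (by linarith [hx.1])]
  gcongr
  exact hx.2

theorem abs_cube_sub_le {x k lo hi : ℝ} (hlo : 0 ≤ lo) (hk : 0 ≤ k) (hx : x ∈ Set.Icc lo hi) :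
    |x ^ 3 - k ^ 3| ≤ (hi ^ 2 + hi * k + k ^ 2) * |x - k| := by
  have hx0 : 0 ≤ x := hlo.trans hx.1
  have hx2 := hx.2
  have : x ^ 3 - k ^ 3 = (x ^ 2 + x * k + k ^ 2) * (x - k) := by ring
  rw [this, abs_mul, abs_of_nonneg (by positivity)]
  gcongr

theorem abs_inv_sq_sub_le {x k lo hi : ℝ} (hlo : 0 < lo) (hk : 0 < k) (hx : x ∈ Set.Icc lo hi) :
    |(x ^ 2)⁻¹ - (k ^ 2)⁻¹| ≤ (hi + k) / (lo ^ 2 * k ^ 2) * |x - k| := by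
  have hx0 : 0 < x := hlo.trans_le hx.1
  have : (x ^ 2)⁻¹ - (k ^ 2)⁻¹ = -(x ^ 2 - k ^ 2) / (x ^ 2 * k ^ 2) := by field_simp; ring
  rw [this, abs_div, abs_neg, abs_of_pos (a := x ^ 2 * k ^ 2) (by positivity), div_mul_eq_mul_div]
  have h1 := hx.1
  have hh : 0 ≤ hi := hx0.le.trans hx.2
  exact div_le_div₀ (by positivity) (abs_sq_sub_le hlo.le hk.le hx) (by positivity) (by gcongr)

set_option maxHeartbeats 1000000 in
/-- Asymptotic expansion of `E[√T * H]` where `H` has the second order expansion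
`L (W / T) + Q (W / T, W / T)` and `√(a / T)` has the first order expansion `k + D (W) / T`. -/
theorem tendsto_sqrt_mul_integral (hr : 2 < r) (hW : HasMomentScale W P r (1 / 2) C)
    (hWm : ∀ a, Measurable (W a)) {T : ℝ → Ω → ℕ} (hTm : ∀ a, Measurable (T a)) {c₀ c₁ : ℝ}
    (hc₀ : 0 < c₀) (hT : ∀ᶠ a in atTop, ∀ ω, c₀ * a ≤ T a ω ∧ (T a ω : ℝ) ≤ c₁ * a)
    (L D : E →L[ℝ] ℝ) (Q : E →L[ℝ] E →L[ℝ] ℝ) (β : (E →L[ℝ] E →L[ℝ] ℝ) → ℝ) {k : ℝ} (hk : 0 < k)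
    (hW1 : ∀ a, ∫ ω, L (W a ω) ∂P = 0)
    (hW2 : ∀ a (b : E →L[ℝ] E →L[ℝ] ℝ),
      ∫ ω, b (W a ω) (W a ω) ∂P = (∫ ω, (T a ω : ℝ) ∂P) * β b)
    {c : ℝ → ℝ} (hc : Tendsto c atTop (𝓝 k))
    (hφ : Tendsto (fun a => ∫ ω, |√(a / T a ω) - c a| ∂P) atTop (𝓝 0))
    (hLφ : Tendsto (fun a => ∫ ω, L (W a ω) * ((√(a / T a ω) - c a) - D (W a ω) / T a ω) ∂P)
      atTop (𝓝 0))
    {H : ℝ → Ω → ℝ} (hHm : ∀ a, Measurable (H a))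
    (hH : ∀ η > 0, ∃ Cη : ℝ, 0 ≤ Cη ∧ ∀ᶠ a in atTop, ∀ᵐ ω ∂P,
      |H a ω - L ((T a ω : ℝ)⁻¹ • W a ω) - Q ((T a ω : ℝ)⁻¹ • W a ω) ((T a ω : ℝ)⁻¹ • W a ω)| ≤
        η * ‖(T a ω : ℝ)⁻¹ • W a ω‖ ^ 2 + Cη * ‖(T a ω : ℝ)⁻¹ • W a ω‖ ^ r) :
    (∀ᶠ a in atTop, Integrable (fun ω => √(T a ω : ℝ) * H a ω) P) ∧
    Tendsto (fun a => √a * ∫ ω, √(T a ω : ℝ) * H a ω ∂P) atTop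
      (𝓝 (β (L.smulRight D) + k * β Q)) := by
  have hTr : ∀ a, Measurable fun ω => (T a ω : ℝ) := fun a => measurable_from_top.comp (hTm a)
  set s : ℝ → Ω → ℝ := fun a ω => √(a / T a ω) with hs
  have hsm : ∀ a, Measurable (s a) := fun a => ((hTr a).const_div a).sqrt
  have hc₁ : 0 < c₁ := by
    obtain ⟨a, ha, ha0⟩ := (hT.and (eventually_gt_atTop 0)).exists
    obtain ⟨ω⟩ : Nonempty Ω := by
      by_contra h
      rw [not_nonempty_iff] at h
      exact absurd (measure_univ (μ := P)) (by simp [Set.univ_eq_empty_iff.2 h])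
    have := (ha ω).1.trans (ha ω).2
    have := (mul_le_mul_iff_left₀ ha0).1 this
    linarith
  set lo : ℝ := √c₁⁻¹
  set hi : ℝ := √c₀⁻¹
  have hlo : 0 < lo := Real.sqrt_pos.2 (by positivity)
  have hhi : 0 ≤ hi := Real.sqrt_nonneg _
  have hsI : ∀ᶠ a in atTop, ∀ ω, s a ω ∈ Set.Icc lo hi := by
    filter_upwards [hT, eventually_gt_atTop 0] with a ha ha0 ω
    have h0 : (0 : ℝ) < T a ω := lt_of_lt_of_le (by positivity) (ha ω).1
    constructor
    · refine Real.sqrt_le_sqrt ?_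
      rw [inv_le_comm₀ hc₁ (by positivity), inv_div, div_le_iff₀ ha0]
      exact (ha ω).2
    · refine Real.sqrt_le_sqrt ?_
      rw [le_inv_comm₀ (by positivity) hc₀, inv_div, le_div_iff₀ ha0]
      exact (ha ω).1
  have hsi : ∀ᶠ a in atTop, Integrable (s a) P := by
    filter_upwards [hsI] with a ha
    refine Integrable.mono' (integrable_const hi) (hsm a).aestronglyMeasurable
      (ae_of_all _ fun ω => ?_)
    rw [Real.norm_of_nonneg (hlo.le.trans (ha ω).1)]
    exact (ha ω).2
  have hslim : Tendsto (fun a => ∫ ω, |s a ω - k| ∂P) atTop (𝓝 0) := by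
    have h2 : Tendsto (fun a => ∫ ω, |s a ω - c a| ∂P + |c a - k|) atTop (𝓝 0) := by
      have := (hc.sub_const k).abs
      rw [sub_self, abs_zero] at this
      have h3 := hφ.add this
      rw [add_zero] at h3
      exact h3
    refine squeeze_zero' (Eventually.of_forall fun a => integral_nonneg fun ω => abs_nonneg _)
      ?_ h2
    filter_upwards [hsi] with a ha
    have e : |c a - k| = ∫ _ : Ω, |c a - k| ∂P := by simp
    have hi1 : ∀ x : ℝ, Integrable (fun ω => |s a ω - x|) P := fun x =>
      (ha.sub (integrable_const x)).abs
    rw [e, ← integral_add (hi1 _) (integrable_const _)]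
    exact integral_mono (hi1 _) ((hi1 _).add (integrable_const _)) fun ω => abs_sub_le _ _ _
  -- Here T/a = s⁻², so the limit of the mean sample size follows from s → k in mean.
  have hET : Tendsto (fun a => (∫ ω, (T a ω : ℝ) ∂P) / a) atTop (𝓝 ((k ^ 2)⁻¹)) := by
    have h := tendsto_integral_comp (f := fun x => (x ^ 2)⁻¹) hsm
      ((measurable_id.pow_const 2).inv) hsI (fun x hx => abs_inv_sq_sub_le hlo hk hx) hslim
    refine h.congr' ?_
    filter_upwards [hT, eventually_gt_atTop 0] with a ha ha0
    rw [← integral_div]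
    refine integral_congr_ae (ae_of_all _ fun ω => ?_)
    simp only [hs]
    rw [Real.sq_sqrt (by positivity), inv_div]
  have hq : ∀ b : E →L[ℝ] E →L[ℝ] ℝ,
      Tendsto (fun a => (∫ ω, b (W a ω) (W a ω) ∂P) / a) atTop (𝓝 ((k ^ 2)⁻¹ * β b)) := by
    intro b
    refine (hET.mul_const (β b)).congr fun a => ?_
    rw [hW2, div_mul_eq_mul_div]
  -- The weight is s² because D(W)/T = s² D(W)/a. In the next application it is s³ because √a · √T /
  -- T² = s³/a.
  obtain ⟨hi2, hl2⟩ := tendsto_integral_weighted_quadratic (f := fun x => x ^ 2) hr hW hWm hsm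
    (measurable_id.pow_const 2) hsI (by positivity) (fun x hx => abs_sq_sub_le hlo.le hk.le hx)
    hslim (L.smulRight D) (hq _)
  obtain ⟨hi3, hl3⟩ := tendsto_integral_weighted_quadratic (f := fun x => x ^ 3) hr hW hWm hsm
    (measurable_id.pow_const 3) hsI (by positivity) (fun x hx => abs_cube_sub_le hlo.le hk.le hx)
    hslim Q (hq _)
  have iW1 : ∀ a, Integrable (fun ω => ‖W a ω‖) P := fun a => by
    simpa using hW.integrable_rpow (p := 1) zero_le_one (by linarith) a
  have iW2 : ∀ a, Integrable (fun ω => ‖W a ω‖ ^ 2) P := fun a => by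
    simpa using hW.integrable_rpow (p := 2) (by norm_num) hr.le a
  have iWr : ∀ a, Integrable (fun ω => ‖W a ω‖ ^ r) P :=
    hW.integrable_rpow (by linarith) le_rfl
  have hLi : ∀ a, Integrable (fun ω => L (W a ω)) P := fun a =>
    Integrable.mono' ((iW1 a).const_mul ‖L‖) (L.measurable.comp (hWm a)).aestronglyMeasurable
      (ae_of_all _ fun ω => L.le_opNorm _)
  -- the linear term
  have hLsi : ∀ᶠ a in atTop, Integrable (fun ω => s a ω * L (W a ω)) P := by
    filter_upwards [hsI] with a ha
    refine (hLi a).bdd_mul (c := hi) (hsm a).aestronglyMeasurable (ae_of_all _ fun ω => ?_)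
    rw [Real.norm_of_nonneg (hlo.le.trans (ha ω).1)]
    exact (ha ω).2
  -- Since E L(W) = 0, the factor s may be replaced by s − c, and `hLφ` then replaces s − c by
  -- D(W)/T.
  have hLs : Tendsto (fun a => ∫ ω, s a ω * L (W a ω) ∂P) atTop (𝓝 (β (L.smulRight D))) := by
    have h := hLφ.add hl2
    have e : 0 + k ^ 2 * ((k ^ 2)⁻¹ * β (L.smulRight D)) = β (L.smulRight D) := by field_simp; ring
    rw [e] at h
    refine h.congr' ?_
    filter_upwards [hi2, hLsi, hT, eventually_gt_atTop 0] with a h2 h3 h4 ha0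
    have hpt : ∀ ω, L (W a ω) * ((√(a / T a ω) - c a) - D (W a ω) / T a ω) =
        s a ω * L (W a ω) - c a * L (W a ω)
          - s a ω ^ 2 * ((L.smulRight D) (W a ω) (W a ω) / a) := by
      intro ω
      have h0 : (0 : ℝ) < T a ω := lt_of_lt_of_le (by positivity) (h4 ω).1
      simp only [hs, ContinuousLinearMap.smulRight_apply, _root_.smul_apply,
        smul_eq_mul]
      rw [Real.sq_sqrt (by positivity)]
      field_simp
    simp only [hpt]
    have h5 : Integrable (fun ω => s a ω * L (W a ω) - c a * L (W a ω)) P :=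
      h3.sub ((hLi a).const_mul _)
    rw [integral_sub h5 h2, integral_sub h3 ((hLi a).const_mul _),
      integral_const_mul, hW1]
    ring
  -- the remainder
  set R : ℝ → Ω → ℝ := fun a ω => √a * (√(T a ω : ℝ) * H a ω) - s a ω * L (W a ω)
    - s a ω ^ 3 * (Q (W a ω) (W a ω) / a) with hR
  have hQm : ∀ a, Measurable fun ω => Q (W a ω) (W a ω) := fun a =>
    (Q.continuous₂.comp (continuous_id.prodMk continuous_id)).measurable.comp (hWm a)
  have hRm : ∀ a, Measurable (R a) := fun a =>
    ((((hTr a).sqrt.mul (hHm a)).const_mul _).sub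
      ((hsm a).mul (L.measurable.comp (hWm a)))).sub
      (((hsm a).pow_const 3).mul ((hQm a).div_const a))
  -- After multiplication by √a · √T, which has order a, the quadratic error contributes a multiple
  -- of η, and the error of order r contributes a^{1−r/2} → 0.
  have hRb : ∀ η > 0, ∃ u : ℝ → ℝ, Tendsto u atTop (𝓝 0) ∧ ∀ᶠ a in atTop,
      Integrable (R a) P ∧ ∫ ω, |R a ω| ∂P ≤ √c₁ / c₀ ^ 2 * (1 + C) * η + u a := by
    intro η hη
    obtain ⟨Cη, hCη0, hCη⟩ := hH η hη
    refine ⟨fun a => √c₁ * Cη / c₀ ^ r * C * a ^ (1 - r / 2), ?_, ?_⟩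
    · simpa using (tendsto_rpow_atTop_of_neg (by linarith : 1 - r / 2 < 0)).const_mul
        (√c₁ * Cη / c₀ ^ r * C)
    filter_upwards [hCη, hT, eventually_gt_atTop 0, hW.moment,
      hW.integral_rpow_le (p := 2) (by norm_num) hr.le] with a ha hTa ha0 hmr hm2
    simp only [Real.rpow_ofNat] at hm2
    have hsa : 0 < √a := Real.sqrt_pos.2 ha0
    have hdom : ∀ᵐ ω ∂P, |R a ω| ≤ √c₁ / c₀ ^ 2 * η / a * ‖W a ω‖ ^ 2
        + √c₁ * Cη / c₀ ^ r * (a / a ^ r) * ‖W a ω‖ ^ r := by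
      filter_upwards [ha] with ω hω
      obtain ⟨hT1, hT2⟩ := hTa ω
      set t : ℝ := (T a ω : ℝ) with ht
      have ht0 : 0 < t := lt_of_lt_of_le (by positivity) hT1
      have hst : √t ≠ 0 := (Real.sqrt_pos.2 ht0).ne'
      have htsq : √t ^ 2 = t := Real.sq_sqrt ht0.le
      have hasq : √a ^ 2 = a := Real.sq_sqrt ha0.le
      have eR : R a ω = √a * √t * (H a ω - L (t⁻¹ • W a ω) - Q (t⁻¹ • W a ω) (t⁻¹ • W a ω)) := by
        simp only [hR, hs, map_smul, smul_eq_mul, _root_.smul_apply]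
        rw [← ht, Real.sqrt_div ha0.le]
        have e1 : √a / √t = √a * √t * t⁻¹ := by
          field_simp; rw [htsq]
        have e2 : (√a / √t) ^ 3 / a = √a * √t * (t⁻¹ * t⁻¹) := by
          rw [div_pow]
          have : √t ^ 3 = t * √t := by rw [pow_succ, htsq]
          have h' : √a ^ 3 = a * √a := by rw [pow_succ, hasq]
          rw [this, h']; field_simp; rw [htsq]
        have e3 : (√a / √t) ^ 3 * (Q (W a ω) (W a ω) / a)
          = ((√a / √t) ^ 3 / a) * Q (W a ω) (W a ω) := by ring
        rw [e3, e2, e1]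
        ring
      have hnorm : ‖t⁻¹ • W a ω‖ ≤ ‖W a ω‖ / (c₀ * a) := by
        rw [norm_smul, norm_inv, Real.norm_of_nonneg ht0.le, inv_mul_eq_div]
        gcongr
      have hsq : √a * √t ≤ √c₁ * a := by
        have : √t ≤ √c₁ * √a := by
          rw [← Real.sqrt_mul hc₁.le]; exact Real.sqrt_le_sqrt hT2
        calc √a * √t ≤ √a * (√c₁ * √a) := by gcongr
          _ = √c₁ * a := by rw [← hasq]; simp only [Real.sqrt_sq hsa.le]; ring
      rw [eR, abs_mul, abs_of_nonneg (by positivity)]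
      calc _ ≤ √c₁ * a * (η * ‖t⁻¹ • W a ω‖ ^ 2 + Cη * ‖t⁻¹ • W a ω‖ ^ r) := by gcongr
        _ ≤ √c₁ * a * (η * (‖W a ω‖ / (c₀ * a)) ^ 2 + Cη * (‖W a ω‖ / (c₀ * a)) ^ r) := by
            gcongr
        _ = _ := by
            rw [Real.div_rpow (norm_nonneg _) (by positivity), Real.mul_rpow hc₀.le ha0.le]
            field_simp
    have hdi : Integrable (fun ω => √c₁ / c₀ ^ 2 * η / a * ‖W a ω‖ ^ 2
        + √c₁ * Cη / c₀ ^ r * (a / a ^ r) * ‖W a ω‖ ^ r) P :=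
      ((iW2 a).const_mul _).add ((iWr a).const_mul _)
    have hRi : Integrable (R a) P := Integrable.mono' hdi (hRm a).aestronglyMeasurable hdom
    refine ⟨hRi, (integral_mono_ae hRi.abs hdi hdom).trans ?_⟩
    rw [integral_add ((iW2 a).const_mul _) ((iWr a).const_mul _), integral_const_mul,
      integral_const_mul]
    have q1 : √c₁ / c₀ ^ 2 * η / a * ∫ ω, ‖W a ω‖ ^ 2 ∂P ≤ √c₁ / c₀ ^ 2 * (1 + C) * η := by
      calc _ ≤ √c₁ / c₀ ^ 2 * η / a * ((1 + C) * a ^ ((2 : ℝ) * (1 / 2))) := by gcongr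
        _ = _ := by norm_num; field_simp
    have q2 : √c₁ * Cη / c₀ ^ r * (a / a ^ r) * ∫ ω, ‖W a ω‖ ^ r ∂P ≤
        √c₁ * Cη / c₀ ^ r * C * a ^ (1 - r / 2) := by
      calc _ ≤ √c₁ * Cη / c₀ ^ r * (a / a ^ r) * (C * a ^ (r * (1 / 2))) := by gcongr
        _ = _ := by
          have : a ^ (1 - r / 2) = a / a ^ r * a ^ (r * (1 / 2)) := by
            have e : 1 - r / 2 = 1 - r + r * (1 / 2) := by ring
            rw [e, Real.rpow_add ha0, Real.rpow_sub ha0, Real.rpow_one]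
          rw [this]; ring
    exact add_le_add q1 q2
  have hRi : ∀ᶠ a in atTop, Integrable (R a) P := by
    obtain ⟨u, -, hu⟩ := hRb 1 one_pos
    exact hu.mono fun a ha => ha.1
  have hRlim : Tendsto (fun a => ∫ ω, R a ω ∂P) atTop (𝓝 0) := by
    refine squeeze_zero_norm (fun a => norm_integral_le_integral_norm _) ?_
    refine tendsto_zero_of_forall_le_add
      (Eventually.of_forall fun a => integral_nonneg fun ω => abs_nonneg _) fun ε hε => ?_
    set q := √c₁ / c₀ ^ 2 * (1 + C) with hq
    have hq0 : 0 ≤ q := by have := hW.nonneg; positivity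
    obtain ⟨u, hu0, hu⟩ := hRb (ε / (q + 1)) (by positivity)
    refine ⟨u, hu0, hu.mono fun a ha => ha.2.trans ?_⟩
    gcongr
    rw [mul_div_assoc', div_le_iff₀ (by positivity)]
    nlinarith
  have hsplit : ∀ a ω, √a * (√(T a ω : ℝ) * H a ω) = R a ω + s a ω * L (W a ω)
      + s a ω ^ 3 * (Q (W a ω) (W a ω) / a) := fun a ω => by simp only [hR]; ring
  constructor
  · filter_upwards [hRi, hLsi, hi3, eventually_gt_atTop 0] with a h1 h2 h3 ha0
    have hsum := (h1.add h2).add h3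
    have hsa : √a ≠ 0 := (Real.sqrt_pos.2 ha0).ne'
    refine (hsum.const_mul (√a)⁻¹).congr (ae_of_all _ fun ω => ?_)
    have := hsplit a ω
    simp only [Pi.add_apply]
    rw [← this, ← mul_assoc, inv_mul_cancel₀ hsa, one_mul]
  · have h := (hRlim.add hLs).add hl3
    have e : 0 + β (L.smulRight D) + k ^ 3 * ((k ^ 2)⁻¹ * β Q) = β (L.smulRight D) + k * β Q := by
      field_simp; ring
    rw [e] at h
    refine h.congr' ?_
    filter_upwards [hRi, hLsi, hi3] with a h1 h2 h3
    rw [← integral_const_mul]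
    simp only [hsplit]
    rw [integral_add (h1.fun_add h2) h3, integral_add h1 h2]

end Limit

end SeqBias

/-! ### Second order Taylor remainder -/

namespace SeqBias

section Taylor

variable {E : Type*} [NormedAddCommGroup E] [NormedSpace ℝ E]

/-- Second order Taylor formula. -/
theorem exists_taylor_two_le {h : E → ℝ} {m : E} (hh : ContDiffAt ℝ 2 h m) {η : ℝ} (hη : 0 < η) :
    ∃ δ > 0, ∀ y : E, ‖y‖ ≤ δ →
      |h (m + y) - h m - fderiv ℝ h m y - ((1 / 2 : ℝ) • fderiv ℝ (fderiv ℝ h) m) y y| ≤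
        η * ‖y‖ ^ 2 := by
  have hd : ∀ᶠ x in 𝓝 m, DifferentiableAt ℝ h x := by
    filter_upwards [hh.eventually (by simp)] with x hx
    exact hx.differentiableAt (by norm_num)
  have hd2 : HasFDerivAt (fderiv ℝ h) (fderiv ℝ (fderiv ℝ h) m) m :=
    ((hh.fderiv_right (m := 1) (by norm_num)).differentiableAt (by norm_num)).hasFDerivAt
  set L := fderiv ℝ h m with hL
  set B := fderiv ℝ (fderiv ℝ h) m with hB
  have hlo := (hasFDerivAt_iff_isLittleO_nhds_zero.1 hd2).def hη
  have hd' : ∀ᶠ y in 𝓝 (0 : E), DifferentiableAt ℝ h (m + y) := by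
    have : Tendsto (fun y : E => m + y) (𝓝 0) (𝓝 m) := by
      have := (continuous_const_add m).tendsto (0 : E)
      rwa [add_zero] at this
    exact this.eventually hd
  obtain ⟨ρ, hρ, hball⟩ := Metric.eventually_nhds_iff_ball.1 (hlo.and hd')
  refine ⟨ρ / 2, by linarith, fun y hy => ?_⟩
  have hmem : ∀ t ∈ Set.Icc (0 : ℝ) 1, t • y ∈ Metric.ball (0 : E) ρ := by
    intro t ht
    rw [mem_ball_zero_iff, norm_smul, Real.norm_of_nonneg ht.1]
    nlinarith [ht.2, norm_nonneg y]
  -- The mean value inequality is applied along the segment to h minus its quadratic terms. The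
  -- derivative is controlled by differentiability of `fderiv ℝ h` at m alone, so no regularity of
  -- the second derivative is used.
  set f : ℝ → ℝ := fun t => h (m + t • y) - t * L y - t ^ 2 / 2 * B y y with hf
  have hderiv : ∀ t ∈ Set.Icc (0 : ℝ) 1,
      HasDerivWithinAt f (fderiv ℝ h (m + t • y) y - L y - t * B y y) (Set.Icc 0 1) t := by
    intro t ht
    have h1 : HasDerivAt (fun t : ℝ => m + t • y) y t := by
      simpa using ((hasDerivAt_id t).smul_const y).const_add m
    have h2 := (hball _ (hmem t ht)).2.hasFDerivAt.comp_hasDerivAt t h1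
    have h3 : HasDerivAt (fun t : ℝ => t * L y) (L y) t := by
      simpa using (hasDerivAt_id t).mul_const (L y)
    have h4 : HasDerivAt (fun t : ℝ => t ^ 2 / 2 * B y y) (t * B y y) t := by
      have := (((hasDerivAt_id t).pow 2).div_const 2).mul_const (B y y)
      refine this.congr_deriv ?_
      simp
    exact ((h2.sub h3).sub h4).hasDerivWithinAt
  have hbound : ∀ t ∈ Set.Ico (0 : ℝ) 1,
      ‖fderiv ℝ h (m + t • y) y - L y - t * B y y‖ ≤ η * ‖y‖ ^ 2 := by
    intro t ht
    have h1 := (hball _ (hmem t ⟨ht.1, ht.2.le⟩)).1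
    have e : fderiv ℝ h (m + t • y) y - L y - t * B y y =
        (fderiv ℝ h (m + t • y) - L - B (t • y)) y := by simp
    rw [e]
    refine (ContinuousLinearMap.le_opNorm _ _).trans ?_
    have h2 : ‖t • y‖ ≤ ‖y‖ := by
      rw [norm_smul, Real.norm_of_nonneg ht.1]
      nlinarith [ht.2, norm_nonneg y]
    calc _ ≤ (η * ‖t • y‖) * ‖y‖ := by gcongr
      _ ≤ (η * ‖y‖) * ‖y‖ := by gcongr
      _ = _ := by ring
  have := norm_image_sub_le_of_norm_deriv_le_segment_01' hderiv hbound
  rw [Real.norm_eq_abs] at this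
  refine le_trans (le_of_eq ?_) this
  congr 1
  simp [hf]
  ring

/-- A quadratic Taylor remainder controlled by a small multiple of the square near the point, and by
a power `r` far from it. -/
theorem exists_remainder_le {h : E → ℝ} {m : E} (hh : ContDiffAt ℝ 2 h m) {r C : ℝ} (hr : 2 ≤ r)
    {η : ℝ} (hη : 0 < η) :
    ∃ Cη : ℝ, 0 ≤ Cη ∧ ∀ y : E, |h (m + y)| ≤ C * (1 + ‖m + y‖ ^ r) →
      |h (m + y) - h m - fderiv ℝ h m y - ((1 / 2 : ℝ) • fderiv ℝ (fderiv ℝ h) m) y y| ≤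
        η * ‖y‖ ^ 2 + Cη * ‖y‖ ^ r := by
  obtain ⟨δ, hδ, hT⟩ := exists_taylor_two_le hh hη
  set L := fderiv ℝ h m
  set Q := (1 / 2 : ℝ) • fderiv ℝ (fderiv ℝ h) m
  set A : ℝ := |C| * (1 + 2 ^ r * ‖m‖ ^ r) + |h m|
  -- Beyond radius δ each lower power of ‖y‖ is a multiple of ‖y‖^r. The summands pay, in order, for
  -- the constants, the growth of h, the linear term and the quadratic term.
  refine ⟨A * δ ^ (-r) + |C| * 2 ^ r + ‖L‖ * δ ^ (1 - r) + ‖Q‖ * δ ^ (2 - r), by positivity,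
    fun y hy => ?_⟩
  rcases le_total ‖y‖ δ with h1 | h1
  · have := hT y h1
    have : 0 ≤ (A * δ ^ (-r) + |C| * 2 ^ r + ‖L‖ * δ ^ (1 - r) + ‖Q‖ * δ ^ (2 - r)) * ‖y‖ ^ r := by
      positivity
    linarith
  · have hy0 : 0 < ‖y‖ := hδ.trans_le h1
    have hp : ∀ p : ℝ, p ≤ r → ‖y‖ ^ p ≤ δ ^ (p - r) * ‖y‖ ^ r := by
      intro p hp
      have e : ‖y‖ ^ p = ‖y‖ ^ (p - r) * ‖y‖ ^ r := by rw [← Real.rpow_add hy0]; ring_nf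
      rw [e]
      exact mul_le_mul_of_nonneg_right (Real.rpow_le_rpow_of_nonpos hδ h1 (by linarith))
        (by positivity)
    have hp0 := hp 0 (by linarith)
    have hp1 := hp 1 (by linarith)
    have hp2 := hp 2 hr
    rw [Real.rpow_zero, zero_sub] at hp0
    rw [Real.rpow_one] at hp1
    rw [Real.rpow_ofNat] at hp2
    have hsum : ‖m + y‖ ^ r ≤ 2 ^ r * ‖m‖ ^ r + 2 ^ r * ‖y‖ ^ r := by
      rw [← Real.mul_rpow (by norm_num) (norm_nonneg _),
        ← Real.mul_rpow (by norm_num) (norm_nonneg _)]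
      rcases le_total ‖m‖ ‖y‖ with h2 | h2
      · have : ‖m + y‖ ^ r ≤ (2 * ‖y‖) ^ r :=
          Real.rpow_le_rpow (norm_nonneg _) ((norm_add_le _ _).trans (by linarith)) (by linarith)
        have : 0 ≤ (2 * ‖m‖) ^ r := by positivity
        linarith
      · have : ‖m + y‖ ^ r ≤ (2 * ‖m‖) ^ r :=
          Real.rpow_le_rpow (norm_nonneg _) ((norm_add_le _ _).trans (by linarith)) (by linarith)
        have : 0 ≤ (2 * ‖y‖) ^ r := by positivity
        linarith
    have hhy : |h (m + y)| ≤ |C| * (1 + (2 ^ r * ‖m‖ ^ r + 2 ^ r * ‖y‖ ^ r)) := by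
      refine hy.trans ?_
      calc C * (1 + ‖m + y‖ ^ r) ≤ |C| * (1 + ‖m + y‖ ^ r) := by
            gcongr; exact le_abs_self C
        _ ≤ _ := by gcongr
    have hLy : |L y| ≤ ‖L‖ * ‖y‖ := L.le_opNorm y
    have hQy : |Q y y| ≤ ‖Q‖ * ‖y‖ ^ 2 := by
      have := Q.le_opNorm₂ y y
      rw [Real.norm_eq_abs] at this
      nlinarith
    have htri : |h (m + y) - h m - L y - Q y y| ≤ |h (m + y)| + |h m| + |L y| + |Q y y| := by
      refine (abs_sub _ _).trans (add_le_add_left ?_ _)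
      refine (abs_sub _ _).trans (add_le_add_left ?_ _)
      exact abs_sub _ _
    have hA : A ≤ A * (δ ^ (-r) * ‖y‖ ^ r) := le_mul_of_one_le_right (by positivity) hp0
    have hL2 := mul_le_mul_of_nonneg_left hp1 (norm_nonneg L)
    have hQ2 := mul_le_mul_of_nonneg_left hp2 (norm_nonneg Q)
    have : 0 ≤ η * ‖y‖ ^ 2 := by positivity
    have eA : A = |C| * (1 + 2 ^ r * ‖m‖ ^ r) + |h m| := rfl
    nlinarith

end Taylor

/-! ### The bias coefficient as means of bilinear forms -/

section Covariance

variable {d : ℕ} {Ω : Type*} [MeasurableSpace Ω] {P : Measure Ω} [IsProbabilityMeasure P]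

/-- The mean of a bilinear form in a centered vector, in terms of the covariance matrix. -/
theorem integral_bilin_eq_sum_covMatrix {Y : Ω → EuclideanSpace ℝ (Fin d)}
    (hY : MemLp Y 2 P) {m : EuclideanSpace ℝ (Fin d)} (hm : m = ∫ ω, Y ω ∂P)
    (b : EuclideanSpace ℝ (Fin d) →L[ℝ] EuclideanSpace ℝ (Fin d) →L[ℝ] ℝ) :
    ∫ ω, b (Y ω - m) (Y ω - m) ∂P = ∑ i, ∑ j,
      b (EuclideanSpace.single i 1) (EuclideanSpace.single j 1) * covMatrix Y P i j := by
  have hcoord : ∀ i, MemLp (fun ω => Y ω i) 2 P := fun i =>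
    (EuclideanSpace.proj (𝕜 := ℝ) i).comp_memLp' hY
  have hmi : ∀ i, m i = ∫ ω, Y ω i ∂P := by
    intro i
    have := (EuclideanSpace.proj (𝕜 := ℝ) i).integral_comp_comm (hY.integrable (by norm_num))
    rw [hm]
    exact this.symm
  have hrep : ∀ x : EuclideanSpace ℝ (Fin d), x = ∑ i, x i • EuclideanSpace.single i (1 : ℝ) := by
    intro x
    conv_lhs => rw [← (EuclideanSpace.basisFun (Fin d) ℝ).sum_repr x]
    simp
  have hexp : ∀ x : EuclideanSpace ℝ (Fin d), b x x = ∑ i, ∑ j,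
      b (EuclideanSpace.single i 1) (EuclideanSpace.single j 1) * (x i * x j) := by
    intro x
    conv_lhs => rw [hrep x]
    simp only [map_sum, map_smul, _root_.sum_apply, _root_.smul_apply, smul_eq_mul,
      Finset.mul_sum]
    rw [Finset.sum_comm]
    refine Finset.sum_congr rfl fun i _ => Finset.sum_congr rfl fun j _ => ?_
    ring
  have hint : ∀ i j, Integrable (fun ω => (Y ω i - m i) * (Y ω j - m j)) P := fun i j =>
    ((hcoord i).sub (memLp_const _)).integrable_mul ((hcoord j).sub (memLp_const _))
  simp only [hexp, PiLp.sub_apply]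
  rw [integral_finsetSum _ fun i _ => integrable_finsetSum _ fun j _ => (hint i j).const_mul _]
  refine Finset.sum_congr rfl fun i _ => ?_
  rw [integral_finsetSum _ fun j _ => (hint i j).const_mul _]
  refine Finset.sum_congr rfl fun j _ => ?_
  rw [integral_const_mul]
  simp only [covMatrix, Matrix.of_apply, covariance, hmi]

theorem covMatrix_comm (Y : Ω → EuclideanSpace ℝ (Fin d)) (i j : Fin d) :
    covMatrix Y P i j = covMatrix Y P j i := by
  simp only [covMatrix, Matrix.of_apply]
  exact covariance_comm _ _

/-- Brings the coefficient to the shape in which Wald's second identity delivers the limit. In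
coordinates both sides are double sums over the covariance matrix, whose symmetry reconciles the
order of the indices. -/
theorem biasCoeff_mul_sqrt {κ h : EuclideanSpace ℝ (Fin d) → ℝ} {Y : Ω → EuclideanSpace ℝ (Fin d)}
    (hY : MemLp Y 2 P) {m : EuclideanSpace ℝ (Fin d)} (hm : m = ∫ ω, Y ω ∂P) (hκ : 0 < κ m) :
    biasCoeff κ h m (covMatrix Y P) * √(κ m) =
      ∫ ω, (fderiv ℝ h m).smulRight (fderiv ℝ (fun y => √(κ y)) m) (Y ω - m) (Y ω - m) ∂P
      + √(κ m) * ∫ ω, ((1 / 2 : ℝ) • fderiv ℝ (fderiv ℝ h) m) (Y ω - m) (Y ω - m) ∂P := by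
  have hs : √(κ m) ≠ 0 := (Real.sqrt_pos.2 hκ).ne'
  have hgrad : ∀ (f : EuclideanSpace ℝ (Fin d) → ℝ) i,
      (gradient f m).ofLp i = fderiv ℝ f m (EuclideanSpace.single i 1) := by
    intro f i
    have h1 : inner ℝ (gradient f m) (EuclideanSpace.single i (1 : ℝ)) =
        fderiv ℝ f m (EuclideanSpace.single i 1) := by
      simp [gradient]
    rw [← h1, EuclideanSpace.inner_single_right]
    simp
  rw [integral_bilin_eq_sum_covMatrix hY hm, integral_bilin_eq_sum_covMatrix hY hm]
  unfold biasCoeff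
  rw [add_mul, div_mul_cancel₀ _ hs]
  congr 1
  · simp only [dotProduct, Matrix.mulVec, hgrad, ContinuousLinearMap.smulRight_apply,
      _root_.smul_apply, smul_eq_mul, Finset.mul_sum]
    rw [Finset.sum_comm]
    refine Finset.sum_congr rfl fun i _ => Finset.sum_congr rfl fun j _ => ?_
    rw [covMatrix_comm Y j i]
    ring
  · simp only [Matrix.trace, Matrix.diag, Matrix.mul_apply, hessian, Matrix.of_apply,
      _root_.smul_apply, smul_eq_mul]
    rw [mul_comm, Finset.sum_div]
    congr 1
    refine Finset.sum_congr rfl fun i _ => ?_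
    rw [Finset.sum_div]
    refine Finset.sum_congr rfl fun j _ => ?_
    rw [covMatrix_comm Y j i]
    ring

end Covariance

end SeqBias

/-! ### Growth of the time bounds and the exceptional events -/

namespace SeqBias

section Scaling

theorem tendsto_div_of_isEquivalent {n : ℝ → ℕ} {ε : ℝ} (hε : 0 < ε)
    (hn : (fun a => (n a : ℝ)) ~[atTop] (fun a => a / ε)) :
    Tendsto (fun a => (n a : ℝ) / a) atTop (𝓝 ε⁻¹) := by
  have h0 : ∀ᶠ a : ℝ in atTop, a / ε ≠ 0 := by
    filter_upwards [eventually_gt_atTop 0] with a ha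
    positivity
  have h := ((isEquivalent_iff_tendsto_one h0).1 hn).mul_const ε⁻¹
  rw [one_mul] at h
  refine h.congr' ?_
  filter_upwards [eventually_gt_atTop 0] with a ha
  simp only [Pi.div_apply]
  field_simp

theorem eventually_mul_lt_of_lt {n : ℝ → ℕ} {ε β : ℝ} (hβ : 0 < β) (hβε : β < ε)
    (hn : Tendsto (fun a => (n a : ℝ) / a) atTop (𝓝 ε⁻¹)) :
    ∀ᶠ a in atTop, (n a : ℝ) * β < a := by
  have h : ε⁻¹ < β⁻¹ := inv_strictAnti₀ hβ hβε
  filter_upwards [hn.eventually (gt_mem_nhds h), eventually_gt_atTop 0] with a h1 ha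
  rw [div_lt_iff₀ ha, ← div_eq_inv_mul, lt_div_iff₀ hβ] at h1
  exact h1

/-- The shift by one allows use at time n₀ − 1, the last one before the rule is truncated. -/
theorem eventually_lt_sub_one_mul {n : ℝ → ℕ} {ε β : ℝ} (hε : 0 < ε) (hβε : ε < β)
    (hn : Tendsto (fun a => (n a : ℝ) / a) atTop (𝓝 ε⁻¹)) :
    ∀ᶠ a in atTop, a < ((n a : ℝ) - 1) * β := by
  have hβ : 0 < β := hε.trans hβε
  have h : β⁻¹ < ε⁻¹ := inv_strictAnti₀ hε hβε
  have h2 : Tendsto (fun a => (n a : ℝ) / a - a⁻¹) atTop (𝓝 ε⁻¹) := by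
    simpa using hn.sub (tendsto_inv_atTop_zero (𝕜 := ℝ))
  filter_upwards [h2.eventually (lt_mem_nhds h), eventually_gt_atTop 0] with a h1 ha
  have e : (n a : ℝ) / a - a⁻¹ = ((n a : ℝ) - 1) / a := by field_simp
  rw [e, lt_div_iff₀ ha, ← div_eq_inv_mul, div_lt_iff₀ hβ] at h1
  exact h1

variable {d : ℕ} {Ω : Type*} [MeasurableSpace Ω] {X : ℕ → Ω → EuclideanSpace ℝ (Fin d)}
  {m : EuclideanSpace ℝ (Fin d)} {P : Measure Ω} [IsProbabilityMeasure P] {r : ℝ}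
  {g : EuclideanSpace ℝ (Fin d) → ℝ}

/-- The last centered summand before a time. -/
noncomputable def lastStep (X : ℕ → Ω → EuclideanSpace ℝ (Fin d)) (m : EuclideanSpace ℝ (Fin d)) (T : Ω → ℕ)
    (ω : Ω) : EuclideanSpace ℝ (Fin d) :=
  {ω | 0 < T ω}.indicator (fun ω => X (T ω - 1) ω - m) ω

theorem hasMomentScale_psum (hξ : IsCenteredIID (fun i ω => X i ω - m) P r) (hr : 2 < r)
    {T : ℝ → Ω → ℕ} {n : ℝ → ℕ} (hT : ∀ a, IsBoundedStop (fun i ω => X i ω - m) (T a) (n a))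
    {c₁ : ℝ} (hn : ∀ᶠ a in atTop, (n a : ℝ) ≤ c₁ * a) :
    ∃ C, HasMomentScale (fun a ω => psum (fun i ω => X i ω - m) (T a ω) ω) P r (1 / 2) C := by
  have hr0 : 0 < r := by linarith
  obtain ⟨K, hK0, hK⟩ := hξ.exists_integral_norm_psum_rpow_le hr
  refine ⟨K * |c₁| ^ (r / 2), fun a => (hT a).memLp_psum hξ hr0, by positivity, ?_⟩
  filter_upwards [hn, eventually_gt_atTop 0] with a ha ha0
  refine (hK _ _ (hT a)).trans ?_
  have h1 : (n a : ℝ) ≤ |c₁| * a := ha.trans (by gcongr; exact le_abs_self _)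
  calc K * (n a : ℝ) ^ (r / 2) ≤ K * (|c₁| * a) ^ (r / 2) := by gcongr
    _ = _ := by
      rw [Real.mul_rpow (abs_nonneg _) ha0.le, mul_assoc]
      ring_nf

theorem hasMomentScale_lastStep (hξ : IsCenteredIID (fun i ω => X i ω - m) P r) (hr : 2 < r)
    {T : ℝ → Ω → ℕ} {n : ℝ → ℕ} (hT : ∀ a, IsBoundedStop (fun i ω => X i ω - m) (T a) (n a))
    {c₁ : ℝ} (hn : ∀ᶠ a in atTop, (n a : ℝ) ≤ c₁ * a) :
    ∃ C, HasMomentScale (fun a => lastStep X m (T a)) P r (1 / r) C := by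
  have hr0 : 0 < r := by linarith
  have hM0 : 0 ≤ ∫ ω, ‖X 0 ω - m‖ ^ r ∂P := integral_nonneg fun _ => by positivity
  have e : ∀ a ω, ‖lastStep X m (T a) ω‖ ^ r =
      {ω | 0 < T a ω}.indicator (fun ω => ‖X (T a ω - 1) ω - m‖ ^ r) ω := by
    intro a ω
    unfold lastStep
    by_cases h : 0 < T a ω
    · simp [h]
    · simp [h, Real.zero_rpow hr0.ne']
  have hmeas : ∀ a, Measurable (lastStep X m (T a)) := by
    intro a
    refine Measurable.indicator ?_ (hξ.past_le 0 _ ((hT a).measurableSet_lt 0))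
    exact (hT a).measurable_comp hξ (f := fun n ω => X (n - 1) ω - m)
      fun n => hξ.measurable (n - 1)
  refine ⟨|c₁| * ∫ ω, ‖X 0 ω - m‖ ^ r ∂P, fun a => ?_, by positivity, ?_⟩
  · rw [← integrable_norm_rpow_iff (hmeas a).aestronglyMeasurable (by simpa using hr0) (by simp),
      ENNReal.toReal_ofReal hr0.le]
    simp only [e]
    exact ((hT a).integral_norm_last_rpow_le hξ hr0).1
  · filter_upwards [hn, eventually_gt_atTop 0] with a ha ha0
    simp only [e]
    refine ((hT a).integral_norm_last_rpow_le hξ hr0).2.trans ?_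
    have h1 : (n a : ℝ) ≤ |c₁| * a := ha.trans (by gcongr; exact le_abs_self _)
    rw [mul_one_div_cancel hr0.ne', Real.rpow_one]
    calc _ ≤ |c₁| * a * ∫ ω, ‖X 0 ω - m‖ ^ r ∂P := by gcongr
      _ = _ := by ring

/-- With overwhelming probability, all sample means between the times `n₁` and `n₀` are close to
the mean. -/
theorem exists_close_event (hξ : IsCenteredIID (fun i ω => X i ω - m) P r) (hr : 2 < r)
    {n₀ n₁ : ℝ → ℕ} {c₀ c₁ : ℝ} (hc₀ : 0 < c₀) (hc₁ : 0 < c₁)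
    (hn₁ : ∀ᶠ a in atTop, c₀ * a ≤ n₁ a) (hn₀ : ∀ᶠ a in atTop, (n₀ a : ℝ) ≤ c₁ * a) {δ : ℝ}
    (hδ : 0 < δ) :
    ∃ (G : ℝ → Set Ω) (K : ℝ), (∀ a, MeasurableSet (G a)) ∧
      (∀ᶠ a in atTop, P.real (G a)ᶜ ≤ K * a ^ (-(r / 2))) ∧
      ∀ a, ∀ ω ∈ G a, ∀ k, 1 ≤ k → n₁ a ≤ k → k ≤ n₀ a → ‖sampleMean X k ω - m‖ ≤ δ := by
  obtain ⟨K, hK0, hK⟩ := exists_prob_max_psum_le hξ hr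
  set ξ : ℕ → Ω → EuclideanSpace ℝ (Fin d) := fun i ω => X i ω - m with hξd
  have hr0 : 0 < r := by linarith
  -- The single threshold δ n₁ serves all k ≥ n₁. Since n₁ and n₀ are of order a, the maximal
  -- inequality gives a^{r/2}/a^r.
  set G : ℝ → Set Ω := fun a => {ω | ∃ k, 1 ≤ k ∧ k ≤ n₀ a ∧ δ * n₁ a ≤ ‖psum ξ k ω‖}ᶜ with hG
  refine ⟨G, K * c₁ ^ (r / 2) / (δ * c₀) ^ r, fun a => ?_, ?_, ?_⟩
  · refine MeasurableSet.compl ?_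
    have : {ω | ∃ k, 1 ≤ k ∧ k ≤ n₀ a ∧ δ * n₁ a ≤ ‖psum ξ k ω‖} =
        ⋃ k : ℕ, ⋃ _ : 1 ≤ k, ⋃ _ : k ≤ n₀ a, {ω | δ * n₁ a ≤ ‖psum ξ k ω‖} := by
      ext ω; simp only [Set.mem_iUnion, Set.mem_ofPred_eq, exists_prop]
    rw [this]
    refine MeasurableSet.iUnion fun k => MeasurableSet.iUnion fun _ => MeasurableSet.iUnion fun _ =>
      measurableSet_le measurable_const ?_
    exact (Finset.measurable_fun_sum _ fun i _ => hξ.measurable i).norm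
  · filter_upwards [hn₁, hn₀, eventually_gt_atTop 0] with a h1 h0 ha
    have hn : 0 < (n₁ a : ℝ) := lt_of_lt_of_le (by positivity) h1
    simp only [hG, compl_compl]
    refine (hK (n₀ a) (δ * n₁ a) (by positivity)).trans ?_
    calc K * (n₀ a : ℝ) ^ (r / 2) / (δ * n₁ a) ^ r
        ≤ K * (c₁ * a) ^ (r / 2) / (δ * (c₀ * a)) ^ r := by gcongr
      _ = _ := by
        rw [← mul_assoc, Real.mul_rpow (by positivity) ha.le, Real.mul_rpow (by positivity) ha.le,
          Real.rpow_neg ha.le]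
        have : a ^ r = a ^ (r / 2) * a ^ (r / 2) := by rw [← Real.rpow_add ha]; ring_nf
        rw [this]
        field_simp
  · intro a ω hω k hk hk1 hk0
    have hkpos : (0 : ℝ) < k := by exact_mod_cast hk
    have h2 : ‖psum ξ k ω‖ < δ * n₁ a := by
      by_contra hcon
      exact hω ⟨k, hk, hk0, not_lt.1 hcon⟩
    rw [← mul_norm_sampleMean_sub hk] at h2
    have h3 : δ * n₁ a ≤ δ * k := by gcongr
    have h4 : (k : ℝ) * ‖sampleMean X k ω - m‖ ≤ k * δ := by linarith
    exact le_of_mul_le_mul_left h4 hkpos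

/-- Under early crossing, the sum at time `n₁` has the mean of the sum at the crossing time. -/
theorem integral_indicator_crossed_eq (hξ : IsCenteredIID (fun i ω => X i ω - m) P r) (hr : 1 ≤ r)
    (hg : Measurable g) (L : EuclideanSpace ℝ (Fin d) →L[ℝ] ℝ) (a : ℝ) (n : ℕ) :
    ∫ ω, {ω | ¬ NotCrossed X g a n ω}.indicator
        (fun ω => L (psum (fun i ω => X i ω - m) n ω)) ω ∂P =
      ∫ ω, {ω | ¬ NotCrossed X g a n ω}.indicator (fun ω =>
        L (psum (fun i ω => X i ω - m) (truncPassage X g a n ω) ω)) ω ∂P := by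
  set ξ : ℕ → Ω → EuclideanSpace ℝ (Fin d) := fun i ω => X i ω - m with hξd
  have hm : MeasurableSet {ω | ¬ NotCrossed X g a n ω} :=
    (hξ.past_le n _ (measurableSet_past_notCrossed hg n)).compl
  have hτ := isBoundedStop_truncPassage (X := X) (m := m) hg a n
  have hc := IsBoundedStop.const ξ n
  -- Optional stopping: both sums have mean zero and coincide off the event, so their integrals over
  -- the event agree.
  have h1 := hc.integral_psum hξ hr L
  have h2 := hτ.integral_psum hξ hr L
  have hr0 : 0 < r := by linarith
  have i1 : Integrable (fun ω => L (psum ξ n ω)) P :=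
    L.integrable_comp ((hc.memLp_psum hξ hr0).integrable (by simpa using hr))
  have i2 : Integrable (fun ω => L (psum ξ (truncPassage X g a n ω) ω)) P :=
    L.integrable_comp ((hτ.memLp_psum hξ hr0).integrable (by simpa using hr))
  rw [integral_indicator hm, integral_indicator hm]
  have e1 := integral_add_compl hm i1
  have e2 := integral_add_compl hm i2
  have e3 : ∫ ω in {ω | ¬ NotCrossed X g a n ω}ᶜ, L (psum ξ n ω) ∂P =
      ∫ ω in {ω | ¬ NotCrossed X g a n ω}ᶜ, L (psum ξ (truncPassage X g a n ω) ω) ∂P := by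
    refine setIntegral_congr_fun hm.compl fun ω hω => ?_
    have : NotCrossed X g a n ω := by simpa using hω
    simp only [truncPassage_eq_of_notCrossed this]
  linarith

/-- If `g` is smaller than `ε₁` near the mean, crossing before `n₁` has vanishing probability, and
the sum at time `n₁` has a vanishing mean on this event. -/
theorem tendsto_early_crossing (hξ : IsCenteredIID (fun i ω => X i ω - m) P r) (hr : 2 < r)
    (hX : ∀ i, Measurable (X i)) (hg : Measurable g) {n₁ : ℝ → ℕ} {δ β : ℝ}
    (hδ : 0 < δ) (hβ : 0 < β) (hgβ : ∀ x, ‖x - m‖ ≤ δ → g x ≤ β)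
    (hn : ∀ᶠ a in atTop, (n₁ a : ℝ) * β < a) (L : EuclideanSpace ℝ (Fin d) →L[ℝ] ℝ) :
    Tendsto (fun a => P.real {ω | ¬ NotCrossed X g a (n₁ a) ω}) atTop (𝓝 0) ∧
    Tendsto (fun a => ∫ ω, {ω | ¬ NotCrossed X g a (n₁ a) ω}.indicator
      (fun ω => L (psum (fun i ω => X i ω - m) (n₁ a) ω)) ω ∂P) atTop (𝓝 0) := by
  have h := tendsto_integral_early_crossing hξ hr hX hg hδ hβ hgβ hn
  set ξ : ℕ → Ω → EuclideanSpace ℝ (Fin d) := fun i ω => X i ω - m with hξd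
  have hr0 : 0 < r := by linarith
  have hm : ∀ a, MeasurableSet {ω | ¬ NotCrossed X g a (n₁ a) ω} := fun a =>
    (hξ.past_le _ _ (measurableSet_past_notCrossed hg (n₁ a))).compl
  have hτ := fun a => isBoundedStop_truncPassage (X := X) (m := m) hg a (n₁ a)
  have i0 : ∀ a, Integrable (fun ω => 1 + ‖psum ξ (truncPassage X g a (n₁ a) ω) ω‖) P := by
    intro a
    refine (integrable_const 1).add ?_
    have := (hτ a).integrable_norm_psum_rpow hξ hr0 (p := 1) zero_le_one (by linarith)
    simpa using this
  constructor
  · refine squeeze_zero (fun a => measureReal_nonneg) (fun a => ?_) h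
    have e : P.real {ω | ¬ NotCrossed X g a (n₁ a) ω} =
        ∫ ω, {ω | ¬ NotCrossed X g a (n₁ a) ω}.indicator (fun _ => (1 : ℝ)) ω ∂P := by
      rw [integral_indicator_const _ (hm a), smul_eq_mul, mul_one]
    rw [e]
    refine integral_mono ((integrable_const 1).indicator (hm a)) ((i0 a).indicator (hm a)) fun ω => ?_
    refine Set.indicator_le_indicator ?_
    have := norm_nonneg (psum ξ (truncPassage X g a (n₁ a) ω) ω)
    linarith
  · refine squeeze_zero_norm (a := fun a => ‖L‖ * ∫ ω,
      {ω | ¬ NotCrossed X g a (n₁ a) ω}.indicator (fun ω =>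
        1 + ‖psum ξ (truncPassage X g a (n₁ a) ω) ω‖) ω ∂P) (fun a => ?_)
      (by simpa using h.const_mul ‖L‖)
    -- The sum at n₁ has order √a and the event has no rate, so a direct bound would fail; the sum
    -- at the crossing time is under control.
    rw [integral_indicator_crossed_eq hξ (by linarith) hg, ← integral_const_mul]
    refine norm_integral_le_of_norm_le (((i0 a).indicator (hm a)).const_mul _)
      (ae_of_all _ fun ω => ?_)
    rw [norm_indicator_eq_indicator_norm]
    by_cases hω : ω ∈ {ω | ¬ NotCrossed X g a (n₁ a) ω}
    · rw [Set.indicator_of_mem hω, Set.indicator_of_mem hω]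
      refine (L.le_opNorm _).trans ?_
      gcongr
      linarith
    · rw [Set.indicator_of_notMem hω, Set.indicator_of_notMem hω, mul_zero]

end Scaling

end SeqBias

/-! ### Expansion of √(a/T) in the three positions of g at the mean -/

namespace SeqBias

section Cases

variable {d : ℕ} {Ω : Type*} [MeasurableSpace Ω] {X : ℕ → Ω → EuclideanSpace ℝ (Fin d)}
  {m : EuclideanSpace ℝ (Fin d)} {P : Measure Ω} [IsProbabilityMeasure P] {r : ℝ}
  {g : EuclideanSpace ℝ (Fin d) → ℝ} {n₀ n₁ : ℝ → ℕ} {ε₀ ε₁ : ℝ}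

theorem eventually_bounds (hε₀ : 0 < ε₀) (hε : ε₀ < ε₁)
    (hn₀ : Tendsto (fun a => (n₀ a : ℝ) / a) atTop (𝓝 ε₀⁻¹))
    (hn₁ : Tendsto (fun a => (n₁ a : ℝ) / a) atTop (𝓝 ε₁⁻¹)) :
    ∃ c₀ c₁ : ℝ, 0 < c₀ ∧ 0 < c₁ ∧ ∀ᶠ a in atTop, c₀ * a ≤ n₁ a ∧ (n₀ a : ℝ) ≤ c₁ * a ∧
      n₁ a < n₀ a ∧ 1 ≤ n₁ a := by
  have hε₁ : 0 < ε₁ := hε₀.trans hε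
  have h1 : ε₁⁻¹ / 2 < ε₁⁻¹ := by have := inv_pos.2 hε₁; linarith
  have h0 : ε₀⁻¹ < ε₀⁻¹ * 2 := by have := inv_pos.2 hε₀; linarith
  obtain ⟨x, hx1, hx0⟩ := exists_between (inv_strictAnti₀ hε₀ hε)
  refine ⟨ε₁⁻¹ / 2, ε₀⁻¹ * 2, by positivity, by positivity, ?_⟩
  filter_upwards [hn₁.eventually (lt_mem_nhds h1), hn₀.eventually (gt_mem_nhds h0),
    hn₁.eventually (gt_mem_nhds hx1), hn₀.eventually (lt_mem_nhds hx0), eventually_gt_atTop 0]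
    with a b1 b2 b3 b4 ha
  rw [lt_div_iff₀ ha] at b1 b4
  rw [div_lt_iff₀ ha] at b2 b3
  refine ⟨b1.le, b2.le, by exact_mod_cast b3.trans b4, ?_⟩
  have : (0 : ℝ) < n₁ a := lt_trans (by positivity) b1
  exact_mod_cast this

theorem tendsto_sqrt_div {n : ℝ → ℕ} {ε : ℝ} (hε : 0 < ε)
    (hn : Tendsto (fun a => (n a : ℝ) / a) atTop (𝓝 ε⁻¹)) :
    Tendsto (fun a => √(a / n a)) atTop (𝓝 (√ε)) := by
  have h := hn.inv₀ (inv_ne_zero hε.ne')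
  simp only [inv_div, inv_inv] at h
  exact h.sqrt

/-- First order expansion in mean of `√(a / T)`, around a deterministic sequence tending to `k`. -/
def HasRootExpansion (X : ℕ → Ω → EuclideanSpace ℝ (Fin d)) (m : EuclideanSpace ℝ (Fin d))
    (P : Measure Ω) (T : ℝ → Ω → ℕ) (k : ℝ) (D : EuclideanSpace ℝ (Fin d) →L[ℝ] ℝ) : Prop :=
  ∃ c : ℝ → ℝ, Tendsto c atTop (𝓝 k) ∧
    Tendsto (fun a => ∫ ω, |√(a / T a ω) - c a| ∂P) atTop (𝓝 0) ∧
    ∀ L : EuclideanSpace ℝ (Fin d) →L[ℝ] ℝ, Tendsto (fun a =>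
      ∫ ω, L (psum (fun i ω => X i ω - m) (T a ω) ω) * ((√(a / T a ω) - c a)
        - D (psum (fun i ω => X i ω - m) (T a ω) ω) / T a ω) ∂P) atTop (𝓝 0)

/-- The common reduction of the three cases: only the pathwise bound on the event of close sample
means, outside the early crossings B, depends on the position of g(m). -/
theorem hasRootExpansion_of_path (hξ : IsCenteredIID (fun i ω => X i ω - m) P r) (hr : 2 < r)
    (hg : Measurable g) (hε₀ : 0 < ε₀) (hε : ε₀ < ε₁)
    (hn₀ : Tendsto (fun a => (n₀ a : ℝ) / a) atTop (𝓝 ε₀⁻¹))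
    (hn₁ : Tendsto (fun a => (n₁ a : ℝ) / a) atTop (𝓝 ε₁⁻¹))
    (D : EuclideanSpace ℝ (Fin d) →L[ℝ] ℝ) {k : ℝ} {c : ℝ → ℝ} (hc : Tendsto c atTop (𝓝 k))
    {B : ℝ → Set Ω} (hBm : ∀ a, MeasurableSet (B a))
    (hB : Tendsto (fun a => P.real (B a)) atTop (𝓝 0))
    (hBT : ∀ᶠ a in atTop, ∀ ω ∈ B a, stopRule X g n₀ n₁ a ω = n₁ a)
    (hLB : ∀ L : EuclideanSpace ℝ (Fin d) →L[ℝ] ℝ, Tendsto (fun a => ∫ ω, (B a).indicator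
      (fun ω => L (psum (fun i ω => X i ω - m) (n₁ a) ω)) ω ∂P) atTop (𝓝 0))
    {K : ℝ} (hK : 0 ≤ K)
    (hG : ∀ η > 0, ∃ δ > 0, ∀ᶠ a in atTop, ∀ ω,
      (∀ k, 1 ≤ k → n₁ a ≤ k → k ≤ n₀ a → ‖sampleMean X k ω - m‖ ≤ δ) → ω ∉ B a →
        |(√(a / stopRule X g n₀ n₁ a ω) - c a)
          - D (psum (fun i ω => X i ω - m) (stopRule X g n₀ n₁ a ω) ω) / stopRule X g n₀ n₁ a ω| ≤
        K / a * (η * ‖psum (fun i ω => X i ω - m) (stopRule X g n₀ n₁ a ω) ω‖ + 1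
          + ‖lastStep X m (stopRule X g n₀ n₁ a) ω‖)) :
    HasRootExpansion X m P (stopRule X g n₀ n₁) k D := by
  obtain ⟨c₀, c₁, hc₀, hc₁, hb⟩ := eventually_bounds hε₀ hε hn₀ hn₁
  set ξ : ℕ → Ω → EuclideanSpace ℝ (Fin d) := fun i ω => X i ω - m with hξd
  set T := stopRule X g n₀ n₁ with hTd
  have hT : ∀ a, IsBoundedStop ξ (T a) (n₀ a) := isBoundedStop_stopRule hg n₀ n₁
  have hTm : ∀ a, Measurable (T a) := fun a => (hT a).measurable hξ
  obtain ⟨C, hW⟩ := hasMomentScale_psum hξ hr hT (hb.mono fun a h => h.2.1)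
  obtain ⟨C', hZ⟩ := hasMomentScale_lastStep hξ hr hT (hb.mono fun a h => h.2.1)
  have hWm : ∀ a, Measurable fun ω => psum ξ (T a ω) ω := fun a =>
    (hT a).measurable_comp hξ fun n => Finset.measurable_fun_sum _ fun i _ => hξ.measurable i
  have hTr : ∀ a, Measurable fun ω => (T a ω : ℝ) := fun a => measurable_from_top.comp (hTm a)
  have hTlow : ∀ᶠ a in atTop, ∀ ω, c₀ * a ≤ T a ω := by
    filter_upwards [hb] with a h ω
    have : n₁ a ≤ T a ω := le_stopRule h.2.2.1.le
    exact h.1.trans (by exact_mod_cast this)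
  have hroot : ∀ᶠ a in atTop, ∀ n : ℕ, c₀ * a ≤ n → |√(a / n) - c a| ≤ √c₀⁻¹ + (|k| + 1) := by
    filter_upwards [hc.abs.eventually (gt_mem_nhds (lt_add_one |k|)), eventually_gt_atTop 0]
      with a h1 ha n hn
    have hn0 : (0 : ℝ) < n := lt_of_lt_of_le (by positivity) hn
    have h2 : √(a / n) ≤ √c₀⁻¹ := by
      refine Real.sqrt_le_sqrt ?_
      rw [le_inv_comm₀ (by positivity) hc₀, inv_div, le_div_iff₀ ha]
      exact hn
    refine (abs_sub _ _).trans (add_le_add ?_ h1.le)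
    rwa [abs_of_nonneg (Real.sqrt_nonneg _)]
  have hmain := fun L : EuclideanSpace ℝ (Fin d) →L[ℝ] ℝ =>
    tendsto_correction (T := T) (φ := fun a ω => √(a / T a ω) - c a) (B := B)
      (c := fun a => √(a / n₁ a) - c a) (M := √c₀⁻¹ + (|k| + 1)) hr hW hZ hWm hTm hc₀ hTlow L D
      (fun a => (((hTr a).const_div a).sqrt).sub_const _)
      (by filter_upwards [hroot, hTlow] with a h1 h2 ω using h1 _ (h2 ω)) hBm hB
      (by
        filter_upwards [hBT] with a h ω hω
        rw [h ω hω])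
      (by filter_upwards [hroot, hb] with a h1 h2 using h1 _ h2.1)
      (by
        refine (hLB L).congr' ?_
        filter_upwards [hBT] with a h
        congr 1
        ext ω
        by_cases hω : ω ∈ B a
        · simp only [Set.indicator_of_mem hω, h ω hω]
          rfl
        · simp only [Set.indicator_of_notMem hω])
      hK
      (by
        intro η hη
        obtain ⟨δ, hδ, hδG⟩ := hG η hη
        obtain ⟨G, K', hGm, hGP, hGc⟩ := exists_close_event hξ hr hc₀ hc₁
          (hb.mono fun a h => h.1) (hb.mono fun a h => h.2.1) hδ
        refine ⟨G, K', hGm, hGP, ?_⟩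
        filter_upwards [hδG] with a h ω hωG hωB
        exact h ω (hGc a ω hωG) hωB)
  -- The L¹ convergence does not involve L, so it is taken from the instance L = 0.
  exact ⟨c, hc, (hmain 0).1, fun L => (hmain L).2⟩

/-- If the mean at n₁ is close to m, the boundary is already reached there. Then T = n₁ exactly, B
can be empty and the error is zero. -/
theorem hasRootExpansion_of_gt (hξ : IsCenteredIID (fun i ω => X i ω - m) P r) (hr : 2 < r)
    (hg : Measurable g) (hgc : ContinuousAt g m) (hε₀ : 0 < ε₀) (hε : ε₀ < ε₁)
    (hn₀ : Tendsto (fun a => (n₀ a : ℝ) / a) atTop (𝓝 ε₀⁻¹))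
    (hn₁ : Tendsto (fun a => (n₁ a : ℝ) / a) atTop (𝓝 ε₁⁻¹)) (hgm : ε₁ < g m) :
    HasRootExpansion X m P (stopRule X g n₀ n₁) (√ε₁) 0 := by
  have hε₁ : 0 < ε₁ := hε₀.trans hε
  obtain ⟨c₀, c₁, hc₀, hc₁, hb⟩ := eventually_bounds hε₀ hε hn₀ hn₁
  obtain ⟨β, hβ1, hβ2⟩ := exists_between hgm
  obtain ⟨δ, hδ, hδg⟩ := Metric.eventually_nhds_iff_ball.1 (hgc.eventually (lt_mem_nhds hβ2))
  refine hasRootExpansion_of_path hξ hr hg hε₀ hε hn₀ hn₁ 0 (tendsto_sqrt_div hε₁ hn₁)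
    (B := fun _ => ∅) (fun _ => MeasurableSet.empty) (by simp) (by simp) (by simp)
    (K := 0) le_rfl fun η hη => ⟨δ / 2, by linarith, ?_⟩
  filter_upwards [eventually_lt_sub_one_mul hε₁ hβ1 hn₁, hb] with a h1 h2 ω hω _
  have hx := hω (n₁ a) h2.2.2.2 le_rfl h2.2.2.1.le
  have hgx := hδg _ (by rw [mem_ball_iff_norm]; linarith)
  have hcross : ¬ NotCrossed X g a (n₁ a) ω := by
    intro hc
    have h3 := hc (n₁ a) h2.2.2.2 le_rfl
    have hn : (0 : ℝ) < n₁ a := by exact_mod_cast h2.2.2.2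
    nlinarith
  rw [stopRule_eq_of_not_notCrossed h2.2.2.1.le hcross]
  simp

/-- Without an early crossing, sample means close to m never reach the boundary between n₁ and n₀,
so T = n₀ and the error is zero. -/
theorem hasRootExpansion_of_lt (hξ : IsCenteredIID (fun i ω => X i ω - m) P r) (hr : 2 < r)
    (hX : ∀ i, Measurable (X i))
    (hg : Measurable g) (hgc : ContinuousAt g m) (hε₀ : 0 < ε₀) (hε : ε₀ < ε₁)
    (hn₀ : Tendsto (fun a => (n₀ a : ℝ) / a) atTop (𝓝 ε₀⁻¹))
    (hn₁ : Tendsto (fun a => (n₁ a : ℝ) / a) atTop (𝓝 ε₁⁻¹)) (hgm : g m < ε₀) :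
    HasRootExpansion X m P (stopRule X g n₀ n₁) (√ε₀) 0 := by
  obtain ⟨c₀, c₁, hc₀, hc₁, hb⟩ := eventually_bounds hε₀ hε hn₀ hn₁
  -- Since g(m) may be negative, β is taken above 0 as well.
  obtain ⟨β, hβ1, hβ2⟩ := exists_between (max_lt hgm hε₀)
  have hβ : 0 < β := (le_max_right _ _).trans_lt hβ1
  obtain ⟨δ, hδ, hδg⟩ := Metric.eventually_nhds_iff_ball.1
    (hgc.eventually (gt_mem_nhds ((le_max_left _ _).trans_lt hβ1)))
  have hgβ : ∀ x, ‖x - m‖ ≤ δ / 2 → g x ≤ β := fun x hx =>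
    (hδg x (by rw [mem_ball_iff_norm]; linarith)).le
  have hcr := tendsto_early_crossing hξ hr hX hg (by linarith : 0 < δ / 2) hβ hgβ
    (eventually_mul_lt_of_lt hβ (hβ2.trans hε) hn₁)
  refine hasRootExpansion_of_path hξ hr hg hε₀ hε hn₀ hn₁ 0 (tendsto_sqrt_div hε₀ hn₀)
    (B := fun a => {ω | ¬ NotCrossed X g a (n₁ a) ω})
    (fun a => (hξ.past_le _ _ (measurableSet_past_notCrossed hg (n₁ a))).compl) (hcr 0).1
    (hb.mono fun a h ω hω => stopRule_eq_of_not_notCrossed h.2.2.1.le hω) (fun L => (hcr L).2)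
    (K := 0) le_rfl fun η hη => ⟨δ / 2, by linarith, ?_⟩
  filter_upwards [eventually_mul_lt_of_lt hβ hβ2 hn₀, hb] with a h1 h2 ω hω hωB
  have hnc : NotCrossed X g a (n₁ a) ω := by simpa using hωB
  have hT : stopRule X g n₀ n₁ a ω = n₀ a := by
    refine le_antisymm stopRule_le (not_lt.1 fun hlt => ?_)
    have hgt : n₁ a < stopRule X g n₀ n₁ a ω := lt_stopRule_iff.2 ⟨h2.2.2.1, Or.inr hnc⟩
    have h3 := le_mul_of_stopRule_lt hgt hlt
    have hx := hω (stopRule X g n₀ n₁ a ω) (by omega) hgt.le hlt.le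
    have h4 := hgβ _ hx
    have h5 : (stopRule X g n₀ n₁ a ω : ℝ) ≤ n₀ a := by exact_mod_cast hlt.le
    have h6 : (stopRule X g n₀ n₁ a ω : ℝ) * g (sampleMean X (stopRule X g n₀ n₁ a ω) ω) ≤
        (stopRule X g n₀ n₁ a ω : ℝ) * β := by gcongr
    have h7 : (stopRule X g n₀ n₁ a ω : ℝ) * β ≤ n₀ a * β := by gcongr
    linarith
  rw [hT]
  simp

/-- Comparison of `√(a / t)` with its linearization at a time `t` of first passage. -/
theorem abs_root_sub_le {E : Type*} [NormedAddCommGroup E] [NormedSpace ℝ E] {D : E →L[ℝ] ℝ}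
    {a t k γ γ' η c₀ : ℝ} {w z : E} (ha : 0 < a) (hc₀ : 0 < c₀) (hη : 0 < η) (hη1 : η ≤ 1)
    (ht : c₀ * a ≤ t - 1)
    (h1 : a ≤ t * γ) (h2 : (t - 1) * γ' < a)
    (hγ : |√γ - k - D (t⁻¹ • w)| ≤ η * ‖t⁻¹ • w‖)
    (hγ' : |√γ' - k - D ((t - 1)⁻¹ • (w - z))| ≤ η * ‖(t - 1)⁻¹ • (w - z)‖)
    (hx' : ‖(t - 1)⁻¹ • (w - z)‖ ≤ 1) :
    |(√(a / t) - k) - D w / t| ≤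
      (1 + √c₀⁻¹ + ‖D‖) / c₀ / a * (η * ‖w‖ + 1 + ‖z‖) := by
  have hca : 0 < c₀ * a := by positivity
  have ht1 : 0 < t - 1 := hca.trans_le ht
  have ht0 : 0 < t := by linarith
  have hta : c₀ * a ≤ t := by linarith
  have eD : D (t⁻¹ • w) = D w / t := by rw [map_smul, smul_eq_mul, inv_mul_eq_div]
  rw [eD] at hγ
  have hw0 := norm_nonneg w
  have hz0 := norm_nonneg z
  have hinv : t⁻¹ ≤ (c₀ * a)⁻¹ := inv_anti₀ hca hta
  have hinv1 : (t - 1)⁻¹ ≤ (c₀ * a)⁻¹ := inv_anti₀ hca ht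
  have hn1 : ‖t⁻¹ • w‖ ≤ (c₀ * a)⁻¹ * ‖w‖ := by
    rw [norm_smul, norm_inv, Real.norm_of_nonneg ht0.le]; gcongr
  have hn2 : ‖(t - 1)⁻¹ • (w - z)‖ ≤ (c₀ * a)⁻¹ * (‖w‖ + ‖z‖) := by
    rw [norm_smul, norm_inv, Real.norm_of_nonneg ht1.le]
    gcongr
    exact norm_sub_le _ _
  have eR : (1 + √c₀⁻¹ + ‖D‖) / c₀ / a * (η * ‖w‖ + 1 + ‖z‖) =
      (c₀ * a)⁻¹ * ((1 + √c₀⁻¹ + ‖D‖) * (η * ‖w‖ + 1 + ‖z‖)) := by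
    rw [mul_inv]; field_simp
  rw [eR]
  set i := (c₀ * a)⁻¹ with hi
  have hi0 : 0 < i := inv_pos.2 hca
  have hD0 := norm_nonneg D
  have hs0 : 0 ≤ √c₀⁻¹ := Real.sqrt_nonneg _
  have hηw : 0 ≤ η * ‖w‖ := by positivity
  have hηz : η * ‖z‖ ≤ ‖z‖ := by nlinarith
  have hexp : (1 + √c₀⁻¹ + ‖D‖) * (η * ‖w‖ + 1 + ‖z‖) ≥
      η * ‖w‖ + ‖z‖ + √c₀⁻¹ + ‖D‖ * (1 + ‖z‖) := by
    have : 0 ≤ (√c₀⁻¹ + ‖D‖) * (η * ‖w‖) := by positivity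
    have : 0 ≤ √c₀⁻¹ * ‖z‖ := by positivity
    nlinarith
  have hexp' := mul_le_mul_of_nonneg_left hexp hi0.le
  -- Here γ and γ' play the values of g at the times t and t − 1. Reaching the boundary at t bounds
  -- √(a/t) above by √γ; missing it at t − 1 bounds √(a/(t − 1)) below by √γ'.
  rw [abs_le]
  constructor
  · -- the lower bound comes from the time before
    set y := (t - 1)⁻¹ • (w - z) with hy
    have hlow : √γ' ≤ √(a / (t - 1)) := by
      refine Real.sqrt_le_sqrt ?_
      rw [le_div_iff₀ ht1]; linarith
    have hA : √(a / (t - 1)) ≤ √c₀⁻¹ := by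
      refine Real.sqrt_le_sqrt ?_
      rw [le_inv_comm₀ (by positivity) hc₀, inv_div, le_div_iff₀ ha]
      exact ht
    -- The change of denominator costs O(1/a), since √x ≥ x on [0, 1] at x = (t − 1)/t.
    have hq : √(a / t) ≥ √(a / (t - 1)) - √c₀⁻¹ * i := by
      have e : a / t = a / (t - 1) * ((t - 1) / t) := by field_simp
      rw [e, Real.sqrt_mul (by positivity)]
      have h3 : (t - 1) / t ≤ √((t - 1) / t) := by
        refine Real.le_sqrt_of_sq_le ?_
        have h4 : (t - 1) / t ≤ 1 := by rw [div_le_one ht0]; linarith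
        have h5 : 0 ≤ (t - 1) / t := by positivity
        nlinarith
      have h6 : (t - 1) / t = 1 - t⁻¹ := by field_simp
      have h7 : √(a / (t - 1)) * t⁻¹ ≤ √c₀⁻¹ * i := by gcongr
      have h8 := mul_le_mul_of_nonneg_left h3 (Real.sqrt_nonneg (a / (t - 1)))
      have h9 : √(a / (t - 1)) * ((t - 1) / t) = √(a / (t - 1)) - √(a / (t - 1)) * t⁻¹ := by
        rw [h6]; ring
      linarith
    have hγl := (abs_le.1 hγ').1
    -- With w = (t − 1) y + z one has y − w/t = (y − z)/t, and ‖y‖ ≤ 1 by assumption.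
    have hDy : D y - D w / t ≥ -(‖D‖ * (1 + ‖z‖) * i) := by
      have e : D y - D w / t = t⁻¹ * D (y - z) := by
        have : w = (t - 1) • y + z := by
          rw [hy, smul_smul, mul_inv_cancel₀ ht1.ne', one_smul, sub_add_cancel]
        rw [this]
        simp only [map_add, map_smul, map_sub, smul_eq_mul]
        field_simp
        ring
      rw [e]
      have h3 : |D (y - z)| ≤ ‖D‖ * (1 + ‖z‖) := by
        refine (D.le_opNorm _).trans ?_
        gcongr
        exact (norm_sub_le _ _).trans (by linarith)
      have h4 := (abs_le.1 h3).1
      have h5 : t⁻¹ * (-(‖D‖ * (1 + ‖z‖))) ≤ t⁻¹ * D (y - z) :=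
        mul_le_mul_of_nonneg_left h4 (by positivity)
      have h6 : t⁻¹ * (‖D‖ * (1 + ‖z‖)) ≤ i * (‖D‖ * (1 + ‖z‖)) := by gcongr
      linarith
    have hηy : η * ‖y‖ ≤ i * (η * ‖w‖ + ‖z‖) := by
      calc η * ‖y‖ ≤ η * (i * (‖w‖ + ‖z‖)) := by gcongr
        _ = i * (η * ‖w‖ + η * ‖z‖) := by ring
        _ ≤ _ := by gcongr
    linarith
  · have hup : √(a / t) ≤ √γ := by
      refine Real.sqrt_le_sqrt ?_
      rw [div_le_iff₀ ht0]; linarith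
    have hγu := (abs_le.1 hγ).2
    have hηx : η * ‖t⁻¹ • w‖ ≤ i * (η * ‖w‖) := by
      calc η * ‖t⁻¹ • w‖ ≤ η * (i * ‖w‖) := by gcongr
        _ = _ := by ring
    have : 0 ≤ i * (‖z‖ + √c₀⁻¹ + ‖D‖ * (1 + ‖z‖)) := by positivity
    linarith

/-- Off the early crossings T lies strictly between n₁ and n₀. Both T − 1 and T are then in the
range where the sample means are close to m, and `abs_root_sub_le` compares them. -/
theorem hasRootExpansion_of_mem (hξ : IsCenteredIID (fun i ω => X i ω - m) P r) (hr : 2 < r)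
    (hX : ∀ i, Measurable (X i))
    (hg : Measurable g) (hgc : ContinuousAt g m) (hε₀ : 0 < ε₀) (hε : ε₀ < ε₁)
    (hn₀ : Tendsto (fun a => (n₀ a : ℝ) / a) atTop (𝓝 ε₀⁻¹))
    (hn₁ : Tendsto (fun a => (n₁ a : ℝ) / a) atTop (𝓝 ε₁⁻¹)) (hgm₀ : ε₀ < g m) (hgm₁ : g m < ε₁)
    {D : EuclideanSpace ℝ (Fin d) →L[ℝ] ℝ} (hD : HasFDerivAt (fun x => √(g x)) D m) :
    HasRootExpansion X m P (stopRule X g n₀ n₁) (√(g m)) D := by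
  obtain ⟨c₀, c₁, hc₀, hc₁, hb⟩ := eventually_bounds hε₀ hε hn₀ hn₁
  obtain ⟨β, hβ1, hβ2⟩ := exists_between hgm₁
  obtain ⟨α, hα1, hα2⟩ := exists_between hgm₀
  have hβ : 0 < β := hε₀.trans (hgm₀.trans hβ1)
  obtain ⟨δ, hδ, hδg⟩ := Metric.eventually_nhds_iff_ball.1
    ((hgc.eventually (gt_mem_nhds hβ1)).and (hgc.eventually (lt_mem_nhds hα2)))
  have hgβ : ∀ x, ‖x - m‖ ≤ δ / 2 → g x ≤ β := fun x hx =>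
    (hδg x (by rw [mem_ball_iff_norm]; linarith)).1.le
  have hcr := tendsto_early_crossing hξ hr hX hg (by linarith : 0 < δ / 2) hβ hgβ
    (eventually_mul_lt_of_lt hβ hβ2 hn₁)
  refine hasRootExpansion_of_path hξ hr hg hε₀ hε hn₀ hn₁ D tendsto_const_nhds
    (B := fun a => {ω | ¬ NotCrossed X g a (n₁ a) ω})
    (fun a => (hξ.past_le _ _ (measurableSet_past_notCrossed hg (n₁ a))).compl) (hcr 0).1
    (hb.mono fun a h ω hω => stopRule_eq_of_not_notCrossed h.2.2.1.le hω) (fun L => (hcr L).2)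
    (K := (1 + √c₀⁻¹ + ‖D‖) / c₀) (by positivity) fun η hη => ?_
  have hη' : 0 < min η 1 := lt_min hη one_pos
  obtain ⟨δ', hδ', hδD⟩ := Metric.eventually_nhds_iff_ball.1 (hD.isLittleO.def hη')
  -- The 1 bounds the mean at T − 1 as `abs_root_sub_le` requires, δ keeps g between α and β, and δ'
  -- is the radius of linearization of √g.
  refine ⟨min 1 (min (δ / 2) (δ' / 2)), by positivity, ?_⟩
  filter_upwards [eventually_lt_sub_one_mul hε₀ hα1 hn₀, hb, eventually_gt_atTop 0]
    with a h1 h2 ha ω hω hωB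
  have hnc : NotCrossed X g a (n₁ a) ω := by simpa using hωB
  obtain ⟨hb1, hb2, hb3, hb4⟩ := h2
  have hgt : n₁ a < stopRule X g n₀ n₁ a ω := lt_stopRule_iff.2 ⟨hb3, Or.inr hnc⟩
  have hle : stopRule X g n₀ n₁ a ω ≤ n₀ a := stopRule_le
  -- Stopping at n₀ would mean no crossing at n₀ − 1, where g > α > ε₀ already puts (n₀ − 1) g above
  -- a.
  have hlt : stopRule X g n₀ n₁ a ω < n₀ a := by
    refine lt_of_le_of_ne hle fun heq => ?_
    have h3 : NotCrossed X g a (n₀ a - 1) ω :=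
      notCrossed_of_lt_stopRule (n₀ := n₀) (n₁ := n₁) (by omega) (by omega)
    have h4 := h3 (n₀ a - 1) (by omega) le_rfl
    have hx := hω (n₀ a - 1) (by omega) (by omega) (by omega)
    have h5 := (hδg _ (by
      rw [mem_ball_iff_norm]
      have := hx.trans ((min_le_right _ _).trans (min_le_left _ _))
      linarith)).2
    have hpos : (0 : ℝ) < n₀ a - 1 := by
      have : (1 : ℝ) < n₀ a := by exact_mod_cast (by omega : 1 < n₀ a)
      linarith
    rw [Nat.cast_sub (by omega), Nat.cast_one] at h4
    nlinarith
  have hreach := le_mul_of_stopRule_lt hgt hlt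
  have hbefore : NotCrossed X g a (stopRule X g n₀ n₁ a ω - 1) ω :=
    notCrossed_of_lt_stopRule (n₀ := n₀) (n₁ := n₁) (by omega) (by omega)
  have hlast : lastStep X m (stopRule X g n₀ n₁ a) ω =
      X (stopRule X g n₀ n₁ a ω - 1) ω - m := by
    unfold lastStep
    rw [Set.indicator_of_mem]
    exact (Nat.zero_le _).trans_lt hgt
  rw [hlast]
  set T := stopRule X g n₀ n₁ a ω with hT
  have hbef := hbefore (T - 1) (by omega) le_rfl
  have hlin : ∀ k, 1 ≤ k → n₁ a ≤ k → k ≤ n₀ a →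
      |√(g (sampleMean X k ω)) - √(g m) - D ((k : ℝ)⁻¹ • psum (fun i ω => X i ω - m) k ω)| ≤
        min η 1 * ‖(k : ℝ)⁻¹ • psum (fun i ω => X i ω - m) k ω‖ := by
    intro k hk1 hk2 hk3
    have hx := (hω k hk1 hk2 hk3).trans ((min_le_right _ _).trans (min_le_right _ _))
    have := hδD (sampleMean X k ω) (by rw [mem_ball_iff_norm]; linarith)
    rwa [Real.norm_eq_abs, psum_sub_eq hk1] at this
  have hγ := hlin T (by omega) hgt.le hle
  have hγ' := hlin (T - 1) (by omega) (by omega) (by omega)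
  have hx' := (hω (T - 1) (by omega) (by omega) (by omega)).trans (min_le_left _ _)
  have hps : psum (fun i ω => X i ω - m) (T - 1) ω =
      psum (fun i ω => X i ω - m) T ω - (X (T - 1) ω - m) := by
    obtain ⟨n, hn⟩ : ∃ n, T = n + 1 := ⟨T - 1, by omega⟩
    rw [hn, Nat.add_sub_cancel]
    unfold psum
    rw [Finset.sum_range_succ, add_sub_cancel_right]
  rw [psum_sub_eq (by omega)] at hx'
  rw [hps] at hγ' hx'
  have hT1 : ((T - 1 : ℕ) : ℝ) = T - 1 := by rw [Nat.cast_sub (by omega), Nat.cast_one]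
  rw [hT1] at hγ' hx' hbef
  have hcT : c₀ * a ≤ T - 1 := by
    have : (n₁ a : ℝ) ≤ ((T - 1 : ℕ) : ℝ) := by exact_mod_cast (by omega : n₁ a ≤ T - 1)
    rw [hT1] at this
    linarith
  refine (abs_root_sub_le ha hc₀ hη' (min_le_right _ _) hcT hreach hbef hγ hγ' hx').trans ?_
  have : 0 ≤ (1 + √c₀⁻¹ + ‖D‖) / c₀ / a := by positivity
  gcongr
  exact min_le_left _ _

end Cases

end SeqBias

/-! ### Assembly: κ, the centered sequence and the stopping rule -/

namespace SeqBias

section Bias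

variable {d : ℕ} {Ω : Type*} [MeasurableSpace Ω] {X : ℕ → Ω → EuclideanSpace ℝ (Fin d)}
  {m : EuclideanSpace ℝ (Fin d)} {P : Measure Ω} [IsProbabilityMeasure P] {r : ℝ}
  {g : EuclideanSpace ℝ (Fin d) → ℝ} {n₀ n₁ : ℝ → ℕ} {ε₀ ε₁ : ℝ}

theorem kappa_pos (hε₀ : 0 < ε₀) (x : EuclideanSpace ℝ (Fin d)) : 0 < kappa g ε₀ ε₁ x :=
  hε₀.trans_le (le_max_left _ _)

/-- Away from the corner points of `κ`, its square root is differentiable and it is the first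
order term in the expansion of the stopping rule. -/
theorem hasRootExpansion_kappa (hξ : IsCenteredIID (fun i ω => X i ω - m) P r) (hr : 3 < r)
    (hX : ∀ i, Measurable (X i)) (hgm : Measurable g) (hg : ContDiffAt ℝ 1 g m)
    (hε₀ : 0 < ε₀) (hε : ε₀ < ε₁) (hgε₀ : g m ≠ ε₀) (hgε₁ : g m ≠ ε₁)
    (hn₀ : Tendsto (fun a => (n₀ a : ℝ) / a) atTop (𝓝 ε₀⁻¹))
    (hn₁ : Tendsto (fun a => (n₁ a : ℝ) / a) atTop (𝓝 ε₁⁻¹)) :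
    ∃ D, HasFDerivAt (fun x => √(kappa g ε₀ ε₁ x)) D m ∧
      HasRootExpansion X m P (stopRule X g n₀ n₁) (√(kappa g ε₀ ε₁ m)) D := by
  have hgc : ContinuousAt g m := hg.continuousAt
  have hr2 : 2 < r := by linarith
  rcases lt_or_gt_of_ne hgε₀ with h0 | h0
  · have hκ : ∀ᶠ x in 𝓝 m, kappa g ε₀ ε₁ x = ε₀ :=
      (hgc.eventually (gt_mem_nhds h0)).mono fun x hx =>
        max_eq_left ((min_le_left _ _).trans hx.le)
    refine ⟨0, (hasFDerivAt_const (√ε₀) m).congr_of_eventuallyEq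
      (hκ.mono fun x hx => congrArg _ hx), ?_⟩
    rw [hκ.self_of_nhds]
    exact hasRootExpansion_of_lt hξ hr2 hX hgm hgc hε₀ hε hn₀ hn₁ h0
  rcases lt_or_gt_of_ne hgε₁ with h1 | h1
  · have hκ : ∀ᶠ x in 𝓝 m, kappa g ε₀ ε₁ x = g x :=
      ((hgc.eventually (lt_mem_nhds h0)).and (hgc.eventually (gt_mem_nhds h1))).mono
        fun x hx => by
          rw [kappa, min_eq_left hx.2.le, max_eq_right hx.1.le]
    have hD : HasFDerivAt (fun x => √(g x)) (fderiv ℝ (fun x => √(g x)) m) m :=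
      ((hg.differentiableAt one_ne_zero).sqrt (hε₀.trans h0).ne').hasFDerivAt
    refine ⟨_, hD.congr_of_eventuallyEq (hκ.mono fun x hx => congrArg _ hx), ?_⟩
    rw [hκ.self_of_nhds]
    exact hasRootExpansion_of_mem hξ hr2 hX hgm hgc hε₀ hε hn₀ hn₁ h0 h1 hD
  · have hκ : ∀ᶠ x in 𝓝 m, kappa g ε₀ ε₁ x = ε₁ :=
      (hgc.eventually (lt_mem_nhds h1)).mono fun x hx => by
        rw [kappa, min_eq_right (le_of_lt hx), max_eq_right hε.le]
    refine ⟨0, (hasFDerivAt_const (√ε₁) m).congr_of_eventuallyEq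
      (hκ.mono fun x hx => congrArg _ hx), ?_⟩
    rw [hκ.self_of_nhds]
    exact hasRootExpansion_of_gt hξ hr2 hgm hgc hε₀ hε hn₀ hn₁ h1

theorem isCenteredIID_sub_mean (hX : ∀ i, Measurable (X i)) (hXi : iIndepFun X P)
    (hXd : ∀ i, IdentDistrib (X i) (X 0) P P) (hX0 : MemLp (X 0) (ENNReal.ofReal r) P)
    (hr : 1 ≤ r) (hm : m = ∫ ω, X 0 ω ∂P) : IsCenteredIID (fun i ω => X i ω - m) P r := by
  have hsub : Measurable fun x : EuclideanSpace ℝ (Fin d) => x - m := measurable_id.sub_const m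
  have hr1 : (1 : ENNReal) ≤ ENNReal.ofReal r := by simpa using ENNReal.ofReal_le_ofReal hr
  refine ⟨fun i => (hX i).sub_const m, hXi.comp (fun _ x => x - m) fun _ => hsub,
    fun i => (hXd i).comp hsub, ?_, ?_⟩
  · have h := (hX0.sub (memLp_const m)).integrable_norm_rpow
      (by simp; linarith) ENNReal.ofReal_ne_top
    rw [ENNReal.toReal_ofReal (by linarith)] at h
    exact h
  · rw [integral_sub (hX0.integrable hr1) (integrable_const m), ← hm]
    simp

/-- The normalised estimation error at the stopping rule is eventually integrable, and its
expectation has the stated limit. -/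
theorem tendsto_sqrt_mul_integral_stopRule (hξ : IsCenteredIID (fun i ω => X i ω - m) P r)
    (hr : 2 < r) (hX : ∀ i, Measurable (X i)) (hgm : Measurable g) (hε₀ : 0 < ε₀) (hε : ε₀ < ε₁)
    (hn₀ : Tendsto (fun a => (n₀ a : ℝ) / a) atTop (𝓝 ε₀⁻¹))
    (hn₁ : Tendsto (fun a => (n₁ a : ℝ) / a) atTop (𝓝 ε₁⁻¹))
    {k : ℝ} (hk : 0 < k) {D : EuclideanSpace ℝ (Fin d) →L[ℝ] ℝ}
    (hT : HasRootExpansion X m P (stopRule X g n₀ n₁) k D)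
    {h : EuclideanSpace ℝ (Fin d) → ℝ} (hhm : Measurable h) (hh : ContDiffAt ℝ 2 h m)
    {C : ℝ} (hC : ∀ᶠ n : ℕ in atTop, ∀ᵐ ω ∂P,
      |h (sampleMean X n ω)| ≤ C * (1 + ‖sampleMean X n ω‖ ^ r)) :
    (∀ᶠ a in atTop, Integrable (fun ω => √(stopRule X g n₀ n₁ a ω : ℝ) *
      (h (sampleMean X (stopRule X g n₀ n₁ a ω) ω) - h m)) P) ∧
    Tendsto (fun a => √a * ∫ ω, √(stopRule X g n₀ n₁ a ω : ℝ) *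
      (h (sampleMean X (stopRule X g n₀ n₁ a ω) ω) - h m) ∂P) atTop
      (𝓝 (∫ ω, (fderiv ℝ h m).smulRight D (X 0 ω - m) (X 0 ω - m) ∂P +
        k * ∫ ω, ((1 / 2 : ℝ) • fderiv ℝ (fderiv ℝ h) m) (X 0 ω - m) (X 0 ω - m) ∂P)) := by
  obtain ⟨c₀, c₁, hc₀, hc₁, hb⟩ := eventually_bounds hε₀ hε hn₀ hn₁
  obtain ⟨c, hc, hφ, hLφ⟩ := hT
  have hS : ∀ a, IsBoundedStop (fun i ω => X i ω - m) (stopRule X g n₀ n₁ a) (n₀ a) :=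
    isBoundedStop_stopRule hgm n₀ n₁
  obtain ⟨K, hW⟩ := hasMomentScale_psum hξ hr hS (hb.mono fun a h => h.2.1)
  have hmean : ∀ n, Measurable fun ω => sampleMean X n ω := fun n =>
    Measurable.const_smul (g := fun ω => ∑ i ∈ Finset.range n, X i ω)
      (Finset.measurable_fun_sum _ fun i _ => hX i) ((n : ℝ)⁻¹)
  refine tendsto_sqrt_mul_integral hr hW
    (fun a => (hS a).measurable_comp hξ fun n =>
      Finset.measurable_fun_sum _ fun i _ => hξ.measurable i)
    (fun a => (hS a).measurable hξ) hc₀ (c₁ := c₁) ?_ (fderiv ℝ h m) D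
    ((1 / 2 : ℝ) • fderiv ℝ (fderiv ℝ h) m)
    (fun b => ∫ ω, b (X 0 ω - m) (X 0 ω - m) ∂P) hk
    (fun a => (hS a).integral_psum hξ (by linarith) _)
    (fun a b => (hS a).integral_bilin_psum hξ hr.le b) hc hφ (hLφ _)
    (fun a => (hS a).measurable_comp hξ fun n => (hhm.comp (hmean n)).sub_const _) ?_
  · filter_upwards [hb] with a ha ω
    exact ⟨ha.1.trans (Nat.cast_le.2 (le_stopRule ha.2.2.1.le)),
      (Nat.cast_le.2 stopRule_le).trans ha.2.1⟩
  · intro η hη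
    obtain ⟨Cη, hCη, hrem⟩ := exists_remainder_le hh (C := C) hr.le hη
    obtain ⟨N, hN⟩ := eventually_atTop.1 hC
    refine ⟨Cη, hCη, ?_⟩
    filter_upwards [hb, eventually_ge_atTop ((N : ℝ) / c₀)] with a ha haN
    -- The growth bound holds almost surely for each n separately. Countability makes it
    -- simultaneous, so it can be used at the random time T ≥ n₁ ≥ N.
    have hall : ∀ᵐ ω ∂P, ∀ n, N ≤ n →
        |h (sampleMean X n ω)| ≤ C * (1 + ‖sampleMean X n ω‖ ^ r) :=
      ae_all_iff.2 fun n => by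
        by_cases hn : N ≤ n
        · filter_upwards [hN n hn] with ω hω _ using hω
        · exact ae_of_all _ fun ω h => absurd h hn
    filter_upwards [hall] with ω hω
    have hle : n₁ a ≤ stopRule X g n₀ n₁ a ω := le_stopRule ha.2.2.1.le
    have hNn : N ≤ n₁ a := by
      rw [div_le_iff₀' hc₀] at haN
      exact_mod_cast haN.trans ha.1
    have hx := psum_sub_eq (X := X) (m := m) (ω := ω) (ha.2.2.2.trans hle)
    rw [← hx]
    have := hrem (sampleMean X (stopRule X g n₀ n₁ a ω) ω - m)
    rw [add_sub_cancel] at this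
    exact this (hω _ (hNn.trans hle))

end Bias

theorem isLittleO_sub_of_tendsto_sqrt_mul {I : ℝ → ℝ} {b k : ℝ}
    (hI : Tendsto (fun a => √a * I a) atTop (𝓝 (b * √k))) (hk : 0 ≤ k) :
    (fun a => I a - b * √(k / a)) =o[atTop] fun a : ℝ => a ^ (-(1 / 2) : ℝ) := by
  refine (isLittleO_iff_tendsto' ?_).2 ?_
  · filter_upwards [eventually_gt_atTop 0] with a ha h
    exact absurd h (Real.rpow_pos_of_pos ha _).ne'
  · have h0 : Tendsto (fun a => √a * I a - b * √k) atTop (𝓝 0) := by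
      simpa using hI.sub_const (b * √k)
    refine h0.congr' ?_
    filter_upwards [eventually_gt_atTop 0] with a ha
    have hs : √a ≠ 0 := (Real.sqrt_pos.2 ha).ne'
    rw [Real.rpow_neg ha.le, ← Real.sqrt_eq_rpow, Real.sqrt_div hk]
    field_simp

end SeqBias

theorem mainTheorem1 {Ω : Type*} [MeasurableSpace Ω] (P : Measure Ω) [IsProbabilityMeasure P]
    (d : ℕ) (X : ℕ → Ω → EuclideanSpace ℝ (Fin d))
    (hXmeas : ∀ i, Measurable (X i))
    (hXindep : iIndepFun X P)
    (hXident : ∀ i, IdentDistrib (X i) (X 0) P P)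
    (r : ℝ) (hr : 3 < r)
    (hXmom : Integrable (fun ω => ‖X 0 ω‖ ^ r) P)
    (m : EuclideanSpace ℝ (Fin d)) (hm : m = ∫ ω, X 0 ω ∂P)
    (V : Matrix (Fin d) (Fin d) ℝ) (hV : V = SeqBias.covMatrix (X 0) P)
    (h : EuclideanSpace ℝ (Fin d) → ℝ) (hhmeas : Measurable h) (hh : ContDiffAt ℝ 2 h m)
    (hhgrowth : ∃ C : ℝ, ∀ᶠ n : ℕ in atTop, ∀ᵐ ω ∂P,
      |h (SeqBias.sampleMean X n ω)| ≤ C * (1 + ‖SeqBias.sampleMean X n ω‖ ^ r))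
    (g : EuclideanSpace ℝ (Fin d) → ℝ) (hgmeas : Measurable g) (hg : ContDiffAt ℝ 1 g m)
    (ε₀ ε₁ : ℝ) (hε₀ : 0 < ε₀) (hε : ε₀ < ε₁)
    (hgε₀ : g m ≠ ε₀) (hgε₁ : g m ≠ ε₁)
    (n₀ n₁ : ℝ → ℕ)
    (hn₀ : (fun a => (n₀ a : ℝ)) ~[atTop] (fun a => a / ε₀))
    (hn₁ : (fun a => (n₁ a : ℝ)) ~[atTop] (fun a => a / ε₁)) :
    DifferentiableAt ℝ (fun x => √(SeqBias.kappa g ε₀ ε₁ x)) m ∧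
    (∀ᶠ a : ℝ in atTop, Integrable (fun ω =>
      √(SeqBias.stopRule X g n₀ n₁ a ω : ℝ) *
        (h (SeqBias.sampleMean X (SeqBias.stopRule X g n₀ n₁ a ω) ω) - h m)) P) ∧
    (fun a : ℝ =>
      (∫ ω, √(SeqBias.stopRule X g n₀ n₁ a ω : ℝ) *
        (h (SeqBias.sampleMean X (SeqBias.stopRule X g n₀ n₁ a ω) ω) - h m) ∂P)
      - SeqBias.biasCoeff (SeqBias.kappa g ε₀ ε₁) h m V * √(SeqBias.kappa g ε₀ ε₁ m / a))
      =o[atTop] (fun a : ℝ => a ^ (-(1 / 2) : ℝ)) := by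
  have hr0 : 0 < r := by linarith
  have hX0 : MemLp (X 0) (ENNReal.ofReal r) P := by
    rw [← integrable_norm_rpow_iff (hXmeas 0).aestronglyMeasurable (by simpa using hr0)
      ENNReal.ofReal_ne_top, ENNReal.toReal_ofReal hr0.le]
    exact hXmom
  have hX2 : MemLp (X 0) 2 P := hX0.mono_exponent (by
    rw [← ENNReal.ofReal_ofNat 2]
    exact ENNReal.ofReal_le_ofReal (by linarith))
  have hξ := SeqBias.isCenteredIID_sub_mean hXmeas hXindep hXident hX0 (by linarith) hm
  have hn₀' := SeqBias.tendsto_div_of_isEquivalent hε₀ hn₀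
  have hn₁' := SeqBias.tendsto_div_of_isEquivalent (hε₀.trans hε) hn₁
  obtain ⟨D, hD, hT⟩ := SeqBias.hasRootExpansion_kappa hξ hr hXmeas hgmeas hg hε₀ hε hgε₀ hgε₁
    hn₀' hn₁'
  obtain ⟨C, hC⟩ := hhgrowth
  have hκ : 0 < SeqBias.kappa g ε₀ ε₁ m := SeqBias.kappa_pos hε₀ m
  obtain ⟨hint, hlim⟩ := SeqBias.tendsto_sqrt_mul_integral_stopRule hξ (by linarith) hXmeas hgmeas
    hε₀ hε hn₀' hn₁' (Real.sqrt_pos.2 hκ) hT hhmeas hh hC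
  refine ⟨hD.differentiableAt, hint, SeqBias.isLittleO_sub_of_tendsto_sqrt_mul ?_ hκ.le⟩
  -- The derivative of √κ in the bias coefficient is the same D that drives the expansion of √(a/T).
  rw [hV, SeqBias.biasCoeff_mul_sqrt hX2 hm hκ, hD.fderiv]
  exact hlim
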